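/- Let $0<\beta<1$, $\alpha>0$, $\gamma\ge 0$, $\nu>0$ and $d\in\mathbb N$. Write $\mathcal F\varphi(\xi)=\int_{\mathbb R^d}e^{-i\langle\xi,x\rangle}\varphi(x)\,dx$ and $E_\beta(x)=\sum_{j\ge0}x^j/\Gamma(1+\beta j)$. **Noise.** Let $\Gamma$ be a non-negative tempered measure on $\mathbb R^d$ (for instance $\Gamma(dx)=f(x)\,dx$ with $f\ge 0$, or $\Gamma=\delta_0$) which is the Fourier transform of a non-negative tempered measure $\mu$ (the spectral measure), i.e. $\int\varphi\,d\Gamma=\int\mathcal F\varphi\,d\mu$ for all Schwartz functions $\varphi$. Let $W=\{W(t,A)\}$, with $t\ge0$ and $A\subset\mathbb R^d$ bounded Borel, be a zero-mean Gaussian process on a probability space $(\Omega,\mathcal A,P)$ with $$\mathbf E[W(t,A)W(s,B)]=(t\wedge s)\int_{\mathbb R^d}\Big(\int_{\mathbb R^d}1_A(x)1_B(x-z)\,dx\Big)\Gamma(dz),$$ which equals $(t\wedge s)\int_A\int_B f(x-y)\,dy\,dx$ if $\Gamma(dx)=f(x)\,dx$. Assume (Hypothesis 2) that $\int(1+|\xi|^2)^{-\eta}\mu(d\xi)<\infty$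 for some $\eta$ with $0<\eta<\alpha+\gamma$ if $\beta<\tfrac12$, $0<\eta<\tfrac{\alpha+\gamma}2$ if $\beta=\tfrac12$, and $0<\eta<\tfrac{\alpha+\gamma}{2\beta}$ if $\beta>\tfrac12$. **Fundamental solution.** A fundamental solution of $\big(\partial_t^\beta+\nu(I-\Delta)^{\gamma/2}(-\Delta)^{\alpha/2}\big)G_t=0$ is a family $(G_t)_{t\ge0}$ of tempered distributions whose spatial Fourier transforms are continuous functions $\mathcal FG_t(\xi)$ such that, for every $\xi$, $t\mapsto\mathcal FG_t(\xi)$ is continuous on $[0,\infty)$, equals $1$ at $t=0$, and satisfies $\mathscr D_t^\beta\mathcal FG_t(\xi)+\nu|\xi|^\alpha(1+|\xi|^2)^{\gamma/2}\mathcal FG_t(\xi)=0$ for $t>0$, where $\mathscr D^\beta_tu(t)=\frac1{\Gamma(1-\beta)}\big[\frac{d}{dt}\int_0^t\frac{u(s)}{(t-s)^\beta}ds-\frac{u(0)}{t^\beta}\big]$ is the Caputo–Djrbashian derivative. **Stochastic integral.** For a deterministic integrand $\Phi$ on $\mathbb R_+\times\mathbb R^d$ (possibly distribution-valued in space), $\int\!\int\Phi\,dW$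 is the $L^2(P)$-limit of $W(\varphi_n)$, where $\varphi_n$ are linear combinations of functions $1_{[0,t]\times A}$ (with $W(1_{[0,t]\times A})=W(t,A)$) converging to $\Phi$ in the norm $\|\Phi\|^2=\int_0^\infty\!\int_{\mathbb R^d}|\mathcal F\Phi(s,\cdot)(\xi)|^2\mu(d\xi)\,ds$. **Theorem.** A fundamental solution $G$ exists. For the fundamental solution $G$ and every fixed $t\ge0$, the stochastic integrals $$U(t,x)=\int_0^t\int_{\mathbb R^d}G_{t-s}(x-y)\,W(ds,dy),\qquad x\in\mathbb R^d,$$ (the mild solution of the linear equation with additive noise and zero initial condition) are well defined, and $x\mapsto U(t,x)$ is a centered Gaussian field with spatial covariance $$\operatorname{Cov}\big(U(t,x),U(t,z)\big)=R_t(x-z)=\int_{\mathbb R^d}\mu(d\xi)\,e^{i\langle x-z,\xi\rangle}\int_0^tE_\beta^2\big(-\nu(t-s)^\beta|\xi|^\alpha(1+|\xi|^2)^{\gamma/2}\big)\,ds,\qquad x,z\in\mathbb R^d,$$ where the integral over $\xi$ converges absolutely. In particular $x\mapsto U(t,x)$ is stationary: its finite-dimensional distributions are invariant under translations of $\mathbb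 R^d$. -/

import Mathlib

open MeasureTheory ProbabilityTheory Filter Topology
open scoped NNReal ENNReal SchwartzMap FourierTransform

noncomputable section

namespace FracKinetic

/-- The state space `ℝ^d` with its Euclidean norm. -/
abbrev Space (d : ℕ) : Type := EuclideanSpace ℝ (Fin d)

/-! ### Fourier transform, with the convention `∫ e^{-i ξ·x} φ(x) dx` -/

/-- `(ℱ f)(ξ) = ∫ e^{-i⟨ξ,x⟩} f(x) dx`. -/
def fourierT {d : ℕ} (f : Space d → ℂ) (ξ : Space d) : ℂ :=
  ∫ x, Complex.exp (-(Complex.I * ((inner ℝ ξ x : ℝ) : ℂ))) * f x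

/-- The map `ξ ↦ ξ / (2π)`, used to pass from Mathlib's normalisation of the Fourier transform
to the one of `fourierT`. -/
def dilation (d : ℕ) : Space d ≃L[ℝ] Space d :=
  ContinuousLinearEquiv.smulLeft (Units.mk0 ((2 * Real.pi)⁻¹ : ℝ) (by positivity))

/-- `ℱ φ` as a Schwartz function, for a Schwartz function `φ`
(see `schwartzFourier_apply`). -/
def schwartzFourier {d : ℕ} (φ : 𝓢(Space d, ℂ)) : 𝓢(Space d, ℂ) :=
  SchwartzMap.compCLMOfContinuousLinearEquiv ℂ (dilation d) (𝓕 φ)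

theorem schwartzFourier_apply {d : ℕ} (φ : 𝓢(Space d, ℂ)) (ξ : Space d) :
    schwartzFourier φ ξ = fourierT φ ξ := by
  have h1 : schwartzFourier φ ξ = 𝓕 (φ : Space d → ℂ) ((2 * Real.pi)⁻¹ • ξ) := rfl
  rw [h1, Real.fourier_eq', fourierT]
  refine integral_congr_ae (Eventually.of_forall fun x => ?_)
  have hpi : (Real.pi : ℂ) ≠ 0 := by exact_mod_cast Real.pi_ne_zero
  simp only [smul_eq_mul, inner_smul_right, real_inner_comm]
  congr 2
  push_cast
  field_simp

/-- The Fourier transform of the tempered distribution `T` is the continuous function `g`: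
`⟨T, ℱ φ⟩ = ∫ g(ξ) φ(ξ) dξ` for all Schwartz functions `φ`.
(A continuous `g` is uniquely determined by `T`, at every point.) -/
structure HasFourier {d : ℕ} (T : 𝓢'(Space d, ℂ)) (g : Space d → ℂ) : Prop where
  continuous : Continuous g
  integrable : ∀ φ : 𝓢(Space d, ℂ), Integrable (fun ξ => g ξ * φ ξ)
  apply_fourier : ∀ φ : 𝓢(Space d, ℂ), T (schwartzFourier φ) = ∫ ξ, g ξ * φ ξ

/-- The Schwartz function `z ↦ φ(x - z)`. -/
def reflShift {d : ℕ} (x : Space d) : 𝓢(Space d, ℂ) →L[ℂ] 𝓢(Space d, ℂ) :=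
  (SchwartzMap.compSubConstCLM ℂ x).comp
    (SchwartzMap.compCLMOfContinuousLinearEquiv ℂ (ContinuousLinearEquiv.neg ℝ))

theorem reflShift_apply {d : ℕ} (x z : Space d) (φ : 𝓢(Space d, ℂ)) :
    reflShift x φ z = φ (x - z) := by
  simp [reflShift]

/-- The tempered distribution `y ↦ T(x - y)`, i.e. `φ ↦ ⟨T, φ(x - ·)⟩`. -/
def reflDist {d : ℕ} (x : Space d) (T : 𝓢'(Space d, ℂ)) : 𝓢'(Space d, ℂ) :=
  PointwiseConvergenceCLM.precomp ℂ (reflShift x) T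

theorem reflDist_apply {d : ℕ} (x : Space d) (T : 𝓢'(Space d, ℂ)) (φ : 𝓢(Space d, ℂ)) :
    reflDist x T φ = T (reflShift x φ) := rfl

/-! ### The Mittag-Leffler function and the fundamental solution -/

/-- The Mittag-Leffler function `E_β(x) = ∑_{j ≥ 0} x^j / Γ(1 + β j)`. -/
def mittagLeffler (β x : ℝ) : ℝ :=
  ∑' j : ℕ, x ^ j / Real.Gamma (1 + β * j)

/-- The symbol `|ξ|^α (1 + |ξ|²)^{γ/2}` of `(I - Δ)^{γ/2} (-Δ)^{α/2}`. -/
def symb {d : ℕ} (α γ : ℝ) (ξ : Space d) : ℝ :=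
  ‖ξ‖ ^ α * (1 + ‖ξ‖ ^ 2) ^ (γ / 2)

/-- `u` has at `t` the Caputo-Djrbashian derivative `v` of order `β ∈ (0,1)`:
`Γ(1-β)⁻¹ [ d/dt ∫₀ᵗ u(s) (t-s)^{-β} ds - u(0) t^{-β} ] = v`. -/
def HasCaputoDerivAt (β : ℝ) (u : ℝ → ℂ) (v : ℂ) (t : ℝ) : Prop :=
  ∃ D : ℂ,
    HasDerivAt (fun r : ℝ => ∫ s in (0 : ℝ)..r, u s / (((r - s) ^ β : ℝ) : ℂ)) D t ∧
    v = (D - u 0 / ((t ^ β : ℝ) : ℂ)) / ((Real.Gamma (1 - β) : ℝ) : ℂ)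

/-- `G` is the fundamental solution of
`(∂^β/∂t^β + ν (I - Δ)^{γ/2} (-Δ)^{α/2}) G_t = 0`, `G_0 = δ_0`: a family of tempered
distributions whose spatial Fourier transforms `g_t(ξ)` solve, for every frequency `ξ`, the
Cauchy problem `D_t^β g(ξ) + ν |ξ|^α (1 + |ξ|²)^{γ/2} g(ξ) = 0`, `g_0(ξ) = 1`.
Only the values `G t`, `0 ≤ t`, matter. -/
def IsFundamentalSolution {d : ℕ} (α β γ ν : ℝ) (G : ℝ → 𝓢'(Space d, ℂ)) : Prop :=
  ∃ g : ℝ → Space d → ℂ,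
    (∀ t, 0 ≤ t → HasFourier (G t) (g t)) ∧
    ∀ ξ, ContinuousOn (fun t => g t ξ) (Set.Ici 0) ∧ g 0 ξ = 1 ∧
      ∀ t, 0 < t →
        HasCaputoDerivAt β (fun r => g r ξ) (-(((ν * symb α γ ξ : ℝ) : ℂ) * g t ξ)) t

/-! ### The Gaussian noise -/

/-- The spatial covariance `Γ` of the noise (`Γ(dx) = f(x) dx`, or e.g. `Γ = δ_0` for noise that
is white in space) is a non-negative tempered measure, and it is the Fourier transform of the
non-negative tempered measure `μ`, its spectral measure: `∫ φ dΓ = ∫ ℱ φ dμ` for all Schwartz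
functions `φ`. -/
structure IsSpectralMeasure {d : ℕ} (Γ μ : Measure (Space d)) : Prop where
  temperate_cov : Γ.HasTemperateGrowth
  temperate_spectral : μ.HasTemperateGrowth
  fourier_eq : ∀ φ : 𝓢(Space d, ℂ), ∫ x, φ x ∂Γ = ∫ ξ, fourierT φ ξ ∂μ

/-- Bounded Borel subsets of `ℝ^d`. -/
abbrev BddBorel (d : ℕ) : Type :=
  {A : Set (Space d) // MeasurableSet A ∧ Bornology.IsBounded A}

/-- `W = {W(t,A)}` is a zero-mean Gaussian process with covariance
`E[W(t,A) W(s,B)] = (t ∧ s) ∫ (∫ 1_A(x) 1_B(x - z) dx) Γ(dz)`, which is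
`(t ∧ s) ∫_A ∫_B f(x - y) dy dx` when `Γ(dz) = f(z) dz`. -/
structure IsNoise {d : ℕ} {Ω : Type*} [MeasurableSpace Ω] (P : Measure Ω)
    (Γ : Measure (Space d)) (W : ℝ≥0 → BddBorel d → Ω → ℝ) : Prop where
  gaussian : IsGaussianProcess (fun p : ℝ≥0 × BddBorel d => W p.1 p.2) P
  mean_zero : ∀ t A, ∫ ω, W t A ω ∂P = 0
  covariance : ∀ t s A B, ∫ ω, W t A ω * W s B ω ∂P =
    ((min t s : ℝ≥0) : ℝ) *
      ∫ z, (∫ x, A.1.indicator (fun _ => (1 : ℝ)) x * B.1.indicator (fun _ => (1 : ℝ)) (x - z)) ∂Γ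

/-- The admissible exponents in the integrability condition on the spectral measure are those
in `(0, exponentBound α β γ)`. -/
def exponentBound (α β γ : ℝ) : ℝ :=
  if β < 1 / 2 then α + γ else if β = 1 / 2 then (α + γ) / 2 else (α + γ) / (2 * β)

/-- `∫ (1 + |ξ|²)^{-η} μ(dξ) < ∞` for some `0 < η < exponentBound α β γ`. -/
def SpectralIntegrability {d : ℕ} (α β γ : ℝ) (μ : Measure (Space d)) : Prop :=
  ∃ η : ℝ, 0 < η ∧ η < exponentBound α β γ ∧
    Integrable (fun ξ : Space d => (1 / (1 + ‖ξ‖ ^ 2)) ^ η) μ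

/-! ### The stochastic integral of deterministic integrands -/

/-- Formal linear combinations of the elementary functions `1_{[0,t] × A}`. -/
abbrev Elementary (d : ℕ) : Type := (ℝ≥0 × BddBorel d) →₀ ℝ

/-- The function `∑ c 1_{[0,t] × A}` represented by a formal linear combination. -/
def Elementary.toFun {d : ℕ} (φ : Elementary d) (s : ℝ) (x : Space d) : ℝ :=
  φ.sum fun p c => c * (Set.Icc (0 : ℝ) p.1 ×ˢ p.2.1).indicator (fun _ => (1 : ℝ)) (s, x)

/-- `W(φ) = ∑ c W(t,A)`. -/
def Elementary.integral {d : ℕ} {Ω : Type*} (W : ℝ≥0 → BddBorel d → Ω → ℝ)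
    (φ : Elementary d) (ω : Ω) : ℝ :=
  φ.sum fun p c => c * W p.1 p.2 ω

/-- Wiener integral. `X` is a version of `∫∫ Φ(s,y) W(ds,dy)`, where the (function- or
distribution-valued) integrand `Φ` on `ℝ₊ × ℝ^d` has spatial Fourier transform `h(s,ξ)`: the
integrand belongs to the closure of the elementary functions for the norm
`‖Φ‖² = ∫_{ℝ₊} ∫ |ℱ Φ(s,·)(ξ)|² μ(dξ) ds`, and `X` is the limit in `L²(P)` of `W(φ_n)` for
elementary functions `φ_n` converging to `Φ` in that norm. -/
def IsWienerIntegral {d : ℕ} {Ω : Type*} [MeasurableSpace Ω] (P : Measure Ω)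
    (μ : Measure (Space d)) (W : ℝ≥0 → BddBorel d → Ω → ℝ) (h : ℝ → Space d → ℂ)
    (X : Ω → ℝ) : Prop :=
  MemLp (fun p : ℝ × Space d => h p.1 p.2) 2 ((volume.restrict (Set.Ici (0 : ℝ))).prod μ) ∧
  MemLp X 2 P ∧
  ∃ φ : ℕ → Elementary d,
    Tendsto (fun n => eLpNorm
      (fun p : ℝ × Space d =>
        fourierT (fun x => (((φ n).toFun p.1 x : ℝ) : ℂ)) p.2 - h p.1 p.2)
      2 ((volume.restrict (Set.Ici (0 : ℝ))).prod μ)) atTop (𝓝 0) ∧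
    Tendsto (fun n => eLpNorm (fun ω => (φ n).integral W ω - X ω) 2 P) atTop (𝓝 0)

/-- `X` is a version of `U(t,x) = ∫₀ᵗ ∫ G_{t-s}(x - y) W(ds,dy)`. -/
def IsStochasticConvolution {d : ℕ} {Ω : Type*} [MeasurableSpace Ω] (P : Measure Ω)
    (μ : Measure (Space d)) (W : ℝ≥0 → BddBorel d → Ω → ℝ) (G : ℝ → 𝓢'(Space d, ℂ))
    (t : ℝ) (x : Space d) (X : Ω → ℝ) : Prop :=
  ∃ h : ℝ → Space d → ℂ,
    (∀ s ∈ Set.Icc 0 t, HasFourier (reflDist x (G (t - s))) (h s)) ∧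
    (∀ s ∉ Set.Icc 0 t, h s = 0) ∧
    IsWienerIntegral P μ W h X

/-- Strict stationarity of a random field: all finite-dimensional distributions are invariant
under spatial translations. -/
def IsStationaryField {d : ℕ} {Ω : Type*} [MeasurableSpace Ω] (P : Measure Ω)
    (U : Space d → Ω → ℝ) : Prop :=
  ∀ (a : Space d) (n : ℕ) (x : Fin n → Space d),
    IdentDistrib (fun ω i => U (x i + a) ω) (fun ω i => U (x i) ω) P P

end FracKinetic

end

/-! Taking Fourier transforms in space turns the equation for `G` into one scalar Caputo problem per
frequency, with rate `l = ν * symb α γ ξ`. Its unique continuous solution is `E_β(-l t^β)`: the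
Mittag-Leffler series solves it termwise by the Beta integral, and the primitive of a difference of
two solutions satisfies a homogeneous Volterra equation, whose iterated bounds are the terms of a
convergent Mittag-Leffler series (`caputo_unique`). Hence the integrand `1_{[0,t]}(s) G_{t-s}(x -
·)` necessarily has spatial transform `canon`, that is `e^{-i⟨x,ξ⟩} E_β(-ν (t-s)^β symb)`, whichever
fundamental solution is taken.

The stochastic side is a Hilbert space isometry. Testing the spectral relation `∫ φ dΓ = ∫ ℱφ dμ` on
the convolution of `f` with the reflected conjugate of `g` gives `∫ ℱf conj(ℱg) dμ = ∫ corr f g dΓ`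
for Schwartz functions. Mollification and dominated convergence extend it to bounded functions of
bounded support, in particular to indicators (`isoPair_bddSupp`). The covariance of `W` is then
exactly the `L²(ds μ(dξ))` inner product of the transforms of elementary functions (`inner_elemLp`),
so the integral extends to their closure, and limits stay centered and jointly Gaussian.

Two facts place `canon` in that closure. First, it is square integrable. Comparison with the
Volterra equation shows that `y ↦ E_β(-y)` is positive and decreasing on `[0, ∞)`, hence
`O(1/(1+y))`; so its square is `O((1+y)^{-p})` for each `p ≤ 2`. With `p = 2η/(α+γ)` the square of
the kernel is at most a multiple of `τ^{-βp} (1+|ξ|²)^{-η}`, and the three cases of the hypothesis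
give both `p ≤ 2` and the time integrability condition `βp < 1` (`kern_sq_le`). Second, real
elementary functions are dense among integrands with Hermitian transform (`approx_hermitian`), and
step functions in time converge to `canon` by monotonicity of the kernel (`approx_canon`).

The covariance is the inner product of two such integrands, evaluated by Fubini. It depends on `x -
z` only, and a centered Gaussian law is determined by its covariances, which gives stationarity. -/

noncomputable section

namespace FracKinetic

/-! ### The Beta integral and the growth of the Gamma function -/

/-- Euler's Beta integral, rescaled. It is the one computation behind fractional integration of
powers: a kernel of order `a` sends `s^{b-1}` to a multiple of `t^{a+b-1}`. -/
theorem integral_rpow_mul_rpow {a b t : ℝ} (ha : 0 < a) (hb : 0 < b) (ht : 0 < t) :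
    ∫ s in (0 : ℝ)..t, (t - s) ^ (a - 1) * s ^ (b - 1) =
      t ^ (a + b - 1) * (Real.Gamma a * Real.Gamma b / Real.Gamma (a + b)) := by
  have h := Complex.betaIntegral_scaled (b : ℂ) (a : ℂ) ht
  rw [Complex.betaIntegral_eq_Gamma_mul_div _ _ (by simpa) (by simpa)] at h
  have h2 : ∫ x in (0 : ℝ)..t, (x : ℂ) ^ ((b : ℂ) - 1) * ((t : ℂ) - x) ^ ((a : ℂ) - 1) =
      ((∫ s in (0 : ℝ)..t, (t - s) ^ (a - 1) * s ^ (b - 1) : ℝ) : ℂ) := by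
    rw [← intervalIntegral.integral_ofReal]
    refine intervalIntegral.integral_congr fun x hx => ?_
    rw [Set.uIcc_of_le ht.le] at hx
    rw [Complex.ofReal_mul, Complex.ofReal_cpow (by linarith [hx.2]), Complex.ofReal_cpow hx.1]
    push_cast
    ring
  rw [h2] at h
  have h3 : ((b : ℂ) + a - 1) = ((a + b - 1 : ℝ) : ℂ) := by push_cast; ring
  have h4 : ((b : ℂ) + a) = ((a + b : ℝ) : ℂ) := by push_cast; ring
  rw [h3, h4, Complex.Gamma_ofReal, Complex.Gamma_ofReal, Complex.Gamma_ofReal,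
    ← Complex.ofReal_cpow ht.le] at h
  have h5 : (∫ s in (0 : ℝ)..t, (t - s) ^ (a - 1) * s ^ (b - 1)) =
      t ^ (a + b - 1) * (Real.Gamma b * Real.Gamma a / Real.Gamma (a + b)) := by
    exact_mod_cast h
  rw [h5, mul_comm (Real.Gamma b)]

theorem intervalIntegrable_rpow_mul_rpow {a b t : ℝ} (ha : 0 < a) (hb : 0 < b) (ht : 0 < t) :
    IntervalIntegrable (fun s : ℝ => (t - s) ^ (a - 1) * s ^ (b - 1)) volume 0 t := by
  by_contra h
  have h1 := integral_rpow_mul_rpow ha hb ht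
  -- A non-integrable function has integral `0` by convention, whereas the Beta value is positive;
  -- so integrability follows from the formula itself.
  rw [intervalIntegral.integral_undef h] at h1
  have := Real.Gamma_pos_of_pos ha
  have := Real.Gamma_pos_of_pos hb
  have := Real.Gamma_pos_of_pos (add_pos ha hb)
  have : 0 < t ^ (a + b - 1) * (Real.Gamma a * Real.Gamma b / Real.Gamma (a + b)) := by positivity
  linarith

theorem intervalIntegrable_sub_rpow {a t : ℝ} (ha : 0 < a) :
    IntervalIntegrable (fun s : ℝ => (t - s) ^ (a - 1)) volume 0 t := by
  have h : IntervalIntegrable (fun s : ℝ => s ^ (a - 1)) volume t 0 :=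
    intervalIntegral.intervalIntegrable_rpow' (by linarith)
  simpa using h.comp_sub_left t

theorem integral_sub_rpow {a t : ℝ} (ha : 0 < a) :
    ∫ s in (0 : ℝ)..t, (t - s) ^ (a - 1) = t ^ a / a := by
  rw [intervalIntegral.integral_comp_sub_left (fun s : ℝ => s ^ (a - 1)) t]
  simp only [sub_self, sub_zero]
  rw [integral_rpow (Or.inl (by linarith))]
  simp [Real.zero_rpow ha.ne']

/-- `Γ(x + 1) ≤ (x + β)^(1 - β) Γ(x + β)`. -/
theorem Gamma_add_one_le {x β : ℝ} (hx : 0 < x) (hβ0 : 0 < β) (hβ1 : β < 1) :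
    Real.Gamma (x + 1) ≤ (x + β) ^ (1 - β) * Real.Gamma (x + β) := by
  -- Log-convexity of the Gamma function, with `x + 1` written as the convex combination of `x + β`
  -- and `x + β + 1` with weights `β` and `1 - β`.
  have h := Real.Gamma_mul_add_mul_le_rpow_Gamma_mul_rpow_Gamma (s := x + β) (t := x + β + 1)
    (by linarith) (by linarith) hβ0 (sub_pos.2 hβ1) (by ring)
  have e : β * (x + β) + (1 - β) * (x + β + 1) = x + 1 := by ring
  rw [e, Real.Gamma_add_one (by linarith : x + β ≠ 0)] at h
  have hG := Real.Gamma_pos_of_pos (by linarith : 0 < x + β)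
  rw [Real.mul_rpow (by linarith) hG.le] at h
  calc _ ≤ _ := h
    _ = (x + β) ^ (1 - β) * (Real.Gamma (x + β) ^ β * Real.Gamma (x + β) ^ (1 - β)) := by ring
    _ = _ := by rw [← Real.rpow_add hG]; simp

/-- With `x = 1 + βj` the ratio is `Γ(x)/Γ(x+β) ≤ (x+β)^{1-β}/x ≤ 2^{1-β} x^{-β}`. This feeds the
ratio test for the Mittag-Leffler series. -/
theorem tendsto_Gamma_ratio {β : ℝ} (hβ0 : 0 < β) (hβ1 : β < 1) :
    Tendsto (fun j : ℕ => Real.Gamma (1 + β * j) / Real.Gamma (1 + β * (j + 1 : ℕ))) atTop (𝓝 0) := by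
  have hlim : Tendsto (fun j : ℕ => (2 : ℝ) ^ (1 - β) * (1 + β * (j : ℝ)) ^ (-β)) atTop (𝓝 0) := by
    have h1 : Tendsto (fun j : ℕ => 1 + β * (j : ℝ)) atTop atTop :=
      tendsto_atTop_add_const_left _ _ (tendsto_natCast_atTop_atTop.const_mul_atTop hβ0)
    simpa using ((tendsto_rpow_neg_atTop hβ0).comp h1).const_mul ((2 : ℝ) ^ (1 - β))
  refine squeeze_zero (fun j => ?_) (fun j => ?_) hlim
  · exact div_nonneg (Real.Gamma_pos_of_pos (by positivity)).le
      (Real.Gamma_pos_of_pos (by positivity)).le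
  · set x : ℝ := 1 + β * j with hx
    have hx1 : 1 ≤ x := by rw [hx]; nlinarith [(Nat.cast_nonneg j : (0 : ℝ) ≤ j)]
    have hx0 : 0 < x := by linarith
    have e : 1 + β * ((j + 1 : ℕ) : ℝ) = x + β := by rw [hx]; push_cast; ring
    rw [e]
    have hG := Real.Gamma_pos_of_pos (by linarith : 0 < x + β)
    rw [div_le_iff₀ hG]
    have h := Gamma_add_one_le hx0 hβ0 hβ1
    rw [Real.Gamma_add_one hx0.ne'] at h
    have h2 : (x + β) ^ (1 - β) ≤ 2 ^ (1 - β) * x ^ (1 - β) := by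
      rw [← Real.mul_rpow (by norm_num) hx0.le]
      exact Real.rpow_le_rpow (by linarith) (by linarith) (by linarith)
    have h3 : x * Real.Gamma x ≤ 2 ^ (1 - β) * x ^ (1 - β) * Real.Gamma (x + β) :=
      h.trans (mul_le_mul_of_nonneg_right h2 hG.le)
    have h4 : x ^ (1 - β) = x * x ^ (-β) := by
      rw [show 1 - β = 1 + -β by ring, Real.rpow_add hx0, Real.rpow_one]
    rw [h4] at h3
    have : x * Real.Gamma x ≤ x * (2 ^ (1 - β) * x ^ (-β) * Real.Gamma (x + β)) := by
      linarith
    exact le_of_mul_le_mul_left this hx0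

theorem summable_mittagLeffler {β : ℝ} (hβ0 : 0 < β) (hβ1 : β < 1) (x : ℝ) :
    Summable fun j : ℕ => x ^ j / Real.Gamma (1 + β * j) := by
  by_cases hx : x = 0
  · refine summable_of_ne_finset_zero (s := {0}) fun j hj => ?_
    have : j ≠ 0 := by simpa using hj
    simp [hx, this]
  have hG : ∀ j : ℕ, 0 < Real.Gamma (1 + β * j) := fun j => Real.Gamma_pos_of_pos (by positivity)
  refine summable_of_ratio_test_tendsto_lt_one (l := 0) one_pos
    (Eventually.of_forall fun j => div_ne_zero (pow_ne_zero _ hx) (hG j).ne') ?_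
  have := (tendsto_Gamma_ratio hβ0 hβ1).const_mul |x|
  rw [mul_zero] at this
  refine this.congr fun j => ?_
  rw [norm_div, norm_div, Real.norm_of_nonneg (hG _).le, Real.norm_of_nonneg (hG _).le, norm_pow,
    norm_pow, Real.norm_eq_abs, pow_succ]
  have := (hG j).ne'
  have := (hG (j + 1)).ne'
  have : |x| ≠ 0 := by simpa
  field_simp

theorem continuous_mittagLeffler {β : ℝ} (hβ0 : 0 < β) (hβ1 : β < 1) :
    Continuous (mittagLeffler β) := by
  rw [continuous_iff_continuousAt]
  intro x
  have h : ContinuousOn (mittagLeffler β) (Metric.ball 0 (|x| + 1)) := by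
    refine continuousOn_tsum (u := fun j : ℕ => (|x| + 1) ^ j / Real.Gamma (1 + β * j))
      (fun j => (Continuous.continuousOn (by fun_prop)))
      (summable_mittagLeffler hβ0 hβ1 _) fun j y hy => ?_
    have hG : 0 < Real.Gamma (1 + β * j) := Real.Gamma_pos_of_pos (by positivity)
    rw [norm_div, norm_pow, Real.norm_of_nonneg hG.le]
    gcongr
    simpa using (mem_ball_zero_iff.1 hy).le
  exact h.continuousAt (Metric.isOpen_ball.mem_nhds (by simp))

theorem mittagLeffler_zero (β : ℝ) : mittagLeffler β 0 = 1 := by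
  rw [mittagLeffler, tsum_eq_single 0 (fun j hj => by simp [hj])]
  simp

/-! ### Relaxation function `t ↦ E_β(-λ t^β)` -/

/-- `t ↦ E_β(-λ t^β)`. -/
def relax (β l t : ℝ) : ℝ := mittagLeffler β (-(l * t ^ β))

theorem continuous_relax {β : ℝ} (hβ0 : 0 < β) (hβ1 : β < 1) (l : ℝ) :
    Continuous (relax β l) := by
  have h := continuous_mittagLeffler hβ0 hβ1
  have h2 : Continuous fun t : ℝ => t ^ β := Real.continuous_rpow_const hβ0.le
  unfold relax
  fun_prop

theorem relax_zero {β : ℝ} (hβ0 : 0 < β) (l : ℝ) : relax β l 0 = 1 := by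
  simp [relax, Real.zero_rpow hβ0.ne', mittagLeffler_zero]

/-- Termwise integration of the Mittag-Leffler series. -/
theorem hasSum_integral_relax {β : ℝ} (hβ0 : 0 < β) (hβ1 : β < 1) (l : ℝ) {t : ℝ} (ht : 0 ≤ t)
    {k : ℝ → ℝ} (hk : IntervalIntegrable k volume 0 t) :
    HasSum (fun j : ℕ => (-l) ^ j / Real.Gamma (1 + β * j) *
      ∫ s in (0 : ℝ)..t, k s * s ^ (β * j)) (∫ s in (0 : ℝ)..t, k s * relax β l s) := by
  have hG : ∀ j : ℕ, 0 < Real.Gamma (1 + β * j) := fun j => Real.Gamma_pos_of_pos (by positivity)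
  have hpow : ∀ j : ℕ, ∀ s : ℝ, 0 ≤ s → (-(l * s ^ β)) ^ j = (-l) ^ j * s ^ (β * j) := by
    intro j s hs
    rw [← neg_mul, mul_pow, ← Real.rpow_natCast (s ^ β), ← Real.rpow_mul hs]
  have hcont : ∀ j : ℕ, Continuous fun s : ℝ => s ^ (β * j) := fun j =>
    Real.continuous_rpow_const (by positivity)
  simp_rw [← intervalIntegral.integral_const_mul]
  refine intervalIntegral.hasSum_integral_of_dominated_convergence
    -- Since `s^{βj} ≤ t^{βj}` on `(0, t]`, the majorants sum to `|k|` times the constant `E_β(|l|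
    -- t^β)`.
    (fun j s => |k s| * ((|l| * t ^ β) ^ j / Real.Gamma (1 + β * j))) (fun j => ?_)
    (fun j => ?_) ?_ ?_ ?_
  · exact ((hk.aestronglyMeasurable_restrict_uIoc.mul
      (hcont j).aestronglyMeasurable).const_mul _)
  · refine Eventually.of_forall fun s hs => ?_
    rw [Set.uIoc_of_le ht] at hs
    rw [norm_mul, norm_mul, norm_div, Real.norm_of_nonneg (hG j).le, norm_pow, norm_neg,
      Real.norm_of_nonneg (Real.rpow_nonneg hs.1.le _), Real.norm_eq_abs, Real.norm_eq_abs]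
    have : s ^ (β * j) ≤ (t ^ β) ^ j := by
      rw [← Real.rpow_natCast (t ^ β), ← Real.rpow_mul ht]
      exact Real.rpow_le_rpow hs.1.le hs.2 (by positivity)
    rw [mul_pow]
    calc |l| ^ j / Real.Gamma (1 + β * j) * (|k s| * s ^ (β * j))
        ≤ |l| ^ j / Real.Gamma (1 + β * j) * (|k s| * (t ^ β) ^ j) := by
          have := (hG j).le
          gcongr
      _ = _ := by ring
  · exact Eventually.of_forall fun s _ => (summable_mittagLeffler hβ0 hβ1 _).mul_left _
  · simp_rw [tsum_mul_left]
    exact hk.abs.mul_const _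
  · refine Eventually.of_forall fun s hs => ?_
    rw [Set.uIoc_of_le ht] at hs
    have h := ((summable_mittagLeffler hβ0 hβ1 (-(l * s ^ β))).hasSum).mul_left (k s)
    refine (congrArg (HasSum · _) (funext fun j => ?_)).mpr h
    rw [hpow j s hs.1.le]
    ring

/-- The Volterra equation of `t ↦ E_β(-λ t^β)`. -/
theorem relax_volterra {β : ℝ} (hβ0 : 0 < β) (hβ1 : β < 1) (l : ℝ) {t : ℝ} (ht : 0 ≤ t) :
    relax β l t = 1 - l / Real.Gamma β * ∫ s in (0 : ℝ)..t, (t - s) ^ (β - 1) * relax β l s := by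
  rcases ht.eq_or_lt with rfl | ht'
  · simp [relax_zero hβ0]
  have hG : ∀ j : ℕ, 0 < Real.Gamma (1 + β * j) := fun j => Real.Gamma_pos_of_pos (by positivity)
  have hGβ := Real.Gamma_pos_of_pos hβ0
  have h := (hasSum_integral_relax hβ0 hβ1 l ht (intervalIntegrable_sub_rpow hβ0)).mul_left
    (-l / Real.Gamma β)
  have h2 : HasSum (fun j : ℕ => (-(l * t ^ β)) ^ (j + 1) / Real.Gamma (1 + β * (j + 1 : ℕ)))
      (-l / Real.Gamma β * ∫ s in (0 : ℝ)..t, (t - s) ^ (β - 1) * relax β l s) := by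
    -- Integration against the kernel of order `β` turns the `j`-th term of the series into the
    -- `(j+1)`-st, so only the term `j = 0`, equal to `1`, is missing from the result.
    refine (congrArg (HasSum · _) (funext fun j => ?_)).mpr h
    have e := integral_rpow_mul_rpow (b := 1 + β * j) hβ0 (by positivity) ht'
    rw [show 1 + β * (j : ℝ) - 1 = β * j by ring] at e
    rw [e]
    have e2 : β + (1 + β * (j : ℝ)) = 1 + β * (j + 1 : ℕ) := by push_cast; ring
    rw [e2, show 1 + β * ((j + 1 : ℕ) : ℝ) - 1 = β * (j + 1 : ℕ) by ring,
      Real.rpow_mul ht, Real.rpow_natCast, ← neg_mul, mul_pow, pow_succ (-l)]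
    have := (hG j).ne'
    have := (hG (j + 1)).ne'
    field_simp
  have h3 := (summable_mittagLeffler hβ0 hβ1 (-(l * t ^ β))).hasSum
  have h4 := (hasSum_nat_add_iff' 1).2 h3
  have h5 := h4.unique h2
  simp only [Finset.range_one, Finset.sum_singleton, pow_zero, Nat.cast_zero, mul_zero, add_zero,
    Real.Gamma_one, div_one] at h5
  have h6 : relax β l t - 1 = -l / Real.Gamma β *
    ∫ s in (0 : ℝ)..t, (t - s) ^ (β - 1) * relax β l s := h5
  have h7 : -l / Real.Gamma β = -(l / Real.Gamma β) := by ring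
  rw [h7] at h6
  linarith

end FracKinetic
end

noncomputable section

namespace FracKinetic

/-! ### The Caputo equation -/

/-- This is the function differentiated in the Caputo derivative. Termwise, the `(j+1)`-st term on
the left is a fixed multiple of the `j`-th term of `∫ relax`. The remaining term `j = 0` gives
`r^{1-β}/(1-β)`, whose derivative is cancelled by the correction `u(0) t^{-β}`. The exponent is kept
as `(1 - β) - 1` to match the Beta integral. -/
theorem integral_sub_rpow_neg_mul_relax {β : ℝ} (hβ0 : 0 < β) (hβ1 : β < 1) (l : ℝ) {r : ℝ}
    (hr : 0 < r) :
    ∫ s in (0 : ℝ)..r, (r - s) ^ ((1 - β) - 1) * relax β l s =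
      r ^ (1 - β) / (1 - β) - l * Real.Gamma (1 - β) * ∫ s in (0 : ℝ)..r, relax β l s := by
  have hβ : 0 < 1 - β := by linarith
  have hG : ∀ j : ℕ, 0 < Real.Gamma (1 + β * j) := fun j => Real.Gamma_pos_of_pos (by positivity)
  have hG1 := Real.Gamma_pos_of_pos hβ
  have h := hasSum_integral_relax hβ0 hβ1 l hr.le (intervalIntegrable_sub_rpow (t := r) hβ)
  have h1 := (hasSum_integral_relax hβ0 hβ1 l hr.le (k := fun _ => 1)
    intervalIntegrable_const).mul_left (-l * Real.Gamma (1 - β))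
  have h2 := (hasSum_nat_add_iff' 1).2 h
  have e : ∀ j : ℕ, ∫ s in (0 : ℝ)..r, (r - s) ^ ((1 - β) - 1) * s ^ (β * j) =
      r ^ (1 - β + β * j) * (Real.Gamma (1 - β) * Real.Gamma (1 + β * j) /
        Real.Gamma (1 - β + (1 + β * j))) := by
    intro j
    have e := integral_rpow_mul_rpow (b := 1 + β * j) hβ (by positivity) hr
    rw [show 1 + β * (j : ℝ) - 1 = β * j by ring] at e
    rw [e]
    congr 2
    ring
  have h3 := h2.unique ((congrArg (HasSum · _) (funext fun j => ?_)).mpr h1)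
  · simp only [Finset.range_one, Finset.sum_singleton, one_mul, e] at h3
    have hΓ : Real.Gamma (1 - β + 1) = (1 - β) * Real.Gamma (1 - β) := Real.Gamma_add_one hβ.ne'
    simp only [pow_zero, Nat.cast_zero, mul_zero, add_zero, Real.Gamma_one, div_one, hΓ, one_mul,
      mul_one] at h3
    have h4 : r ^ (1 - β) * (Real.Gamma (1 - β) / ((1 - β) * Real.Gamma (1 - β))) =
        r ^ (1 - β) / (1 - β) := by
      field_simp
    rw [h4] at h3
    linarith
  · rw [e]
    have hb : 0 < 1 + β * (j : ℝ) := by positivity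
    have i1 : ∫ s in (0 : ℝ)..r, (1 : ℝ) * s ^ (β * (j : ℝ)) =
        r ^ (1 + β * (j : ℝ)) / (1 + β * j) := by
      simp only [one_mul]
      rw [integral_rpow (Or.inl (by linarith [mul_nonneg hβ0.le (Nat.cast_nonneg (α := ℝ) j)])),
        Real.zero_rpow (by positivity)]
      rw [add_comm (β * (j : ℝ))]
      ring
    rw [i1]
    have e3 : 1 - β + (1 + β * ((j + 1 : ℕ) : ℝ)) = (1 + β * j) + 1 := by push_cast; ring
    have e4 : 1 - β + β * ((j + 1 : ℕ) : ℝ) = 1 + β * j := by push_cast; ring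
    rw [e3, e4, Real.Gamma_add_one hb.ne']
    have := (hG j).ne'
    have := (hG (j + 1)).ne'
    field_simp
    ring

theorem continuous_ofReal_relax {β : ℝ} (hβ0 : 0 < β) (hβ1 : β < 1) (l : ℝ) :
    Continuous fun t => (relax β l t : ℂ) :=
  Complex.continuous_ofReal.comp (continuous_relax hβ0 hβ1 l)

/-- `t ↦ E_β(-λ t^β)` solves `D^β u + λ u = 0`. -/
theorem hasCaputoDerivAt_relax {β : ℝ} (hβ0 : 0 < β) (hβ1 : β < 1) (l : ℝ) {t : ℝ} (ht : 0 < t) :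
    HasCaputoDerivAt β (fun r => (relax β l r : ℂ)) (-((l : ℂ) * relax β l t)) t := by
  have hβ : 0 < 1 - β := by linarith
  have hG1 := Real.Gamma_pos_of_pos hβ
  refine ⟨((t ^ (-β) - l * Real.Gamma (1 - β) * relax β l t : ℝ) : ℂ), ?_, ?_⟩
  · have hd : HasDerivAt (fun r : ℝ => r ^ (1 - β) / (1 - β) -
        l * Real.Gamma (1 - β) * ∫ s in (0 : ℝ)..r, relax β l s)
        (t ^ (-β) - l * Real.Gamma (1 - β) * relax β l t) t := by
      refine HasDerivAt.sub ?_ (HasDerivAt.const_mul _ ?_)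
      · have := (Real.hasDerivAt_rpow_const (x := t) (p := 1 - β) (Or.inl ht.ne')).div_const (1 - β)
        refine this.congr_deriv ?_
        rw [show 1 - β - 1 = -β by ring]
        field_simp
      · exact intervalIntegral.integral_hasDerivAt_right
          ((continuous_relax hβ0 hβ1 l).intervalIntegrable _ _)
          ((continuous_relax hβ0 hβ1 l).stronglyMeasurableAtFilter _ _)
          (continuous_relax hβ0 hβ1 l).continuousAt
    refine hd.ofReal_comp.congr_of_eventuallyEq ?_
    filter_upwards [lt_mem_nhds ht] with r hr
    rw [← integral_sub_rpow_neg_mul_relax hβ0 hβ1 l hr, ← intervalIntegral.integral_ofReal]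
    refine intervalIntegral.integral_congr fun s hs => ?_
    rw [Set.uIcc_of_le hr.le] at hs
    rw [show 1 - β - 1 = -β by ring, Real.rpow_neg (by linarith [hs.2])]
    push_cast
    ring
  · simp only
    rw [relax_zero hβ0, Real.rpow_neg ht.le]
    have : ((t ^ β : ℝ) : ℂ) ≠ 0 := by exact_mod_cast (Real.rpow_pos_of_pos ht β).ne'
    have : ((Real.Gamma (1 - β) : ℝ) : ℂ) ≠ 0 := by exact_mod_cast hG1.ne'
    push_cast
    field_simp
    ring

/-! ### Uniqueness for the Caputo equation -/

/-- Each substitution of the current bound into the equation produces, by the Beta integral, the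
next term of the series of `E_β(‖c‖ Γ(β) t^β)`. As that series converges, its terms tend to `0` and
`V` vanishes. -/
theorem volterra_bound {β : ℝ} (hβ0 : 0 < β) {c : ℂ} {V : ℝ → ℂ} {M T : ℝ}
    (hM : ∀ t ∈ Set.Icc 0 T, ‖V t‖ ≤ M)
    (hV : ∀ t ∈ Set.Icc 0 T, V t = c * ∫ s in (0 : ℝ)..t, (((t - s) ^ (β - 1) : ℝ) : ℂ) * V s)
    (n : ℕ) : ∀ t ∈ Set.Icc 0 T,
      ‖V t‖ ≤ M * ((‖c‖ * Real.Gamma β * t ^ β) ^ n / Real.Gamma (1 + β * n)) := by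
  induction n with
  | zero => intro t ht; simpa using hM t ht
  | succ n ih =>
    intro t ht
    have hM0 : 0 ≤ M := (norm_nonneg _).trans (hM t ht)
    have hG : ∀ j : ℕ, 0 < Real.Gamma (1 + β * j) := fun j => Real.Gamma_pos_of_pos (by positivity)
    have hGβ := Real.Gamma_pos_of_pos hβ0
    rcases ht.1.eq_or_lt with h0 | h0
    · rw [hV t ht, ← h0]
      simp [Real.zero_rpow hβ0.ne']
    have hint := (intervalIntegrable_rpow_mul_rpow (b := 1 + β * n) hβ0 (by positivity) h0).const_mul
      (M * (‖c‖ * Real.Gamma β) ^ n / Real.Gamma (1 + β * n))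
    have h1 : ‖∫ s in (0 : ℝ)..t, (((t - s) ^ (β - 1) : ℝ) : ℂ) * V s‖ ≤
        ∫ s in (0 : ℝ)..t, M * (‖c‖ * Real.Gamma β) ^ n / Real.Gamma (1 + β * n) *
          ((t - s) ^ (β - 1) * s ^ (1 + β * (n : ℝ) - 1)) := by
      refine intervalIntegral.norm_integral_le_of_norm_le h0.le (Eventually.of_forall fun s hs => ?_)
        hint
      have hk : 0 ≤ (t - s) ^ (β - 1) := Real.rpow_nonneg (by linarith [hs.2]) _
      rw [norm_mul, Complex.norm_real, Real.norm_of_nonneg hk]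
      have := ih s ⟨hs.1.le, hs.2.trans ht.2⟩
      calc _ ≤ (t - s) ^ (β - 1) *
            (M * ((‖c‖ * Real.Gamma β * s ^ β) ^ n / Real.Gamma (1 + β * n))) := by gcongr
        _ = _ := by
          rw [mul_pow, show 1 + β * (n : ℝ) - 1 = β * n by ring, Real.rpow_mul hs.1.le,
            Real.rpow_natCast]
          ring
    rw [hV t ht, norm_mul]
    calc _ ≤ ‖c‖ * ∫ s in (0 : ℝ)..t, M * (‖c‖ * Real.Gamma β) ^ n / Real.Gamma (1 + β * n) *
          ((t - s) ^ (β - 1) * s ^ (1 + β * (n : ℝ) - 1)) := by gcongr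
      _ = _ := by
        rw [intervalIntegral.integral_const_mul, integral_rpow_mul_rpow hβ0 (by positivity) h0]
        have e2 : β + (1 + β * (n : ℝ)) = 1 + β * (n + 1 : ℕ) := by push_cast; ring
        rw [e2, show 1 + β * ((n + 1 : ℕ) : ℝ) - 1 = β * (n + 1 : ℕ) by ring,
          Real.rpow_mul h0.le, Real.rpow_natCast, mul_pow _ _ (n + 1), pow_succ (‖c‖ * Real.Gamma β)]
        have := (hG n).ne'
        have := (hG (n + 1)).ne'
        field_simp

theorem volterra_eq_zero {β : ℝ} (hβ0 : 0 < β) (hβ1 : β < 1) {c : ℂ} {V : ℝ → ℂ} {M T : ℝ}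
    (hM : ∀ t ∈ Set.Icc 0 T, ‖V t‖ ≤ M)
    (hV : ∀ t ∈ Set.Icc 0 T, V t = c * ∫ s in (0 : ℝ)..t, (((t - s) ^ (β - 1) : ℝ) : ℂ) * V s) :
    ∀ t ∈ Set.Icc 0 T, V t = 0 := by
  intro t ht
  have h := ((summable_mittagLeffler hβ0 hβ1
    (‖c‖ * Real.Gamma β * t ^ β)).tendsto_atTop_zero).const_mul M
  rw [mul_zero] at h
  exact norm_le_zero_iff.1 (ge_of_tendsto' h fun n => volterra_bound hβ0 hM hV n t ht)

/-- A Beta integral with complementary orders: the power of `t - r` has exponent `a + (1-a) - 1 =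
0`, so the value does not depend on the end points. This is why kernels of orders `a` and `1 - a`
compose to plain integration. -/
theorem integral_kernel_mul_kernel {a r t : ℝ} (ha0 : 0 < a) (ha1 : a < 1) (hrt : r < t) :
    ∫ s in r..t, (t - s) ^ (a - 1) * (s - r) ^ ((1 - a) - 1) =
      Real.Gamma a * Real.Gamma (1 - a) := by
  have h := integral_rpow_mul_rpow ha0 (sub_pos.2 ha1) (sub_pos.2 hrt)
  have e := intervalIntegral.integral_comp_sub_right
    (fun s : ℝ => (t - r - s) ^ (a - 1) * s ^ ((1 - a) - 1)) r (a := r) (b := t)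
  simp only [sub_self, sub_sub_sub_cancel_right] at e
  rw [e, h]
  simp

theorem intervalIntegrable_kernel_mul_kernel {a r t : ℝ} (ha0 : 0 < a) (ha1 : a < 1)
    (hrt : r < t) :
    IntervalIntegrable (fun s => (t - s) ^ (a - 1) * (s - r) ^ ((1 - a) - 1)) volume r t := by
  by_contra h
  have h1 := integral_kernel_mul_kernel ha0 ha1 hrt
  rw [intervalIntegral.integral_undef h] at h1
  have := mul_pos (Real.Gamma_pos_of_pos ha0) (Real.Gamma_pos_of_pos (sub_pos.2 ha1))
  linarith

/-- `I^a I^(1-a) = I^1` for fractional integrals. -/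
theorem fractional_integral_comp {a t : ℝ} (ha0 : 0 < a) (ha1 : a < 1) (ht : 0 ≤ t)
    {v : ℝ → ℂ} (hv : Continuous v) :
    ∫ s in (0 : ℝ)..t, (((t - s) ^ (a - 1) : ℝ) : ℂ) *
        ∫ r in (0 : ℝ)..s, (((s - r) ^ ((1 - a) - 1) : ℝ) : ℂ) * v r =
      ((Real.Gamma a * Real.Gamma (1 - a) : ℝ) : ℂ) * ∫ r in (0 : ℝ)..t, v r := by
  set ν : Measure ℝ := volume.restrict (Set.Ioc 0 t) with hν
  let K : ℝ × ℝ → ℝ := fun p => (t - p.1) ^ (a - 1) * (p.1 - p.2) ^ ((1 - a) - 1)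
  -- The integrand cut to the triangle `r < s`, so that both iterated integrals run over the square
  -- `(0, t]²` and Fubini applies.
  let F : ℝ × ℝ → ℂ := {p : ℝ × ℝ | p.2 < p.1}.indicator fun p => ((K p : ℝ) : ℂ) * v p.2
  have hKm : Measurable K := by
    have h1 : Measurable fun p : ℝ × ℝ => (t - p.1) ^ (a - 1) :=
      (measurable_const.sub measurable_fst).pow_const _
    have h2 : Measurable fun p : ℝ × ℝ => (p.1 - p.2) ^ ((1 - a) - 1) :=
      (measurable_fst.sub measurable_snd).pow_const _
    exact h1.mul h2
  have hset : MeasurableSet {p : ℝ × ℝ | p.2 < p.1} :=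
    measurableSet_lt measurable_snd measurable_fst
  have hFm : Measurable F :=
    ((Complex.measurable_ofReal.comp hKm).mul (hv.measurable.comp measurable_snd)).indicator hset
  have hF1 : ∀ s r, r < s → F (s, r) = ((K (s, r) : ℝ) : ℂ) * v r := fun s r h =>
    Set.indicator_of_mem (s := {p : ℝ × ℝ | p.2 < p.1}) h _
  have hF0 : ∀ s r, ¬ r < s → F (s, r) = 0 := fun s r h =>
    Set.indicator_of_notMem (s := {p : ℝ × ℝ | p.2 < p.1}) h _
  have hsec : ∀ r ∈ Set.Ioo 0 t, ∀ g : ℝ → ℂ, (∀ s, g s = F (s, r)) →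
      ∀ s, (Set.Ioc 0 t).indicator g s =
        (Set.Ioc r t).indicator (fun s => ((K (s, r) : ℝ) : ℂ) * v r) s := by
    intro r hr g hg s
    by_cases h1 : s ∈ Set.Ioc r t
    · have h2 : s ∈ Set.Ioc 0 t := ⟨hr.1.trans h1.1, h1.2⟩
      rw [Set.indicator_of_mem h1, Set.indicator_of_mem h2, hg, hF1 _ _ h1.1]
    · rw [Set.indicator_of_notMem h1]
      by_cases h2 : s ∈ Set.Ioc 0 t
      · rw [Set.indicator_of_mem h2, hg, hF0 _ _ fun h => h1 ⟨h, h2.2⟩]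
      · rw [Set.indicator_of_notMem h2]
  have hr_ae : ∀ᵐ r ∂ν, r ∈ Set.Ioo 0 t := by
    rw [hν, ← Measure.restrict_congr_set (Ioo_ae_eq_Ioc (a := (0 : ℝ)) (b := t))]
    exact ae_restrict_mem measurableSet_Ioo
  have hKint : ∀ r ∈ Set.Ioo 0 t, IntegrableOn (fun s => ((K (s, r) : ℝ) : ℂ)) (Set.Ioc r t) := by
    intro r hr
    exact ((intervalIntegrable_iff_integrableOn_Ioc_of_le hr.2.le).1
      (intervalIntegrable_kernel_mul_kernel ha0 ha1 hr.2)).ofReal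
  have hFsec : ∀ r ∈ Set.Ioo 0 t, Integrable (fun s => F (s, r)) ν := by
    intro r hr
    rw [hν, ← IntegrableOn, ← integrable_indicator_iff measurableSet_Ioc,
      funext (hsec r hr _ fun _ => rfl), integrable_indicator_iff measurableSet_Ioc]
    exact (hKint r hr).mul_const _
  have hFint : ∀ r ∈ Set.Ioo 0 t, ∫ s, F (s, r) ∂ν =
      ((Real.Gamma a * Real.Gamma (1 - a) : ℝ) : ℂ) * v r := by
    intro r hr
    rw [hν, ← integral_indicator measurableSet_Ioc, funext (hsec r hr _ fun _ => rfl),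
      integral_indicator measurableSet_Ioc, integral_mul_const,
      ← integral_kernel_mul_kernel ha0 ha1 hr.2, ← intervalIntegral.integral_of_le hr.2.le,
      ← intervalIntegral.integral_ofReal]
  have hFnorm : ∀ r ∈ Set.Ioo 0 t, ∫ s, ‖F (s, r)‖ ∂ν =
      Real.Gamma a * Real.Gamma (1 - a) * ‖v r‖ := by
    intro r hr
    have e : ∀ s, (Set.Ioc 0 t).indicator (fun s => ‖F (s, r)‖) s =
        (Set.Ioc r t).indicator (fun s => K (s, r) * ‖v r‖) s := by
      intro s
      have h1 := congrArg norm (hsec r hr _ (fun _ => rfl) s)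
      rw [norm_indicator_eq_indicator_norm, norm_indicator_eq_indicator_norm] at h1
      rw [h1]
      refine Set.indicator_congr (fun s hs => ?_) |> fun h => congrFun h s
      have : 0 ≤ K (s, r) := mul_nonneg (Real.rpow_nonneg (by linarith [hs.2]) _)
        (Real.rpow_nonneg (by simpa using hs.1.le) _)
      simp [abs_of_nonneg this]
    rw [hν, ← integral_indicator measurableSet_Ioc, funext e,
      integral_indicator measurableSet_Ioc, integral_mul_const,
      ← integral_kernel_mul_kernel ha0 ha1 hr.2, ← intervalIntegral.integral_of_le hr.2.le]
  have hvint : Integrable v ν :=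
    (intervalIntegrable_iff_integrableOn_Ioc_of_le ht).1 (hv.intervalIntegrable 0 t)
  have hI : Integrable F (ν.prod ν) := by
    -- The section at `r` has `L¹` norm `Γ(a) Γ(1-a) ‖v r‖`, which is integrable on `(0, t]` because
    -- `v` is continuous.
    rw [integrable_prod_iff' hFm.aestronglyMeasurable]
    refine ⟨hr_ae.mono fun r hr => hFsec r hr, ?_⟩
    exact (hvint.norm.const_mul (Real.Gamma a * Real.Gamma (1 - a))).congr
      (hr_ae.mono fun r hr => (hFnorm r hr).symm)
  have hswap := integral_integral_swap (f := fun s r => F (s, r)) hI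
  rw [intervalIntegral.integral_of_le ht, intervalIntegral.integral_of_le ht, ← integral_const_mul]
  calc _ = ∫ s, ∫ r, F (s, r) ∂ν ∂ν := by
        refine setIntegral_congr_fun measurableSet_Ioc fun s hs => ?_
        rw [intervalIntegral.integral_of_le hs.1.le, ← integral_const_mul, hν,
          ← integral_indicator measurableSet_Ioc, ← integral_indicator measurableSet_Ioc,
          integral_indicator measurableSet_Ioc, ← integral_indicator measurableSet_Ioc]
        refine integral_congr_ae ?_
        -- The diagonal point `r = s` is discarded: the inner interval `(0, s]` contains it, the
        -- strict triangle does not.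
        filter_upwards [compl_mem_ae_iff.2 (measure_singleton s)] with r hr
        have hr' : r ≠ s := hr
        by_cases h1 : r ∈ Set.Ioc 0 s
        · have h2 : r ∈ Set.Ioc 0 t := ⟨h1.1, h1.2.trans hs.2⟩
          rw [Set.indicator_of_mem h1, Set.indicator_of_mem h2, hF1 _ _ (lt_of_le_of_ne h1.2 hr')]
          simp only [K]
          push_cast
          ring
        · rw [Set.indicator_of_notMem h1]
          by_cases h2 : r ∈ Set.Ioc 0 t
          · rw [Set.indicator_of_mem h2, hF0 _ _ fun h => h1 ⟨h2.1, le_of_lt h⟩]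
          · rw [Set.indicator_of_notMem h2]
    _ = ∫ r, ∫ s, F (s, r) ∂ν ∂ν := hswap
    _ = _ := integral_congr_ae (hr_ae.mono fun r hr => hFint r hr)

end FracKinetic
end

/-! ### Uniqueness for the Caputo problem; sign, monotonicity and decay of the Mittag-Leffler
function -/

noncomputable section

namespace FracKinetic

theorem intervalIntegrable_sub_rpow_mul {a t : ℝ} (ha : 0 < a) {v : ℝ → ℂ} (hv : Continuous v) :
    IntervalIntegrable (fun s : ℝ => (((t - s) ^ (a - 1) : ℝ) : ℂ) * v s) volume 0 t :=
  IntervalIntegrable.mul_continuousOn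
    (f := fun s : ℝ => (((t - s) ^ (a - 1) : ℝ) : ℂ))
    ⟨(intervalIntegrable_sub_rpow ha).1.ofReal, (intervalIntegrable_sub_rpow ha).2.ofReal⟩
    hv.continuousOn

theorem norm_integral_sub_rpow_mul_le {a t M : ℝ} (ha : 0 < a) (ht : 0 ≤ t) {v : ℝ → ℂ}
    (hM : ∀ s ∈ Set.Icc 0 t, ‖v s‖ ≤ M) :
    ‖∫ s in (0 : ℝ)..t, (((t - s) ^ (a - 1) : ℝ) : ℂ) * v s‖ ≤ t ^ a / a * M := by
  rw [← integral_sub_rpow ha, ← intervalIntegral.integral_mul_const]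
  refine intervalIntegral.norm_integral_le_of_norm_le ht (Eventually.of_forall fun s hs => ?_)
    ((intervalIntegrable_sub_rpow ha).mul_const M)
  have hk : 0 ≤ (t - s) ^ (a - 1) := Real.rpow_nonneg (by linarith [hs.2]) _
  rw [norm_mul, Complex.norm_real, Real.norm_of_nonneg hk]
  exact mul_le_mul_of_nonneg_left (hM s ⟨hs.1.le, hs.2⟩) hk

/-- Freezing `u` at `u 0` on negative times turns a function continuous on `[0, ∞)` into one
continuous on `ℝ`, without changing the integral. -/
theorem caputo_integrand_eq {β : ℝ} {r : ℝ} (hr : 0 ≤ r) (u : ℝ → ℂ) :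
    ∫ s in (0 : ℝ)..r, u s / (((r - s) ^ β : ℝ) : ℂ) =
      ∫ s in (0 : ℝ)..r, (((r - s) ^ ((1 - β) - 1) : ℝ) : ℂ) * u (max s 0) := by
  refine intervalIntegral.integral_congr fun s hs => ?_
  rw [Set.uIcc_of_le hr] at hs
  rw [show 1 - β - 1 = -β by ring, Real.rpow_neg (by linarith [hs.2]), max_eq_left hs.1]
  push_cast
  ring

/-- A continuous function on `[0, ∞)` with `v(0) = 0` and `D^β v + λ v = 0` vanishes. -/
theorem eq_zero_of_fractional_ode {β : ℝ} (hβ0 : 0 < β) (hβ1 : β < 1) (l : ℝ) {v : ℝ → ℂ}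
    (hv : Continuous v)
    (hJ : ∀ t, 0 < t → HasDerivAt
      (fun r => ∫ s in (0 : ℝ)..r, (((r - s) ^ ((1 - β) - 1) : ℝ) : ℂ) * v s)
      (-((l * Real.Gamma (1 - β) : ℝ) : ℂ) * v t) t) : ∀ t, 0 < t → v t = 0 := by
  have hβ : 0 < 1 - β := by linarith
  have hG1 := Real.Gamma_pos_of_pos hβ
  have hGβ := Real.Gamma_pos_of_pos hβ0
  set J : ℝ → ℂ := fun r => ∫ s in (0 : ℝ)..r, (((r - s) ^ ((1 - β) - 1) : ℝ) : ℂ) * v s with hJdef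
  -- The argument runs on the primitive `V`. Integrating the hypothesis gives `J = -l Γ(1-β) V`;
  -- applying the kernel of order `β` turns `J` into `Γ(β) Γ(1-β) V`. So `V` solves a homogeneous
  -- Volterra equation, hence `V = 0` and `v = V' = 0`.
  set V : ℝ → ℂ := fun r => ∫ s in (0 : ℝ)..r, v s with hVdef
  have hVd : ∀ t, HasDerivAt V (v t) t := fun t =>
    intervalIntegral.integral_hasDerivAt_right (hv.intervalIntegrable _ _)
      (hv.stronglyMeasurableAtFilter _ _) hv.continuousAt
  have hJ0 : J 0 = 0 := by simp [hJdef]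
  -- Differentiability of `J` is known only for positive times; continuity at `0` comes from the
  -- bound `r^{1-β}/(1-β) * M`.
  have hJcont : ∀ T, ContinuousOn J (Set.Icc 0 T) := by
    intro T t ht
    rcases ht.1.eq_or_lt with h0 | h0
    · rw [← h0]
      obtain ⟨M, hM⟩ := isCompact_Icc.exists_bound_of_continuousOn (hv.continuousOn (s := Set.Icc 0 T))
      rw [ContinuousWithinAt, hJ0]
      have hlim : Tendsto (fun r : ℝ => r ^ (1 - β) / (1 - β) * M) (𝓝[Set.Icc 0 T] 0) (𝓝 0) := by
        have : Continuous fun r : ℝ => r ^ (1 - β) / (1 - β) * M :=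
          ((Real.continuous_rpow_const hβ.le).div_const _).mul_const _
        have h := this.tendsto 0
        simp only [Real.zero_rpow hβ.ne', zero_div, zero_mul] at h
        exact h.mono_left nhdsWithin_le_nhds
      refine squeeze_zero_norm' ?_ hlim
      filter_upwards [self_mem_nhdsWithin] with r hr
      exact norm_integral_sub_rpow_mul_le hβ hr.1 fun s hs => hM s ⟨hs.1, hs.2.trans hr.2⟩
    · exact (hJ t h0).continuousAt.continuousWithinAt
  have hJV : ∀ t, 0 ≤ t → J t = -((l * Real.Gamma (1 - β) : ℝ) : ℂ) * V t := by
    intro t ht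
    have h := intervalIntegral.integral_eq_sub_of_hasDerivAt_of_le ht (hJcont t)
      (fun x hx => hJ x hx.1) ((continuous_const.mul hv).intervalIntegrable _ _)
    rw [intervalIntegral.integral_const_mul, hJ0, sub_zero] at h
    exact h.symm
  have hVV : ∀ t, 0 ≤ t → V t = (-(l / Real.Gamma β : ℝ) : ℂ) *
      ∫ s in (0 : ℝ)..t, (((t - s) ^ (β - 1) : ℝ) : ℂ) * V s := by
    intro t ht
    have h := fractional_integral_comp hβ0 hβ1 ht hv
    have h2 : ∫ s in (0 : ℝ)..t, (((t - s) ^ (β - 1) : ℝ) : ℂ) * J s =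
        -((l * Real.Gamma (1 - β) : ℝ) : ℂ) *
          ∫ s in (0 : ℝ)..t, (((t - s) ^ (β - 1) : ℝ) : ℂ) * V s := by
      rw [← intervalIntegral.integral_const_mul]
      refine intervalIntegral.integral_congr fun s hs => ?_
      rw [Set.uIcc_of_le ht] at hs
      rw [hJV s hs.1]
      ring
    rw [hJdef] at h2
    simp only at h2
    rw [h2] at h
    have n1 : ((Real.Gamma (1 - β) : ℝ) : ℂ) ≠ 0 := by exact_mod_cast hG1.ne'
    have n2 : ((Real.Gamma β : ℝ) : ℂ) ≠ 0 := by exact_mod_cast hGβ.ne'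
    push_cast at h ⊢
    change _ = _ * _ * V t at h
    field_simp
    have h3 : (Real.Gamma (1 - β) : ℂ) * (V t * Real.Gamma β) =
        (Real.Gamma (1 - β) : ℂ) *
          -(l * ∫ s in (0 : ℝ)..t, (((t - s) ^ (β - 1) : ℝ) : ℂ) * V s) := by
      linear_combination -h
    exact mul_left_cancel₀ n1 h3
  have hV0 : ∀ t, 0 ≤ t → V t = 0 := by
    intro t ht
    have hVc : Continuous V := continuous_iff_continuousAt.2 fun t => (hVd t).continuousAt
    obtain ⟨M, hM⟩ := isCompact_Icc.exists_bound_of_continuousOn (hVc.continuousOn (s := Set.Icc 0 t))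
    exact volterra_eq_zero hβ0 hβ1 hM (fun s hs => hVV s hs.1) t ⟨ht, le_rfl⟩
  intro t ht
  refine (hVd t).unique ((hasDerivAt_const t (0 : ℂ)).congr_of_eventuallyEq ?_)
  filter_upwards [lt_mem_nhds ht] with r hr using hV0 r hr.le

/-- The difference with `relax` solves the same linear problem with zero initial value: both
functions start at `1`, so the corrections in `t^{-β}` cancel. -/
theorem caputo_unique {β : ℝ} (hβ0 : 0 < β) (hβ1 : β < 1) (l : ℝ) {u : ℝ → ℂ}
    (hc : ContinuousOn u (Set.Ici 0)) (h0 : u 0 = 1)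
    (hu : ∀ t, 0 < t → HasCaputoDerivAt β u (-((l : ℂ) * u t)) t) :
    ∀ t, 0 ≤ t → u t = relax β l t := by
  have hβ : 0 < 1 - β := by linarith
  have hG1 := Real.Gamma_pos_of_pos hβ
  have hmax : Continuous fun s : ℝ => max s 0 := continuous_id.max continuous_const
  have hcu : Continuous fun s : ℝ => u (max s 0) :=
    hc.comp_continuous hmax fun s => Set.mem_Ici.2 (le_max_right _ _)
  have hce : Continuous fun s : ℝ => (relax β l (max s 0) : ℂ) :=
    (continuous_ofReal_relax hβ0 hβ1 l).comp hmax
  have key := eq_zero_of_fractional_ode hβ0 hβ1 l (hcu.sub hce) fun t ht => ?_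
  · intro t ht
    rcases ht.eq_or_lt with rfl | ht'
    · rw [h0, relax_zero hβ0]; simp
    · have := key t ht'
      rwa [Pi.sub_apply, max_eq_left ht, sub_eq_zero] at this
  · obtain ⟨D, hD, hD'⟩ := hu t ht
    obtain ⟨E, hE, hE'⟩ := hasCaputoDerivAt_relax hβ0 hβ1 l ht
    have n1 : ((Real.Gamma (1 - β) : ℝ) : ℂ) ≠ 0 := by exact_mod_cast hG1.ne'
    have hd := (hD.sub hE).congr_of_eventuallyEq (f₁ := fun r => ∫ s in (0 : ℝ)..r,
      (((r - s) ^ ((1 - β) - 1) : ℝ) : ℂ) * (u (max s 0) - (relax β l (max s 0) : ℂ))) ?_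
    · refine hd.congr_deriv ?_
      rw [h0] at hD'
      simp only [relax_zero hβ0, Complex.ofReal_one] at hE'
      rw [eq_div_iff n1] at hD' hE'
      rw [Pi.sub_apply, max_eq_left ht.le]
      push_cast
      linear_combination hE' - hD'
    · filter_upwards [lt_mem_nhds ht] with r hr
      simp only [Pi.sub_apply]
      rw [caputo_integrand_eq hr.le, caputo_integrand_eq hr.le (fun r => (relax β l r : ℂ)),
        ← intervalIntegral.integral_sub (intervalIntegrable_sub_rpow_mul hβ hcu)
          (intervalIntegrable_sub_rpow_mul hβ hce)]
      simp only [mul_sub]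

/-! ### Positivity, monotonicity and decay -/

/-- A first-zero argument. Let `t₀` be the first time with `v ≤ 0`, and let `t₁` maximise `v` on
`[t₀ - δ, t₀]`. By the ratio condition `hr`, the history before `t₁` weighs at time `t₀` at most `f
t₀ / f t₁` times what it weighs at time `t₁`, and the latter is known from the equation at `t₁`. The
history after `t₁` contributes at most `δ^β/β * v t₁`. Together `v t₀ ≥ v t₁ (f t₀ / f t₁ - c
δ^β/β)`, which is positive for small `δ`: a contradiction. -/
theorem volterra_pos {β c : ℝ} (hβ0 : 0 < β) (hβ1 : β < 1) (hc : 0 < c) {v f : ℝ → ℝ}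
    (hv : Continuous v) (h0 : 0 < v 0) (hf : ∀ t, 0 < t → 0 < f t)
    (hV : ∀ t, 0 < t → v t = f t - c * ∫ s in (0 : ℝ)..t, (t - s) ^ (β - 1) * v s)
    (hr : ∀ s t₁ t₀, 0 ≤ s → s < t₁ → t₁ < t₀ →
      f t₁ * (t₀ - s) ^ (β - 1) ≤ f t₀ * (t₁ - s) ^ (β - 1)) :
    ∀ t, 0 ≤ t → 0 < v t := by
  by_contra! hneg
  obtain ⟨t', ht', hvt'⟩ := hneg
  set S : Set ℝ := {t | 0 ≤ t ∧ v t ≤ 0} with hS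
  have hSc : IsClosed S := (isClosed_le continuous_const continuous_id).inter
    (isClosed_le hv continuous_const)
  have hSb : BddBelow S := ⟨0, fun t ht => ht.1⟩
  have ht0S := hSc.csInf_mem ⟨t', ht', hvt'⟩ hSb
  set t₀ := sInf S with ht0
  have ht0pos : 0 < t₀ := by
    rcases ht0S.1.eq_or_lt with h | h
    · have := ht0S.2
      rw [← h] at this
      linarith
    · exact h
  have hpos : ∀ s, 0 ≤ s → s < t₀ → 0 < v s := by
    intro s hs hst
    by_contra! h
    exact absurd (csInf_le hSb (show s ∈ S from ⟨hs, h⟩)) (not_le.2 hst)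
  have hint : ∀ t a b : ℝ, 0 ≤ a → a ≤ b → b ≤ t →
      IntervalIntegrable (fun s => (t - s) ^ (β - 1) * v s) volume a b := by
    intro t a b ha hab hbt
    have h1 := (intervalIntegrable_sub_rpow (t := t) hβ0).mul_continuousOn hv.continuousOn
    refine h1.mono_set ?_
    rw [Set.uIcc_of_le hab, Set.uIcc_of_le (by linarith)]
    exact Set.Icc_subset_Icc ha hbt
  -- choose the window
  obtain ⟨δ, hδ0, hδt, hδ⟩ : ∃ δ : ℝ, 0 < δ ∧ δ ≤ t₀ / 2 ∧ c * (δ ^ β / β) < 1 / 2 := by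
    have hcont : Continuous fun δ : ℝ => c * (δ ^ β / β) :=
      ((Real.continuous_rpow_const hβ0.le).div_const _).const_mul _
    have hl := hcont.tendsto 0
    simp only [Real.zero_rpow hβ0.ne', zero_div, mul_zero] at hl
    have h1 := (hl.eventually (gt_mem_nhds (show (0 : ℝ) < 1 / 2 by norm_num)))
    have h2 : ∀ᶠ δ in 𝓝[>] (0 : ℝ), c * (δ ^ β / β) < 1 / 2 := h1.filter_mono nhdsWithin_le_nhds
    have h3 : ∀ᶠ δ in 𝓝[>] (0 : ℝ), δ ∈ Set.Ioc 0 (t₀ / 2) :=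
      Ioc_mem_nhdsGT (by linarith)
    obtain ⟨δ, hδ, hδ'⟩ := (h2.and h3).exists
    exact ⟨δ, hδ'.1, hδ'.2, hδ⟩
  obtain ⟨t₁, ht1, hmax⟩ := isCompact_Icc.exists_isMaxOn
    (Set.nonempty_Icc.2 (by linarith : t₀ - δ ≤ t₀)) hv.continuousOn
  have hv1 : 0 < v t₁ := (hpos (t₀ - δ) (by linarith) (by linarith)).trans_le
    (hmax ⟨le_rfl, by linarith⟩)
  have ht1pos : 0 < t₁ := by linarith [ht1.1]
  have ht10 : t₁ < t₀ := lt_of_le_of_ne ht1.2 fun h => by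
    have := ht0S.2
    rw [← h] at this
    linarith
  have hf0 := hf t₀ ht0pos
  have hf1 := hf t₁ ht1pos
  have e0 := hV t₀ ht0pos
  have e1 := hV t₁ ht1pos
  rw [← intervalIntegral.integral_add_adjacent_intervals
    (hint t₀ 0 t₁ le_rfl ht1pos.le ht10.le) (hint t₀ t₁ t₀ ht1pos.le ht10.le le_rfl)] at e0
  have i1 : f t₁ * ∫ s in (0 : ℝ)..t₁, (t₀ - s) ^ (β - 1) * v s ≤
      f t₀ * ∫ s in (0 : ℝ)..t₁, (t₁ - s) ^ (β - 1) * v s := by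
    rw [← intervalIntegral.integral_const_mul, ← intervalIntegral.integral_const_mul]
    refine intervalIntegral.integral_mono_on_of_le_Ioo ht1pos.le
      ((hint t₀ 0 t₁ le_rfl ht1pos.le ht10.le).const_mul _)
      ((hint t₁ 0 t₁ le_rfl ht1pos.le le_rfl).const_mul _) fun s hs => ?_
    rw [← mul_assoc, ← mul_assoc]
    exact mul_le_mul_of_nonneg_right (hr s t₁ t₀ hs.1.le hs.2 ht10)
      (hpos s hs.1.le (hs.2.trans ht10)).le
  have i2 : ∫ s in t₁..t₀, (t₀ - s) ^ (β - 1) * v s ≤ δ ^ β / β * v t₁ := by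
    have hk : IntervalIntegrable (fun s : ℝ => (t₀ - s) ^ (β - 1)) volume t₁ t₀ := by
      refine (intervalIntegrable_sub_rpow (t := t₀) hβ0).mono_set ?_
      rw [Set.uIcc_of_le ht10.le, Set.uIcc_of_le ht0pos.le]
      exact Set.Icc_subset_Icc ht1pos.le le_rfl
    have e : ∫ s in t₁..t₀, (t₀ - s) ^ (β - 1) = (t₀ - t₁) ^ β / β := by
      rw [intervalIntegral.integral_comp_sub_left (fun s : ℝ => s ^ (β - 1)) t₀]
      rw [sub_self, integral_rpow (Or.inl (by linarith))]
      simp [Real.zero_rpow hβ0.ne']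
    calc _ ≤ ∫ s in t₁..t₀, (t₀ - s) ^ (β - 1) * v t₁ := by
          refine intervalIntegral.integral_mono_on ht10.le
            (hint t₀ t₁ t₀ ht1pos.le ht10.le le_rfl) (hk.mul_const _) fun s hs => ?_
          exact mul_le_mul_of_nonneg_left (hmax ⟨ht1.1.trans hs.1, hs.2⟩)
            (Real.rpow_nonneg (by linarith [hs.2]) _)
      _ = (t₀ - t₁) ^ β / β * v t₁ := by rw [intervalIntegral.integral_mul_const, e]
      _ ≤ _ := by
        have : (t₀ - t₁) ^ β ≤ δ ^ β :=
          Real.rpow_le_rpow (by linarith) (by linarith [ht1.1]) hβ0.le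
        gcongr
  -- The ratio condition at `s = 0`, with `t₁ ≥ t₀/2` from the choice `δ ≤ t₀/2`. This fixes the
  -- threshold `1/2` imposed on `c δ^β/β`.
  have i3 : 1 / 2 * f t₁ ≤ f t₀ := by
    have h := hr 0 t₁ t₀ le_rfl ht1pos ht10
    simp only [sub_zero] at h
    have h1 : t₁ ^ (β - 1) ≤ 2 * t₀ ^ (β - 1) := by
      have h2 : t₁ ^ (β - 1) ≤ (t₀ / 2) ^ (β - 1) :=
        Real.rpow_le_rpow_of_nonpos (by linarith) (by linarith [ht1.1]) (by linarith)
      have h3 : (t₀ / 2) ^ (β - 1) = t₀ ^ (β - 1) * 2 ^ (1 - β) := by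
        rw [Real.div_rpow ht0pos.le (by norm_num), show 1 - β = -(β - 1) by ring,
          Real.rpow_neg (by norm_num)]
        ring
      have h4 : (2 : ℝ) ^ (1 - β) ≤ 2 := by
        calc (2 : ℝ) ^ (1 - β) ≤ 2 ^ (1 : ℝ) :=
              Real.rpow_le_rpow_of_exponent_le (by norm_num) (by linarith)
          _ = 2 := Real.rpow_one 2
      have h5 : 0 < t₀ ^ (β - 1) := Real.rpow_pos_of_pos ht0pos _
      rw [h3] at h2
      nlinarith
    have h5 : 0 < t₀ ^ (β - 1) := Real.rpow_pos_of_pos ht0pos _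
    have h6 : f t₁ * t₀ ^ (β - 1) ≤ (2 * f t₀) * t₀ ^ (β - 1) := by nlinarith
    have := le_of_mul_le_mul_right h6 h5
    linarith
  have hv0 : v t₀ ≤ 0 := ht0S.2
  set A := ∫ s in (0 : ℝ)..t₁, (t₀ - s) ^ (β - 1) * v s
  set B := ∫ s in (0 : ℝ)..t₁, (t₁ - s) ^ (β - 1) * v s
  set D := ∫ s in t₁..t₀, (t₀ - s) ^ (β - 1) * v s
  have j1 : f t₀ ≤ c * (A + D) := by linarith
  have j2 : f t₁ * f t₀ ≤ c * (f t₁ * A) + c * (f t₁ * D) := by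
    calc f t₁ * f t₀ ≤ f t₁ * (c * (A + D)) := by gcongr
      _ = _ := by ring
  have j3 : c * (f t₁ * A) ≤ f t₀ * (f t₁ - v t₁) := by
    calc c * (f t₁ * A) ≤ c * (f t₀ * B) := by gcongr
      _ = f t₀ * (c * B) := by ring
      _ = _ := by rw [show c * B = f t₁ - v t₁ by linarith]
  have j4 : c * (f t₁ * D) ≤ f t₁ * v t₁ * (c * (δ ^ β / β)) := by
    calc c * (f t₁ * D) ≤ c * (f t₁ * (δ ^ β / β * v t₁)) := by gcongr
      _ = _ := by ring
  have j5 : f t₁ * v t₁ * (c * (δ ^ β / β)) < f t₁ * v t₁ * (1 / 2) := by gcongr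
  have j6 : 1 / 2 * f t₁ * v t₁ ≤ f t₀ * v t₁ := by gcongr
  linarith

theorem relax_pos {β : ℝ} (hβ0 : 0 < β) (hβ1 : β < 1) {t : ℝ} (ht : 0 ≤ t) :
    0 < relax β 1 t := by
  have hGβ := Real.Gamma_pos_of_pos hβ0
  refine volterra_pos hβ0 hβ1 (c := 1 / Real.Gamma β) (by positivity) (f := fun _ => 1)
    (continuous_relax hβ0 hβ1 1) (by simp [relax_zero hβ0]) (fun _ _ => one_pos)
    (fun t ht => relax_volterra hβ0 hβ1 1 ht.le) (fun s t₁ t₀ hs h1 h2 => ?_) t ht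
  simp only [one_mul]
  exact Real.rpow_le_rpow_of_nonpos (by linarith) (by linarith) (by linarith)

/-- Splitting the Volterra integral at time `t + h` at the point `h` and translating shows that
`relax t - relax (t + h)` solves the same equation. The new forcing is the contribution of `[0, h]`,
positive by `relax_pos`, so `volterra_pos` applies again. -/
theorem relax_shift_lt {β : ℝ} (hβ0 : 0 < β) (hβ1 : β < 1) {h : ℝ} (hh : 0 < h) {t : ℝ}
    (ht : 0 ≤ t) : relax β 1 (t + h) < relax β 1 t := by
  have hGβ := Real.Gamma_pos_of_pos hβ0
  have hcr := continuous_relax hβ0 hβ1 1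
  have hkint : ∀ t : ℝ, 0 ≤ t → IntervalIntegrable
      (fun r => (t + h - r) ^ (β - 1) * relax β 1 r) volume 0 h := by
    intro t ht
    have h1 := (intervalIntegrable_sub_rpow (t := t + h) hβ0).mul_continuousOn hcr.continuousOn
    refine h1.mono_set ?_
    rw [Set.uIcc_of_le hh.le, Set.uIcc_of_le (by linarith)]
    exact Set.Icc_subset_Icc le_rfl (by linarith)
  have hfpos : ∀ t : ℝ, 0 ≤ t → 0 < 1 / Real.Gamma β *
      ∫ r in (0 : ℝ)..h, (t + h - r) ^ (β - 1) * relax β 1 r := by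
    intro t ht
    refine mul_pos (by positivity) (intervalIntegral.intervalIntegral_pos_of_pos_on (hkint t ht)
      (fun r hr => ?_) hh)
    exact mul_pos (Real.rpow_pos_of_pos (by linarith [hr.2]) _) (relax_pos hβ0 hβ1 hr.1.le)
  refine sub_pos.1 (volterra_pos hβ0 hβ1 (c := 1 / Real.Gamma β) (by positivity)
    (v := fun t => relax β 1 t - relax β 1 (t + h))
    (f := fun t => 1 / Real.Gamma β * ∫ r in (0 : ℝ)..h, (t + h - r) ^ (β - 1) * relax β 1 r)
    (by fun_prop) ?_ (fun t ht => hfpos t ht.le) (fun t ht => ?_) (fun s t₁ t₀ hs h1 h2 => ?_) t ht)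
  · have e := relax_volterra hβ0 hβ1 1 hh.le
    have := hfpos 0 le_rfl
    simp only [zero_add] at this ⊢
    rw [relax_zero hβ0]
    linarith
  · have e1 := relax_volterra hβ0 hβ1 1 ht.le
    have e2 := relax_volterra hβ0 hβ1 1 (t := t + h) (by linarith)
    have hi2 : IntervalIntegrable
        (fun r => (t + h - r) ^ (β - 1) * relax β 1 r) volume h (t + h) := by
      have h1 := (intervalIntegrable_sub_rpow (t := t + h) hβ0).mul_continuousOn hcr.continuousOn
      refine h1.mono_set ?_
      rw [Set.uIcc_of_le (by linarith), Set.uIcc_of_le (by linarith)]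
      exact Set.Icc_subset_Icc hh.le le_rfl
    rw [← intervalIntegral.integral_add_adjacent_intervals (hkint t ht.le) hi2] at e2
    have e3 := intervalIntegral.integral_comp_add_right
      (fun r : ℝ => (t + h - r) ^ (β - 1) * relax β 1 r) h (a := 0) (b := t)
    simp only [zero_add, add_sub_add_right_eq_sub] at e3
    rw [← e3] at e2
    have e4 : ∫ s in (0 : ℝ)..t, (t - s) ^ (β - 1) * (relax β 1 s - relax β 1 (s + h)) =
        (∫ s in (0 : ℝ)..t, (t - s) ^ (β - 1) * relax β 1 s) -
          ∫ s in (0 : ℝ)..t, (t - s) ^ (β - 1) * relax β 1 (s + h) := by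
      rw [← intervalIntegral.integral_sub
        ((intervalIntegrable_sub_rpow hβ0).mul_continuousOn hcr.continuousOn)
        ((intervalIntegrable_sub_rpow hβ0).mul_continuousOn (Continuous.continuousOn (by fun_prop)))]
      simp only [mul_sub]
    rw [e4]
    linarith
  · have key : (∫ r in (0 : ℝ)..h, (t₁ + h - r) ^ (β - 1) * relax β 1 r) * (t₀ - s) ^ (β - 1) ≤
        (∫ r in (0 : ℝ)..h, (t₀ + h - r) ^ (β - 1) * relax β 1 r) * (t₁ - s) ^ (β - 1) := by
      rw [← intervalIntegral.integral_mul_const, ← intervalIntegral.integral_mul_const]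
      refine intervalIntegral.integral_mono_on hh.le ((hkint t₁ (by linarith)).mul_const _)
        ((hkint t₀ (by linarith)).mul_const _) fun r hr => ?_
      have hp := (relax_pos hβ0 hβ1 hr.1).le
      have hmul : (t₁ + h - r) ^ (β - 1) * (t₀ - s) ^ (β - 1) ≤
          (t₀ + h - r) ^ (β - 1) * (t₁ - s) ^ (β - 1) := by
        rw [← Real.mul_rpow (by linarith [hr.2]) (by linarith),
          ← Real.mul_rpow (by linarith [hr.2]) (by linarith)]
        refine Real.rpow_le_rpow_of_nonpos
          (mul_pos (by linarith [hr.2]) (by linarith)) ?_ (by linarith)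
        -- The difference of the two products is `(t₀ - t₁)(s + h - r)`, which is nonnegative.
        nlinarith [mul_nonneg (sub_nonneg.2 h2.le) (add_nonneg hs (sub_nonneg.2 hr.2))]
      calc _ = (t₁ + h - r) ^ (β - 1) * (t₀ - s) ^ (β - 1) * relax β 1 r := by ring
        _ ≤ (t₀ + h - r) ^ (β - 1) * (t₁ - s) ^ (β - 1) * relax β 1 r := by gcongr
        _ = _ := by ring
    rw [mul_assoc, mul_assoc]
    exact mul_le_mul_of_nonneg_left key (by positivity)

theorem relax_antitoneOn {β : ℝ} (hβ0 : 0 < β) (hβ1 : β < 1) :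
    AntitoneOn (relax β 1) (Set.Ici 0) := by
  intro s hs t _ hst
  rcases hst.eq_or_lt with rfl | h
  · exact le_rfl
  · have := relax_shift_lt hβ0 hβ1 (sub_pos.2 h) hs
    rw [add_sub_cancel] at this
    exact this.le

/-- The substitution `t = y^{1/β}` carries the results for rate `1` over to the whole negative axis.
-/
theorem mittagLeffler_neg_eq_relax {β y : ℝ} (hβ0 : 0 < β) (hy : 0 ≤ y) :
    mittagLeffler β (-y) = relax β 1 (y ^ β⁻¹) := by
  rw [relax, Real.rpow_inv_rpow hy hβ0.ne', one_mul]

theorem mittagLeffler_neg_pos {β y : ℝ} (hβ0 : 0 < β) (hβ1 : β < 1) (hy : 0 ≤ y) :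
    0 < mittagLeffler β (-y) := by
  rw [mittagLeffler_neg_eq_relax hβ0 hy]
  exact relax_pos hβ0 hβ1 (by positivity)

theorem mittagLeffler_neg_antitone {β y z : ℝ} (hβ0 : 0 < β) (hβ1 : β < 1) (hy : 0 ≤ y)
    (hyz : y ≤ z) : mittagLeffler β (-z) ≤ mittagLeffler β (-y) := by
  have hz := hy.trans hyz
  rw [mittagLeffler_neg_eq_relax hβ0 hy, mittagLeffler_neg_eq_relax hβ0 hz]
  exact relax_antitoneOn hβ0 hβ1 (Set.mem_Ici.2 (by positivity)) (Set.mem_Ici.2 (by positivity))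
    (Real.rpow_le_rpow hy hyz (by positivity))

theorem mittagLeffler_neg_le_one {β y : ℝ} (hβ0 : 0 < β) (hβ1 : β < 1) (hy : 0 ≤ y) :
    mittagLeffler β (-y) ≤ 1 := by
  have := mittagLeffler_neg_antitone hβ0 hβ1 le_rfl hy
  rwa [neg_zero, mittagLeffler_zero] at this

/-- `E_β(-y) (1 + y / Γ(1 + β)) ≤ 1`. -/
theorem mittagLeffler_neg_mul_le {β y : ℝ} (hβ0 : 0 < β) (hβ1 : β < 1) (hy : 0 ≤ y) :
    mittagLeffler β (-y) * (1 + y / Real.Gamma (β + 1)) ≤ 1 := by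
  have hGβ := Real.Gamma_pos_of_pos hβ0
  have hcr := continuous_relax hβ0 hβ1 1
  set t : ℝ := y ^ β⁻¹ with ht
  have ht0 : 0 ≤ t := by positivity
  have hty : t ^ β = y := Real.rpow_inv_rpow hy hβ0.ne'
  rw [mittagLeffler_neg_eq_relax hβ0 hy, ← ht, Real.Gamma_add_one hβ0.ne']
  have e := relax_volterra hβ0 hβ1 1 ht0
  -- By monotonicity `relax s ≥ relax t` under the integral, and the kernel has mass `t^β/β`; the
  -- Volterra equation then gives the decay.
  have h : t ^ β / β * relax β 1 t ≤ ∫ s in (0 : ℝ)..t, (t - s) ^ (β - 1) * relax β 1 s := by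
    rw [← integral_sub_rpow hβ0, ← intervalIntegral.integral_mul_const]
    refine intervalIntegral.integral_mono_on ht0 ((intervalIntegrable_sub_rpow hβ0).mul_const _)
      ((intervalIntegrable_sub_rpow hβ0).mul_continuousOn hcr.continuousOn) fun s hs => ?_
    exact mul_le_mul_of_nonneg_left (relax_antitoneOn hβ0 hβ1 hs.1 ht0 hs.2)
      (Real.rpow_nonneg (by linarith [hs.2]) _)
  rw [hty] at h
  have h2 : 1 / Real.Gamma β * (y / β * relax β 1 t) ≤ 1 / Real.Gamma β *
      ∫ s in (0 : ℝ)..t, (t - s) ^ (β - 1) * relax β 1 s := by gcongr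
  have h3 : relax β 1 t * (1 + y / (β * Real.Gamma β)) =
      relax β 1 t + 1 / Real.Gamma β * (y / β * relax β 1 t) := by field_simp
  rw [h3]
  linarith

end FracKinetic
end

/-! ### The isometry between correlations under `Γ` and Fourier transforms under `μ` -/

noncomputable section

namespace FracKinetic

/-! ### Convergence in `L²` -/

theorem tendsto_integral_mul_conj {𝕜 X : Type*} [RCLike 𝕜] [MeasurableSpace X] {m : Measure X}
    {f g : ℕ → X → 𝕜} {f₀ g₀ : X → 𝕜} (hf : ∀ n, MemLp (f n) 2 m) (hf₀ : MemLp f₀ 2 m)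
    (hg : ∀ n, MemLp (g n) 2 m) (hg₀ : MemLp g₀ 2 m)
    (hft : Tendsto (fun n => eLpNorm (f n - f₀) 2 m) atTop (𝓝 0))
    (hgt : Tendsto (fun n => eLpNorm (g n - g₀) 2 m) atTop (𝓝 0)) :
    Tendsto (fun n => ∫ x, f n x * (starRingEnd 𝕜) (g n x) ∂m) atTop
      (𝓝 (∫ x, f₀ x * (starRingEnd 𝕜) (g₀ x) ∂m)) := by
  have key : ∀ {a b : X → 𝕜} (ha : MemLp a 2 m) (hb : MemLp b 2 m),
      inner 𝕜 (hb.toLp b) (ha.toLp a) = ∫ x, a x * (starRingEnd 𝕜) (b x) ∂m := by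
    intro a b ha hb
    rw [L2.inner_def]
    refine integral_congr_ae ?_
    filter_upwards [ha.coeFn_toLp, hb.coeFn_toLp] with x h1 h2
    rw [h1, h2]
    simp
  have h1 := (Lp.tendsto_Lp_iff_tendsto_eLpNorm'' f hf f₀ hf₀).2 hft
  have h2 := (Lp.tendsto_Lp_iff_tendsto_eLpNorm'' g hg g₀ hg₀).2 hgt
  have h3 := Filter.Tendsto.inner (𝕜 := 𝕜) h2 h1
  simpa only [key] using h3

theorem eLpNorm_two_sq_eq {X : Type*} [MeasurableSpace X] {m : Measure X} {f : X → ℂ}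
    (hf : MemLp f 2 m) :
    eLpNorm f 2 m ^ 2 = ENNReal.ofReal (∫ x, f x * (starRingEnd ℂ) (f x) ∂m).re := by
  have h1 : ∫ x, f x * (starRingEnd ℂ) (f x) ∂m = ((∫ x, ‖f x‖ ^ 2 ∂m : ℝ) : ℂ) := by
    rw [← integral_complex_ofReal]
    refine integral_congr_ae (Eventually.of_forall fun x => ?_)
    simp [Complex.mul_conj, Complex.normSq_eq_norm_sq]
  rw [h1, Complex.ofReal_re, hf.eLpNorm_eq_integral_rpow_norm (by norm_num) (by norm_num),
    ← ENNReal.ofReal_pow (by positivity)]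
  congr 1
  have h0 : 0 ≤ ∫ x, ‖f x‖ ^ 2 ∂m := integral_nonneg fun x => by positivity
  simp only [ENNReal.toReal_ofNat, Real.rpow_ofNat]
  rw [← Real.rpow_natCast, ← Real.rpow_mul h0]
  norm_num

/-! ### Weights -/

/-- The weight `(1 + |x|)^{-N}`. -/
def weight {d : ℕ} (N : ℕ) (x : Space d) : ℝ := (1 + ‖x‖) ^ (-(N : ℝ))

theorem weight_pos {d : ℕ} (N : ℕ) (x : Space d) : 0 < weight N x :=
  Real.rpow_pos_of_pos (by positivity) _

theorem weight_add {d : ℕ} (n m : ℕ) (x : Space d) :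
    weight (n + m) x = weight n x * weight m x := by
  have : 0 < 1 + ‖x‖ := by positivity
  rw [weight, weight, weight, ← Real.rpow_add this]
  push_cast
  ring_nf

/-- From `1 + |z| ≤ (1 + |x|)(1 + |x - z|)`: `n` powers are spent on decay in `z`, and `m` powers
are kept for decay in `x`. This separates the variables in correlation integrals. -/
theorem weight_mul_weight_le {d : ℕ} (n m : ℕ) (x z : Space d) :
    weight (n + m) x * weight (n + m) (x - z) ≤ weight n z * weight m x := by
  have h1 : weight n x * weight n (x - z) ≤ weight n z := by
    unfold weight
    rw [← Real.mul_rpow (by positivity) (by positivity)]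
    refine Real.rpow_le_rpow_of_nonpos (by positivity) ?_ (by simp)
    have : ‖z‖ ≤ ‖x‖ + ‖x - z‖ := by
      calc ‖z‖ = ‖x - (x - z)‖ := by congr 1; abel
        _ ≤ _ := norm_sub_le _ _
    nlinarith [norm_nonneg x, norm_nonneg (x - z), mul_nonneg (norm_nonneg x) (norm_nonneg (x - z))]
  have h2 : weight m (x - z) ≤ 1 :=
    Real.rpow_le_one_of_one_le_of_nonpos (by linarith [norm_nonneg (x - z)]) (by simp)
  rw [weight_add, weight_add]
  calc _ = (weight n x * weight n (x - z)) * weight m x * weight m (x - z) := by ring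
    _ ≤ weight n z * weight m x * 1 := by
      have := (weight_pos m x).le
      have := (weight_pos n z).le
      have := (weight_pos m (x - z)).le
      gcongr
    _ = _ := mul_one _

theorem measurable_weight {d : ℕ} (N : ℕ) : Measurable (weight (d := d) N) :=
  (measurable_const.add measurable_norm).pow_const _

theorem weight_le_of_le {d : ℕ} {n m : ℕ} (h : n ≤ m) (x : Space d) :
    weight m x ≤ weight n x :=
  Real.rpow_le_rpow_of_exponent_le (by linarith [norm_nonneg x]) (by simpa using h)

/-- The exponent for which functions `O((1 + |x|)^{-N})` have a `Γ`-integrable correlation. -/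
def rapidExp {d : ℕ} (Γ : Measure (Space d)) : ℕ :=
  Γ.integrablePower + (volume : Measure (Space d)).integrablePower

/-- Measurable functions which are `O((1 + |x|)^{-N})`. -/
def Rapid {d : ℕ} (Γ : Measure (Space d)) (f : Space d → ℂ) : Prop :=
  Measurable f ∧ ∃ C, ∀ x, ‖f x‖ ≤ C * weight (rapidExp Γ) x

theorem integrable_weight {d : ℕ} (Γ : Measure (Space d)) :
    Integrable (weight (d := d) (rapidExp Γ)) := by
  refine ((volume : Measure (Space d)).integrable_pow_neg_integrablePower).mono'
    (measurable_weight _).aestronglyMeasurable (Eventually.of_forall fun x => ?_)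
  rw [Real.norm_of_nonneg (weight_pos _ x).le]
  exact weight_le_of_le (Nat.le_add_left _ _) x

theorem Rapid.sub {d : ℕ} {Γ : Measure (Space d)} {f g : Space d → ℂ} (hf : Rapid Γ f)
    (hg : Rapid Γ g) : Rapid Γ (f - g) := by
  obtain ⟨hfm, C, hC⟩ := hf
  obtain ⟨hgm, D, hD⟩ := hg
  refine ⟨hfm.sub hgm, C + D, fun x => ?_⟩
  rw [add_mul]
  exact (norm_sub_le _ _).trans (add_le_add (hC x) (hD x))

theorem Rapid.integrable {d : ℕ} {Γ : Measure (Space d)} {f : Space d → ℂ} (hf : Rapid Γ f) :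
    Integrable f := by
  obtain ⟨hfm, C, hC⟩ := hf
  exact ((integrable_weight Γ).const_mul C).mono' hfm.aestronglyMeasurable
    (Eventually.of_forall hC)

/-! ### Correlations -/

/-- `∫ f(x) \overline{g(x - z)} dx`. -/
def corr {d : ℕ} (f g : Space d → ℂ) (z : Space d) : ℂ :=
  ∫ x, f x * (starRingEnd ℂ) (g (x - z))

/-- `∫ (∫ f(x) \overline{g(x - z)} dx) Γ(dz)`. -/
def corrForm {d : ℕ} (Γ : Measure (Space d)) (f g : Space d → ℂ) : ℂ := ∫ z, corr f g z ∂Γ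

section
variable {d : ℕ} {Γ : Measure (Space d)}

theorem corr_integrand_le {f g : Space d → ℂ} {C D : ℝ}
    (hf : ∀ x, ‖f x‖ ≤ C * weight (rapidExp Γ) x) (hg : ∀ x, ‖g x‖ ≤ D * weight (rapidExp Γ) x)
    (x z : Space d) : ‖f x * (starRingEnd ℂ) (g (x - z))‖ ≤ C * D * weight Γ.integrablePower z *
      weight (volume : Measure (Space d)).integrablePower x := by
  have hC : 0 ≤ C := by
    have := (norm_nonneg _).trans (hf 0)
    exact nonneg_of_mul_nonneg_left this (weight_pos _ _)
  have hD : 0 ≤ D := by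
    have := (norm_nonneg _).trans (hg 0)
    exact nonneg_of_mul_nonneg_left this (weight_pos _ _)
  rw [norm_mul, RCLike.norm_conj]
  calc _ ≤ (C * weight (rapidExp Γ) x) * (D * weight (rapidExp Γ) (x - z)) :=
        mul_le_mul (hf x) (hg _) (norm_nonneg _) ((norm_nonneg _).trans (hf x))
    _ = C * D * (weight (rapidExp Γ) x * weight (rapidExp Γ) (x - z)) := by ring
    _ ≤ C * D * (weight Γ.integrablePower z *
          weight (volume : Measure (Space d)).integrablePower x) :=
        mul_le_mul_of_nonneg_left (weight_mul_weight_le _ _ _ _) (by positivity)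
    _ = _ := by ring

theorem measurable_corr {f g : Space d → ℂ} (hf : Measurable f) (hg : Measurable g) :
    StronglyMeasurable (corr f g) := by
  have : Measurable fun p : Space d × Space d => f p.2 * (starRingEnd ℂ) (g (p.2 - p.1)) :=
    (hf.comp measurable_snd).mul (Complex.continuous_conj.measurable.comp
      (hg.comp (measurable_snd.sub measurable_fst)))
  exact this.stronglyMeasurable.integral_prod_right

theorem norm_corr_le {f g : Space d → ℂ} {C D : ℝ}
    (hf : ∀ x, ‖f x‖ ≤ C * weight (rapidExp Γ) x) (hg : ∀ x, ‖g x‖ ≤ D * weight (rapidExp Γ) x)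
    (z : Space d) : ‖corr f g z‖ ≤ C * D *
      (∫ x : Space d, weight (volume : Measure (Space d)).integrablePower x) *
        weight Γ.integrablePower z := by
  calc ‖corr f g z‖ ≤ ∫ x, C * D * weight Γ.integrablePower z *
      weight (volume : Measure (Space d)).integrablePower x :=
        norm_integral_le_of_norm_le
          ((volume : Measure (Space d)).integrable_pow_neg_integrablePower.const_mul _)
          (Eventually.of_forall fun x => corr_integrand_le hf hg x z)
    _ = _ := by rw [integral_const_mul]; ring

variable [hΓ : Γ.HasTemperateGrowth]

/-- Dominated convergence twice, in `x` for Lebesgue measure and in `z` for `Γ`, with the product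
majorant of `corr_integrand_le`. Convergence for Lebesgue-almost every `x` is enough, whatever `Γ`
is, because translation by each `z` preserves null sets. -/
theorem tendsto_corrForm {f g : ℕ → Space d → ℂ} {f₀ g₀ : Space d → ℂ} {C D : ℝ}
    (hfm : ∀ n, Measurable (f n)) (hgm : ∀ n, Measurable (g n))
    (hf : ∀ n x, ‖f n x‖ ≤ C * weight (rapidExp Γ) x)
    (hg : ∀ n x, ‖g n x‖ ≤ D * weight (rapidExp Γ) x)
    (hft : ∀ᵐ x, Tendsto (fun n => f n x) atTop (𝓝 (f₀ x)))
    (hgt : ∀ᵐ x, Tendsto (fun n => g n x) atTop (𝓝 (g₀ x))) :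
    Tendsto (fun n => corrForm Γ (f n) (g n)) atTop (𝓝 (corrForm Γ f₀ g₀)) := by
  have hcm : Measurable (starRingEnd ℂ) := Complex.continuous_conj.measurable
  refine tendsto_integral_of_dominated_convergence _
    (fun n => (measurable_corr (hfm n) (hgm n)).aestronglyMeasurable)
    (Γ.integrable_pow_neg_integrablePower.const_mul _)
    (fun n => Eventually.of_forall (norm_corr_le (hf n) (hg n))) (Eventually.of_forall fun z => ?_)
  refine tendsto_integral_of_dominated_convergence _
    (fun n => ((hfm n).mul (hcm.comp ((hgm n).comp
      (measurable_id.sub_const z)))).aestronglyMeasurable)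
    ((volume : Measure (Space d)).integrable_pow_neg_integrablePower.const_mul _)
    (fun n => Eventually.of_forall fun x => corr_integrand_le (hf n) (hg n) x z) ?_
  have hgt' : ∀ᵐ x : Space d, Tendsto (fun n => g n (x - z)) atTop (𝓝 (g₀ (x - z))) :=
    (measurePreserving_sub_right volume z).quasiMeasurePreserving.ae hgt
  filter_upwards [hft, hgt'] with x h1 h2
  exact h1.mul ((Complex.continuous_conj.tendsto _).comp h2)

end

/-! ### Basic properties of `fourierT` -/

section
variable {d : ℕ}

theorem norm_cexp_neg_I_mul (r : ℝ) : ‖Complex.exp (-(Complex.I * (r : ℂ)))‖ = 1 := by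
  rw [show -(Complex.I * (r : ℂ)) = ((-r : ℝ) : ℂ) * Complex.I by push_cast; ring]
  exact Complex.norm_exp_ofReal_mul_I _

theorem integrable_fourier_integrand {f : Space d → ℂ} (hf : Integrable f) (ξ : Space d) :
    Integrable fun x => Complex.exp (-(Complex.I * ((inner ℝ ξ x : ℝ) : ℂ))) * f x := by
  refine hf.bdd_mul (c := 1) (Continuous.aestronglyMeasurable (by fun_prop))
    (Eventually.of_forall fun x => (norm_cexp_neg_I_mul _).le)

theorem fourierT_sub {f g : Space d → ℂ} (hf : Integrable f) (hg : Integrable g) (ξ : Space d) :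
    fourierT (f - g) ξ = fourierT f ξ - fourierT g ξ := by
  rw [fourierT, fourierT, fourierT, ← integral_sub (integrable_fourier_integrand hf ξ)
    (integrable_fourier_integrand hg ξ)]
  simp [mul_sub]

theorem continuous_fourierT {f : Space d → ℂ} (hf : Integrable f) : Continuous (fourierT f) := by
  refine continuous_of_dominated (bound := fun x => ‖f x‖)
    (fun ξ => (integrable_fourier_integrand hf ξ).aestronglyMeasurable)
    (fun ξ => Eventually.of_forall fun x => ?_) hf.norm (Eventually.of_forall fun x => by fun_prop)
  rw [norm_mul, norm_cexp_neg_I_mul, one_mul]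

theorem fourierT_conj_neg (g : Space d → ℂ) (ξ : Space d) :
    fourierT (fun x => (starRingEnd ℂ) (g (-x))) ξ = (starRingEnd ℂ) (fourierT g ξ) := by
  rw [fourierT, fourierT, ← integral_conj, ← integral_neg_eq_self]
  refine integral_congr_ae (Eventually.of_forall fun x => ?_)
  simp only [neg_neg, map_mul, inner_neg_right, ← Complex.exp_conj, map_neg, Complex.conj_I,
    Complex.conj_ofReal]
  push_cast
  ring_nf

theorem tendsto_fourierT {f : ℕ → Space d → ℂ} {f₀ : Space d → ℂ} {b : Space d → ℝ}
    (hfm : ∀ n, Measurable (f n)) (hb : Integrable b) (hf : ∀ n x, ‖f n x‖ ≤ b x)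
    (hft : ∀ᵐ x, Tendsto (fun n => f n x) atTop (𝓝 (f₀ x))) (ξ : Space d) :
    Tendsto (fun n => fourierT (f n) ξ) atTop (𝓝 (fourierT f₀ ξ)) := by
  refine tendsto_integral_of_dominated_convergence b
    (fun n => (Continuous.aestronglyMeasurable (by fun_prop)).mul (hfm n).aestronglyMeasurable) hb
    (fun n => Eventually.of_forall fun x => ?_) ?_
  · rw [norm_mul, norm_cexp_neg_I_mul, one_mul]
    exact hf n x
  · filter_upwards [hft] with x hx using hx.const_mul _

end

/-! ### The isometry -/

/-- `∫ ℱf \overline{ℱg} dμ = ∫ (∫ f(x) \overline{g(x - z)} dx) Γ(dz)`. -/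
def IsoPair {d : ℕ} (Γ μ : Measure (Space d)) (f g : Space d → ℂ) : Prop :=
  MemLp (fourierT f) 2 μ ∧ MemLp (fourierT g) 2 μ ∧
    ∫ ξ, fourierT f ξ * (starRingEnd ℂ) (fourierT g ξ) ∂μ = corrForm Γ f g

theorem eLpNorm_fourierT_of_isoPair {d : ℕ} {Γ μ : Measure (Space d)} {f : Space d → ℂ}
    (h : IsoPair Γ μ f f) :
    eLpNorm (fourierT f) 2 μ = (ENNReal.ofReal (corrForm Γ f f).re) ^ (1 / 2 : ℝ) := by
  have h1 := eLpNorm_two_sq_eq h.1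
  rw [h.2.2] at h1
  rw [← h1, ← ENNReal.rpow_natCast, ← ENNReal.rpow_mul]
  norm_num

section
variable {d : ℕ} {Γ μ : Measure (Space d)} [hΓ : Γ.HasTemperateGrowth]

/-- Dominated a.e. convergence implies convergence of the Fourier transforms in `L²(μ)`, within a
class on which the isometry holds. -/
theorem tendsto_eLpNorm_fourierT {V : Set (Space d → ℂ)}
    (hsub : ∀ f ∈ V, ∀ g ∈ V, f - g ∈ V) (hV : ∀ f ∈ V, Rapid Γ f)
    (hiso : ∀ f ∈ V, IsoPair Γ μ f f)
    {f : ℕ → Space d → ℂ} {f₀ : Space d → ℂ} {C : ℝ} (hfV : ∀ n, f n ∈ V) (hf₀ : Rapid Γ f₀)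
    (hf : ∀ n x, ‖f n x‖ ≤ C * weight (rapidExp Γ) x)
    (hft : ∀ᵐ x, Tendsto (fun n => f n x) atTop (𝓝 (f₀ x))) :
    MemLp (fourierT f₀) 2 μ ∧
      Tendsto (fun n => eLpNorm (fourierT (f n) - fourierT f₀) 2 μ) atTop (𝓝 0) := by
  have hfm : ∀ n, Measurable (f n) := fun n => (hV _ (hfV n)).1
  have hfi : ∀ n, Integrable (f n) := fun n => (hV _ (hfV n)).integrable
  have hfc : ∀ n, AEStronglyMeasurable (fourierT (f n)) μ := fun n =>
    (continuous_fourierT (hfi n)).aestronglyMeasurable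
  have hf₀c : AEStronglyMeasurable (fourierT f₀) μ :=
    (continuous_fourierT hf₀.integrable).aestronglyMeasurable
  obtain ⟨C₀, hC₀⟩ := hf₀.2
  -- The norm that the isometry would assign to `f n - f₀`. Since `f₀` need not lie in the class
  -- `V`, only the upper bound `hle` is obtained, by letting `m → ∞` in the isometry for `f n - f
  -- m`.
  let Q : ℕ → ℝ≥0∞ := fun n =>
    (ENNReal.ofReal (corrForm Γ (f n - f₀) (f n - f₀)).re) ^ (1 / 2 : ℝ)
  have hQ0 : Tendsto Q atTop (𝓝 0) := by
    have h1 : Tendsto (fun n => corrForm Γ (f n - f₀) (f n - f₀)) atTop (𝓝 (corrForm Γ 0 0)) := by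
      have hb : ∀ n x, ‖(f n - f₀) x‖ ≤ (C + C₀) * weight (rapidExp Γ) x := fun n x => by
        rw [add_mul]
        exact (norm_sub_le _ _).trans (add_le_add (hf n x) (hC₀ x))
      have ht : ∀ᵐ x, Tendsto (fun n => (f n - f₀) x) atTop (𝓝 ((0 : Space d → ℂ) x)) := by
        filter_upwards [hft] with x hx
        simpa using hx.sub_const (f₀ x)
      exact tendsto_corrForm (fun n => (hfm n).sub hf₀.1) (fun n => (hfm n).sub hf₀.1) hb hb ht ht
    have h0 : corrForm Γ (0 : Space d → ℂ) 0 = 0 := by simp [corrForm, corr]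
    rw [h0] at h1
    have h2 := (ENNReal.continuous_rpow_const (y := 1 / 2)).tendsto 0 |>.comp
      (ENNReal.tendsto_ofReal ((Complex.continuous_re.tendsto 0).comp h1) |>.trans (by simp))
    rw [ENNReal.zero_rpow_of_pos (by norm_num)] at h2
    exact h2
  have hle : ∀ n, eLpNorm (fourierT (f n) - fourierT f₀) 2 μ ≤ Q n := by
    intro n
    have h1 : Tendsto (fun m => corrForm Γ (f n - f m) (f n - f m)) atTop
        (𝓝 (corrForm Γ (f n - f₀) (f n - f₀))) := by
      have hb : ∀ m x, ‖(f n - f m) x‖ ≤ (C + C) * weight (rapidExp Γ) x := fun m x => by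
        rw [add_mul]
        exact (norm_sub_le _ _).trans (add_le_add (hf n x) (hf m x))
      have ht : ∀ᵐ x, Tendsto (fun m => (f n - f m) x) atTop (𝓝 ((f n - f₀) x)) := by
        filter_upwards [hft] with x hx
        exact hx.const_sub _
      exact tendsto_corrForm (fun m => (hfm n).sub (hfm m)) (fun m => (hfm n).sub (hfm m))
        hb hb ht ht
    have h2 : Tendsto (fun m => eLpNorm (fourierT (f n) - fourierT (f m)) 2 μ) atTop (𝓝 (Q n)) := by
      have h3 : ∀ m, eLpNorm (fourierT (f n) - fourierT (f m)) 2 μ =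
          (ENNReal.ofReal (corrForm Γ (f n - f m) (f n - f m)).re) ^ (1 / 2 : ℝ) := by
        intro m
        rw [← eLpNorm_fourierT_of_isoPair (hiso _ (hsub _ (hfV n) _ (hfV m)))]
        congr 1
        ext ξ
        exact (fourierT_sub (hfi n) (hfi m) ξ).symm
      simp_rw [h3]
      exact (ENNReal.continuous_rpow_const.tendsto _).comp
        (ENNReal.tendsto_ofReal ((Complex.continuous_re.tendsto _).comp h1))
    rw [← h2.liminf_eq]
    -- Fatou: the transforms of `f m` converge at every frequency, so the norm of the limit is at
    -- most the limit inferior of the norms.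
    refine Lp.eLpNorm_lim_le_liminf_eLpNorm (fun m => (hfc n).sub (hfc m)) _
      (Eventually.of_forall fun ξ => ?_)
    exact (tendsto_fourierT hfm ((integrable_weight Γ).const_mul C) hf hft ξ).const_sub _
  have htend : Tendsto (fun n => eLpNorm (fourierT (f n) - fourierT f₀) 2 μ) atTop (𝓝 0) :=
    tendsto_of_tendsto_of_tendsto_of_le_of_le tendsto_const_nhds hQ0 (fun _ => zero_le) hle
  refine ⟨?_, htend⟩
  obtain ⟨n, hn⟩ := (htend.eventually (gt_mem_nhds ENNReal.zero_lt_top)).exists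
  have h1 : MemLp (fourierT (f n) - fourierT f₀) 2 μ := ⟨(hfc n).sub hf₀c, hn⟩
  have h2 := (hiso _ (hfV n)).1.sub h1
  simpa using h2

/-- The extension step, used twice: from Schwartz functions to bounded functions of bounded support,
and from these to functions of rapid decay. -/
theorem isoPair_of_tendsto {V : Set (Space d → ℂ)}
    (hsub : ∀ f ∈ V, ∀ g ∈ V, f - g ∈ V) (hV : ∀ f ∈ V, Rapid Γ f)
    (hiso : ∀ f ∈ V, ∀ g ∈ V, IsoPair Γ μ f g)
    {f g : ℕ → Space d → ℂ} {f₀ g₀ : Space d → ℂ} {C D : ℝ}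
    (hfV : ∀ n, f n ∈ V) (hf₀ : Rapid Γ f₀)
    (hf : ∀ n x, ‖f n x‖ ≤ C * weight (rapidExp Γ) x)
    (hft : ∀ᵐ x, Tendsto (fun n => f n x) atTop (𝓝 (f₀ x)))
    (hgV : ∀ n, g n ∈ V) (hg₀ : Rapid Γ g₀)
    (hg : ∀ n x, ‖g n x‖ ≤ D * weight (rapidExp Γ) x)
    (hgt : ∀ᵐ x, Tendsto (fun n => g n x) atTop (𝓝 (g₀ x))) : IsoPair Γ μ f₀ g₀ := by
  obtain ⟨hF, hF'⟩ := tendsto_eLpNorm_fourierT hsub hV (fun f h => hiso f h f h) hfV hf₀ hf hft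
  obtain ⟨hG, hG'⟩ := tendsto_eLpNorm_fourierT hsub hV (fun f h => hiso f h f h) hgV hg₀ hg hgt
  refine ⟨hF, hG, ?_⟩
  have h1 := tendsto_integral_mul_conj (fun n => (hiso _ (hfV n) _ (hfV n)).1) hF
    (fun n => (hiso _ (hgV n) _ (hgV n)).1) hG hF' hG'
  have h2 := tendsto_corrForm (fun n => (hV _ (hfV n)).1) (fun n => (hV _ (hgV n)).1) hf hg hft hgt
  refine tendsto_nhds_unique h1 (h2.congr fun n => ?_)
  exact (hiso _ (hfV n) _ (hgV n)).2.2.symm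

end

end FracKinetic
end

noncomputable section

namespace FracKinetic

section
variable {d : ℕ} {Γ μ : Measure (Space d)}

/-! ### The isometry for Schwartz functions -/

/-- `x ↦ \overline{g(-x)}` as a Schwartz function. -/
def conjNeg (g : 𝓢(Space d, ℂ)) : 𝓢(Space d, ℂ) :=
  (SchwartzMap.compCLMOfContinuousLinearEquiv ℝ (ContinuousLinearEquiv.neg ℝ) g).postcompCLM
    (𝕜 := ℝ) (Complex.conjCLE : ℂ →L[ℝ] ℂ)

theorem conjNeg_apply (g : 𝓢(Space d, ℂ)) (x : Space d) :
    conjNeg g x = (starRingEnd ℂ) (g (-x)) := by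
  simp [conjNeg]

theorem fourierT_coe (f : 𝓢(Space d, ℂ)) : fourierT f = schwartzFourier f :=
  funext fun ξ => (schwartzFourier_apply f ξ).symm

theorem schwartz_rapid (Γ : Measure (Space d)) (f : 𝓢(Space d, ℂ)) : Rapid Γ f := by
  refine ⟨f.continuous.measurable, 2 ^ (rapidExp Γ) *
    ((Finset.Iic (rapidExp Γ, 0)).sup (schwartzSeminormFamily ℝ (Space d) ℂ)) f, fun x => ?_⟩
  have h := SchwartzMap.one_add_le_sup_seminorm_apply (𝕜 := ℝ) (m := (rapidExp Γ, 0))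
    (le_refl _) (le_refl _) f x
  simp only [norm_iteratedFDeriv_zero] at h
  have h0 : 0 < 1 + ‖x‖ := by positivity
  rw [weight, Real.rpow_neg h0.le, Real.rpow_natCast, ← div_eq_mul_inv, le_div_iff₀ (by positivity)]
  rw [mul_comm]
  exact h

/-- The correlation of `f` and `g` is the convolution of `f` with `x ↦ conj g(-x)`, whose Fourier
transform is `ℱf conj(ℱg)`. The identity is the spectral relation tested on this convolution. -/
theorem isoPair_schwartz (h : IsSpectralMeasure Γ μ) (f g : 𝓢(Space d, ℂ)) :
    IsoPair Γ μ f g := by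
  have := h.temperate_spectral
  refine ⟨by rw [fourierT_coe]; exact (schwartzFourier f).memLp 2 μ,
    by rw [fourierT_coe]; exact (schwartzFourier g).memLp 2 μ, ?_⟩
  let B : ℂ →L[ℂ] ℂ →L[ℂ] ℂ := ContinuousLinearMap.mul ℂ ℂ
  have h1 := h.fourier_eq (SchwartzMap.convolution B f (conjNeg g))
  rw [corrForm]
  have e1 : ∀ z, corr f g z = SchwartzMap.convolution B f (conjNeg g) z := by
    intro z
    rw [SchwartzMap.convolution_apply, convolution_def, corr]
    refine integral_congr_ae (Eventually.of_forall fun x => ?_)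
    simp [B, conjNeg_apply]
  simp_rw [e1]
  rw [h1]
  refine integral_congr_ae (Eventually.of_forall fun ξ => ?_)
  have e2 : (starRingEnd ℂ) (fourierT g ξ) = fourierT (conjNeg g) ξ := by
    rw [← fourierT_conj_neg]
    congr 1
  simp only
  rw [e2, ← schwartzFourier_apply, ← schwartzFourier_apply, ← schwartzFourier_apply]
  simp [schwartzFourier, SchwartzMap.fourier_convolution, B]

/-! ### Bounded measurable functions with bounded support -/

/-- Bounded measurable functions with bounded support. -/
def BddSupp (f : Space d → ℂ) : Prop :=
  Measurable f ∧ ∃ C R : ℝ, (∀ x, ‖f x‖ ≤ C) ∧ ∀ x, R < ‖x‖ → f x = 0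

theorem BddSupp.sub {f g : Space d → ℂ} (hf : BddSupp f) (hg : BddSupp g) : BddSupp (f - g) := by
  obtain ⟨hfm, C, R, hC, hR⟩ := hf
  obtain ⟨hgm, D, S, hD, hS⟩ := hg
  refine ⟨hfm.sub hgm, C + D, max R S, fun x => (norm_sub_le _ _).trans (add_le_add (hC x) (hD x)),
    fun x hx => ?_⟩
  rw [Pi.sub_apply, hR x ((le_max_left _ _).trans_lt hx), hS x ((le_max_right _ _).trans_lt hx),
    sub_zero]

theorem norm_le_weight_of_bddSupp {f : Space d → ℂ} {C R : ℝ} (N : ℕ) (hC : ∀ x, ‖f x‖ ≤ C)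
    (hR : ∀ x, R < ‖x‖ → f x = 0) (x : Space d) :
    ‖f x‖ ≤ C * (1 + |R|) ^ N * weight N x := by
  have h0 : 0 < 1 + ‖x‖ := by positivity
  have hC0 : 0 ≤ C := (norm_nonneg _).trans (hC 0)
  by_cases hx : R < ‖x‖
  · rw [hR x hx, norm_zero]
    have := weight_pos N x
    positivity
  · rw [weight, Real.rpow_neg h0.le, Real.rpow_natCast, ← div_eq_mul_inv,
      le_div_iff₀ (by positivity)]
    have : ‖x‖ ≤ |R| := (not_lt.1 hx).trans (le_abs_self R)
    exact mul_le_mul (hC x) (by gcongr) (by positivity) hC0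

theorem BddSupp.rapid {f : Space d → ℂ} (Γ : Measure (Space d)) (hf : BddSupp f) : Rapid Γ f := by
  obtain ⟨hfm, C, R, hC, hR⟩ := hf
  exact ⟨hfm, _, norm_le_weight_of_bddSupp _ hC hR⟩

/-- A sequence of bump functions shrinking to the origin. -/
def shrinkingBump (d : ℕ) (n : ℕ) : ContDiffBump (0 : Space d) where
  rIn := 1 / (2 * ((n : ℝ) + 1))
  rOut := 1 / ((n : ℝ) + 1)
  rIn_pos := by positivity
  rIn_lt_rOut := by
    apply one_div_lt_one_div_of_lt <;> [positivity; skip]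
    have : (0 : ℝ) < n + 1 := by positivity
    linarith

/-- Mollification of a bounded function with bounded support. -/
theorem exists_schwartz_tendsto {f : Space d → ℂ} (hf : BddSupp f) (N : ℕ) :
    ∃ (φ : ℕ → 𝓢(Space d, ℂ)) (C : ℝ), (∀ n x, ‖φ n x‖ ≤ C * weight N x) ∧
      ∀ᵐ x, Tendsto (fun n => φ n x) atTop (𝓝 (f x)) := by
  -- Any measure serves here: the decay exponent always includes the power that makes the weight
  -- Lebesgue integrable.
  have hfi : Integrable f := (hf.rapid (0 : Measure (Space d))).integrable
  obtain ⟨hfm, C, R, hC, hR⟩ := hf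
  have hC0 : 0 ≤ C := (norm_nonneg _).trans (hC 0)
  let L : ℝ →L[ℝ] ℂ →L[ℝ] ℂ := ContinuousLinearMap.lsmul ℝ ℝ
  let φ : ℕ → Space d → ℂ := fun n => convolution ((shrinkingBump d n).normed volume) f L volume
  have hfs : HasCompactSupport f := by
    refine HasCompactSupport.of_support_subset_isCompact (isCompact_closedBall (0 : Space d) R) ?_
    intro x hx
    rw [mem_closedBall_zero_iff]
    by_contra h
    exact hx (hR x (not_le.1 h))
  have hsm : ∀ n, ContDiff ℝ ((⊤ : ℕ∞) : WithTop ℕ∞) (φ n) := fun n =>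
    ((shrinkingBump d n).hasCompactSupport_normed).contDiff_convolution_left L
      ((shrinkingBump d n).contDiff_normed) hfi.locallyIntegrable
  have hcs : ∀ n, HasCompactSupport (φ n) := fun n =>
    ((shrinkingBump d n).hasCompactSupport_normed).convolution L hfs
  have hbd : ∀ n x, ‖φ n x‖ ≤ C := by
    intro n x
    calc ‖φ n x‖ ≤ ∫ y, (shrinkingBump d n).normed volume y * C := by
          refine norm_integral_le_of_norm_le
            (((shrinkingBump d n).integrable_normed).mul_const C) (Eventually.of_forall fun y => ?_)
          rw [show L ((shrinkingBump d n).normed volume y) (f (x - y)) =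
            (shrinkingBump d n).normed volume y • f (x - y) from rfl, norm_smul,
            Real.norm_of_nonneg ((shrinkingBump d n).nonneg_normed _)]
          exact mul_le_mul_of_nonneg_left (hC _) ((shrinkingBump d n).nonneg_normed _)
      _ = C := by rw [integral_mul_const, (shrinkingBump d n).integral_normed, one_mul]
  have hsupp : ∀ n x, R + 1 < ‖x‖ → φ n x = 0 := by
    intro n x hx
    have h0 : ∀ y, L ((shrinkingBump d n).normed volume y) (f (x - y)) = 0 := by
      intro y
      by_cases hy : y ∈ Metric.ball (0 : Space d) (shrinkingBump d n).rOut
      · have h1 : ‖y‖ < 1 := by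
          refine (mem_ball_zero_iff.1 hy).trans_le ?_
          change 1 / ((n : ℝ) + 1) ≤ 1
          rw [div_le_one (by positivity)]
          linarith [(Nat.cast_nonneg n : (0 : ℝ) ≤ n)]
        rw [hR (x - y) (by linarith [norm_sub_norm_le x y]), map_zero]
      · rw [← (shrinkingBump d n).support_normed_eq (μ := volume)] at hy
        rw [Function.notMem_support.1 hy, map_zero, zero_apply]
    simp only [φ, convolution_def, h0, integral_zero]
  refine ⟨fun n => (hcs n).toSchwartzMap (hsm n), C * (1 + |R + 1|) ^ N, fun n x => ?_, ?_⟩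
  · exact norm_le_weight_of_bddSupp N (hbd n) (hsupp n) x
  · refine ContDiffBump.ae_convolution_tendsto_right_of_locallyIntegrable (K := 2)
      (φ := shrinkingBump d) tendsto_one_div_add_atTop_nhds_zero_nat
      (Eventually.of_forall fun n => ?_) hfi.locallyIntegrable
    change 1 / ((n : ℝ) + 1) ≤ 2 * (1 / (2 * ((n : ℝ) + 1)))
    apply le_of_eq
    field_simp

theorem isoPair_bddSupp (h : IsSpectralMeasure Γ μ) {f g : Space d → ℂ} (hf : BddSupp f)
    (hg : BddSupp g) : IsoPair Γ μ f g := by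
  have := h.temperate_cov
  obtain ⟨φ, C, hφ, hφt⟩ := exists_schwartz_tendsto hf (rapidExp Γ)
  obtain ⟨ψ, D, hψ, hψt⟩ := exists_schwartz_tendsto hg (rapidExp Γ)
  refine isoPair_of_tendsto (V := Set.range fun φ : 𝓢(Space d, ℂ) => (φ : Space d → ℂ)) ?_ ?_ ?_
    (fun n => ⟨φ n, rfl⟩) (hf.rapid Γ) hφ hφt (fun n => ⟨ψ n, rfl⟩) (hg.rapid Γ) hψ hψt
  · rintro _ ⟨a, rfl⟩ _ ⟨b, rfl⟩
    exact ⟨a - b, by ext; simp⟩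
  · rintro _ ⟨a, rfl⟩
    exact schwartz_rapid Γ a
  · rintro _ ⟨a, rfl⟩ _ ⟨b, rfl⟩
    exact isoPair_schwartz h a b

/-- Truncation to balls of radius `n` reduces to bounded support, with the untruncated bound as
majorant. -/
theorem isoPair_rapid (h : IsSpectralMeasure Γ μ) {f g : Space d → ℂ} (hf : Rapid Γ f)
    (hg : Rapid Γ g) : IsoPair Γ μ f g := by
  have := h.temperate_cov
  have key : ∀ {f : Space d → ℂ}, Rapid Γ f → ∃ (φ : ℕ → Space d → ℂ) (C : ℝ),
      (∀ n, BddSupp (φ n)) ∧ (∀ n x, ‖φ n x‖ ≤ C * weight (rapidExp Γ) x) ∧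
        ∀ᵐ x, Tendsto (fun n => φ n x) atTop (𝓝 (f x)) := by
    intro f hf
    obtain ⟨hfm, C, hC⟩ := hf
    have hC0 : 0 ≤ C := nonneg_of_mul_nonneg_left ((norm_nonneg _).trans (hC 0)) (weight_pos _ _)
    refine ⟨fun n => (Metric.closedBall (0 : Space d) n).indicator f, C, fun n => ?_, fun n x => ?_,
      Eventually.of_forall fun x => ?_⟩
    · refine ⟨hfm.indicator Metric.isClosed_closedBall.measurableSet, C, n, fun x => ?_, fun x hx => ?_⟩
      · refine (norm_indicator_le_norm_self _ _).trans ((hC x).trans ?_)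
        refine mul_le_of_le_one_right hC0 ?_
        exact Real.rpow_le_one_of_one_le_of_nonpos (by linarith [norm_nonneg x]) (by simp)
      · exact Set.indicator_of_notMem (by simpa using hx) _
    · exact (norm_indicator_le_norm_self _ _).trans (hC x)
    · obtain ⟨n, hn⟩ := exists_nat_ge ‖x‖
      refine tendsto_const_nhds.congr' ?_
      filter_upwards [eventually_ge_atTop n] with m hm
      rw [Set.indicator_of_mem]
      rw [mem_closedBall_zero_iff]
      exact hn.trans (by exact_mod_cast hm)
  obtain ⟨φ, C, hφV, hφ, hφt⟩ := key hf
  obtain ⟨ψ, D, hψV, hψ, hψt⟩ := key hg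
  exact isoPair_of_tendsto (V := {f | BddSupp f}) (fun a ha b hb => ha.sub hb)
    (fun a ha => BddSupp.rapid Γ ha) (fun a ha b hb => isoPair_bddSupp h ha hb)
    hφV hf hφ hφt hψV hg hψ hψt

theorem tendsto_eLpNorm_fourierT_rapid (h : IsSpectralMeasure Γ μ)
    {f : ℕ → Space d → ℂ} {f₀ : Space d → ℂ} {C : ℝ} (hfm : ∀ n, Measurable (f n))
    (hf₀ : Rapid Γ f₀) (hf : ∀ n x, ‖f n x‖ ≤ C * weight (rapidExp Γ) x)
    (hft : ∀ᵐ x, Tendsto (fun n => f n x) atTop (𝓝 (f₀ x))) :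
    Tendsto (fun n => eLpNorm (fourierT (f n) - fourierT f₀) 2 μ) atTop (𝓝 0) := by
  have := h.temperate_cov
  exact (tendsto_eLpNorm_fourierT (V := {f | Rapid Γ f}) (fun a ha b hb => ha.sub hb)
    (fun a ha => ha) (fun a ha => isoPair_rapid h ha ha) (fun n => ⟨hfm n, C, hf n⟩) hf₀ hf hft).2

end

/-! ### Measures of temperate growth -/

theorem isFiniteMeasureOnCompacts_of_hasTemperateGrowth {d : ℕ} (μ : Measure (Space d))
    [μ.HasTemperateGrowth] : IsFiniteMeasureOnCompacts μ := by
  refine ⟨fun K hK => ?_⟩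
  obtain ⟨R, hR⟩ := hK.isBounded.exists_norm_le
  have hi := μ.integrable_pow_neg_integrablePower
  have hc : 0 < (1 + |R|) ^ (-(μ.integrablePower : ℝ)) := Real.rpow_pos_of_pos (by positivity) _
  refine (measure_mono fun x hx => ?_).trans_lt (hi.measure_ge_lt_top hc)
  exact Real.rpow_le_rpow_of_nonpos (by positivity)
    (by linarith [hR x hx, le_abs_self R]) (by simp)

theorem sigmaFinite_of_hasTemperateGrowth {d : ℕ} (μ : Measure (Space d))
    [μ.HasTemperateGrowth] : SigmaFinite μ := by
  have := isFiniteMeasureOnCompacts_of_hasTemperateGrowth μ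
  infer_instance

end FracKinetic
end

noncomputable section

namespace FracKinetic

section
variable {Ω : Type*} [MeasurableSpace Ω] {P : Measure Ω} [IsProbabilityMeasure P]

/-! ### Limits of Gaussian variables -/

theorem norm_cexp_mul_I_sub_le (a b : ℝ) :
    ‖Complex.exp ((a : ℂ) * Complex.I) - Complex.exp ((b : ℂ) * Complex.I)‖ ≤ ‖a - b‖ := by
  have h : Complex.exp ((a : ℂ) * Complex.I) - Complex.exp ((b : ℂ) * Complex.I) =
      Complex.exp ((b : ℂ) * Complex.I) * (Complex.exp (Complex.I * ((a - b : ℝ) : ℂ)) - 1) := by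
    rw [mul_sub, ← Complex.exp_add, mul_one]
    push_cast
    ring_nf
  rw [h, norm_mul, Complex.norm_exp_ofReal_mul_I, one_mul]
  exact Real.norm_exp_I_mul_ofReal_sub_one_le

theorem tendsto_eLpNorm_one {X : ℕ → Ω → ℝ} {Y : Ω → ℝ} (hX : ∀ n, MemLp (X n) 2 P)
    (hY : MemLp Y 2 P) (h : Tendsto (fun n => eLpNorm (X n - Y) 2 P) atTop (𝓝 0)) :
    Tendsto (fun n => eLpNorm (X n - Y) 1 P) atTop (𝓝 0) :=
  tendsto_of_tendsto_of_tendsto_of_le_of_le tendsto_const_nhds h (fun _ => zero_le) fun n =>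
    eLpNorm_le_eLpNorm_of_exponent_le (by norm_num)
      ((hX n).aestronglyMeasurable.sub hY.aestronglyMeasurable)

theorem tendsto_integral_of_L2 {X : ℕ → Ω → ℝ} {Y : Ω → ℝ} (hX : ∀ n, MemLp (X n) 2 P)
    (hY : MemLp Y 2 P) (h : Tendsto (fun n => eLpNorm (X n - Y) 2 P) atTop (𝓝 0)) :
    Tendsto (fun n => ∫ ω, X n ω ∂P) atTop (𝓝 (∫ ω, Y ω ∂P)) :=
  tendsto_integral_of_L1' _ hY.aestronglyMeasurable
    (Eventually.of_forall fun n => (hX n).integrable (by norm_num)) (tendsto_eLpNorm_one hX hY h)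

theorem tendsto_variance_of_L2 {X : ℕ → Ω → ℝ} {Y : Ω → ℝ} (hX : ∀ n, MemLp (X n) 2 P)
    (hY : MemLp Y 2 P) (h : Tendsto (fun n => eLpNorm (X n - Y) 2 P) atTop (𝓝 0)) :
    Tendsto (fun n => Var[X n; P]) atTop (𝓝 Var[Y; P]) := by
  have h1 := tendsto_integral_mul_conj hX hY hX hY h h
  have h2 := tendsto_integral_of_L2 hX hY h
  have h3 := h1.sub (h2.pow 2)
  simp only [conj_trivial, ← pow_two] at h3
  rw [variance_eq_sub hY]
  refine h3.congr fun n => ?_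
  rw [variance_eq_sub (hX n)]
  rfl

/-- `L²` convergence carries means and variances to the limit and, since `x ↦ e^{ix}` is
1-Lipschitz, characteristic functions as well. So the limit has the Gaussian characteristic
function. -/
theorem hasGaussianLaw_of_tendsto {X : ℕ → Ω → ℝ} {Y : Ω → ℝ} (hX : ∀ n, HasGaussianLaw (X n) P)
    (hY : MemLp Y 2 P) (h : Tendsto (fun n => eLpNorm (X n - Y) 2 P) atTop (𝓝 0)) :
    HasGaussianLaw Y P := by
  rw [hasGaussianLaw_iff_charFunDual_map_eq hY.aestronglyMeasurable.aemeasurable]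
  intro L
  have hL : ∀ X : Ω → ℝ, L ∘ X = L 1 • X := by
    intro X
    ext ω
    simp only [Function.comp, Pi.smul_apply, smul_eq_mul]
    conv_lhs => rw [← mul_one (X ω), ← smul_eq_mul, map_smul, smul_eq_mul, mul_comm]
  have hLX : ∀ n, MemLp (L ∘ X n) 2 P := fun n => by
    rw [hL]; exact (hX n).memLp_two.const_smul _
  have hLY : MemLp (L ∘ Y) 2 P := by rw [hL]; exact hY.const_smul _
  have hLt : Tendsto (fun n => eLpNorm (L ∘ X n - L ∘ Y) 2 P) atTop (𝓝 0) := by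
    have : ∀ n, eLpNorm (L ∘ X n - L ∘ Y) 2 P = ‖L 1‖ₑ * eLpNorm (X n - Y) 2 P := fun n => by
      rw [hL, hL, ← smul_sub, eLpNorm_const_smul]
    simp_rw [this]
    simpa using ENNReal.Tendsto.const_mul h (Or.inr (by simp))
  have hchar : ∀ X : Ω → ℝ, AEMeasurable X P →
      charFunDual (P.map X) L = ∫ ω, Complex.exp ((((L ∘ X) ω : ℝ) : ℂ) * Complex.I) ∂P := by
    intro X hX
    rw [charFunDual_apply, integral_map hX (by fun_prop)]
    rfl
  have hmeas : ∀ X : Ω → ℝ, AEStronglyMeasurable X P →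
      Integrable (fun ω => Complex.exp (((X ω : ℝ) : ℂ) * Complex.I)) P := by
    intro X hX
    refine Integrable.of_bound (C := 1) ?_ (Eventually.of_forall fun ω =>
      (Complex.norm_exp_ofReal_mul_I _).le)
    exact (by fun_prop : Continuous fun x : ℝ => Complex.exp ((x : ℂ) * Complex.I)
      ).comp_aestronglyMeasurable hX
  have h1 : Tendsto (fun n => charFunDual (P.map (X n)) L) atTop
      (𝓝 (charFunDual (P.map Y) L)) := by
    rw [hchar Y hY.aestronglyMeasurable.aemeasurable]
    simp_rw [fun n => hchar (X n) (hX n).aemeasurable]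
    refine tendsto_integral_of_L1 _ (hmeas _ hLY.aestronglyMeasurable).aestronglyMeasurable
      (Eventually.of_forall fun n => hmeas _ (hLX n).aestronglyMeasurable) ?_
    refine tendsto_of_tendsto_of_tendsto_of_le_of_le tendsto_const_nhds
      (tendsto_eLpNorm_one hLX hLY hLt) (fun _ => zero_le) fun n => ?_
    simp only [eLpNorm_one_eq_lintegral_enorm]
    refine lintegral_mono fun ω => ?_
    exact enorm_le_iff_norm_le.2 (norm_cexp_mul_I_sub_le _ _)
  have h2 := tendsto_integral_of_L2 hLX hLY hLt
  have h3 := tendsto_variance_of_L2 hLX hLY hLt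
  have h4 : Tendsto (fun n => Complex.exp ((P[L ∘ X n] : ℝ) * Complex.I -
      (Var[L ∘ X n; P] : ℝ) / 2)) atTop (𝓝 (Complex.exp ((P[L ∘ Y] : ℝ) * Complex.I -
      (Var[L ∘ Y; P] : ℝ) / 2))) := by
    refine (Complex.continuous_exp.tendsto _).comp (Tendsto.sub ?_ ?_)
    · exact ((Complex.continuous_ofReal.tendsto _).comp h2).mul_const _
    · exact ((Complex.continuous_ofReal.tendsto _).comp h3).div_const _
  refine tendsto_nhds_unique h1 (h4.congr fun n => ?_)
  exact ((hX n).charFunDual_map_eq L).symm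

/-- Every linear functional of a finite-dimensional marginal of `U` is an `L²` limit of Gaussian
variables, hence Gaussian; this characterises Gaussian vectors. -/
theorem isGaussianProcess_of_tendsto {T : Type*} {Y : ℕ → T → Ω → ℝ} {U : T → Ω → ℝ}
    (hY : ∀ n, IsGaussianProcess (Y n) P) (hU : ∀ t, MemLp (U t) 2 P)
    (h : ∀ t, Tendsto (fun n => eLpNorm (Y n t - U t) 2 P) atTop (𝓝 0)) :
    IsGaussianProcess U P := by
  classical
  refine ⟨fun I => ⟨?_⟩⟩
  have hm : AEMeasurable (fun ω => I.restrict (U · ω)) P :=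
    aemeasurable_pi_lambda _ fun i => (hU i).aestronglyMeasurable.aemeasurable
  refine isGaussian_of_map_eq_gaussianReal fun L => ?_
  rw [AEMeasurable.map_map_of_aemeasurable (by fun_prop) hm]
  have hL : ∀ Z : T → Ω → ℝ, (L ∘ fun ω => I.restrict (Z · ω)) =
      ∑ i : I, L (Pi.single i 1) • Z i := by
    intro Z
    ext ω
    simp only [Function.comp, Finset.sum_apply, Pi.smul_apply, smul_eq_mul]
    conv_lhs => rw [pi_eq_sum_univ' (I.restrict (Z · ω))]
    rw [map_sum]
    refine Finset.sum_congr rfl fun i _ => ?_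
    rw [map_smul, smul_eq_mul, mul_comm]
    congr 2
  have hg : HasGaussianLaw (L ∘ fun ω => I.restrict (U · ω)) P := by
    refine hasGaussianLaw_of_tendsto (X := fun n => L ∘ fun ω => I.restrict (Y n · ω))
      (fun n => ((hY n).hasGaussianLaw I).map L) ?_ ?_
    · rw [hL]
      exact memLp_finsetSum' _ fun i _ => (hU i).const_smul _
    · have hb : Tendsto (fun n => ∑ i : I, ‖L (Pi.single i 1)‖ₑ * eLpNorm (Y n i - U i) 2 P)
          atTop (𝓝 0) := by
        have := tendsto_finsetSum (Finset.univ : Finset I) fun i _ =>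
          ENNReal.Tendsto.const_mul (h i) (Or.inr (by simp : ‖L (Pi.single i 1)‖ₑ ≠ ∞))
        simpa using this
      refine tendsto_of_tendsto_of_tendsto_of_le_of_le tendsto_const_nhds hb (fun _ => zero_le)
        fun n => ?_
      simp only
      rw [hL, hL, ← Finset.sum_sub_distrib]
      refine (eLpNorm_sum_le (fun i _ => ?_) (by norm_num)).trans (le_of_eq ?_)
      · exact (((hY n).hasGaussianLaw_eval i).memLp_two.const_smul _).aestronglyMeasurable.sub
          ((hU i).const_smul _).aestronglyMeasurable
      · refine Finset.sum_congr rfl fun i _ => ?_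
        rw [← smul_sub, eLpNorm_const_smul]
  exact ⟨_, _, hg.map_eq_gaussianReal⟩

/-- Centered Gaussian vectors with the same covariances have the same law. -/
theorem identDistrib_of_covariance_eq {T : Type*} {U : T → Ω → ℝ} (hU : IsGaussianProcess U P)
    (h0 : ∀ t, ∫ ω, U t ω ∂P = 0) {n : ℕ} (x y : Fin n → T)
    (hc : ∀ i j, cov[U (x i), U (x j); P] = cov[U (y i), U (y j); P]) :
    IdentDistrib (fun ω i => U (x i) ω) (fun ω i => U (y i) ω) P P := by
  classical
  have hL2 : ∀ t, MemLp (U t) 2 P := fun t => (hU.hasGaussianLaw_eval t).memLp_two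
  have hg : ∀ x : Fin n → T, HasGaussianLaw (fun ω i => U (x i) ω) P := by
    intro x
    have h1 := (hU.comp_right x).hasGaussianLaw Finset.univ
    -- Only a reindexing: marginals of a process are indexed by the subtype of a finite set.
    let K : ({i // i ∈ (Finset.univ : Finset (Fin n))} → ℝ) →L[ℝ] Fin n → ℝ :=
      ContinuousLinearMap.pi fun i => ContinuousLinearMap.proj ⟨i, Finset.mem_univ i⟩
    exact h1.map K
  refine ⟨(hg x).aemeasurable, (hg y).aemeasurable, ?_⟩
  have := (hg x).isGaussian_map
  have := (hg y).isGaussian_map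
  refine Measure.ext_of_charFunDual (funext fun L => ?_)
  have hL : ∀ z : Fin n → T, (fun ω => L fun i => U (z i) ω) =
      fun ω => ∑ i, L (Pi.single i 1) * U (z i) ω := by
    intro z
    ext ω
    conv_lhs => rw [pi_eq_sum_univ' (fun i => U (z i) ω)]
    rw [map_sum]
    refine Finset.sum_congr rfl fun i _ => ?_
    rw [map_smul, smul_eq_mul, mul_comm]
  have hmean : ∀ z : Fin n → T, ∫ ω, L (fun i => U (z i) ω) ∂P = 0 := by
    intro z
    rw [hL z, integral_finsetSum _ fun i _ =>
      ((hL2 (z i)).integrable (by norm_num)).const_mul _]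
    simp [integral_const_mul, h0]
  have hvar : ∀ z : Fin n → T, Var[fun ω => L fun i => U (z i) ω; P] =
      ∑ i, ∑ j, L (Pi.single i 1) * (L (Pi.single j 1) * cov[U (z i), U (z j); P]) := by
    intro z
    rw [hL z, variance_fun_sum fun i => (hL2 (z i)).const_mul _]
    simp only [covariance_const_mul_left, covariance_const_mul_right]
    exact Finset.sum_congr rfl fun i _ => Finset.sum_congr rfl fun j _ => by ring
  rw [(hg x).charFunDual_map_eq_fun, (hg y).charFunDual_map_eq_fun, hmean, hmean, hvar, hvar]
  simp only [hc]

end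

end FracKinetic
end

/-! ### Wiener integrals of deterministic integrands -/

noncomputable section

namespace FracKinetic

section
variable {d : ℕ}

/-! ### Elementary integrands -/

/-- The indicator function of a bounded Borel set. -/
def indFun (A : BddBorel d) : Space d → ℂ := A.1.indicator fun _ => 1

theorem bddSupp_indFun (A : BddBorel d) : BddSupp (indFun A) := by
  obtain ⟨R, hR⟩ := A.2.2.exists_norm_le
  refine ⟨measurable_const.indicator A.2.1, 1, R, fun x => ?_, fun x hx => ?_⟩
  · exact (norm_indicator_le_norm_self _ _).trans (by simp)
  · exact Set.indicator_of_notMem (fun h => not_lt.2 (hR x h) hx) _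

/-- The space-time reference measure `1_{s ≥ 0} ds μ(dξ)`. -/
def spaceTime (μ : Measure (Space d)) : Measure (ℝ × Space d) :=
  (volume.restrict (Set.Ici (0 : ℝ))).prod μ

/-- The spatial Fourier transform of `1_{[0,t] × A}`. -/
def basisFourier (q : ℝ≥0 × BddBorel d) (p : ℝ × Space d) : ℂ :=
  (Set.Icc (0 : ℝ) q.1).indicator (fun _ => (1 : ℂ)) p.1 * fourierT (indFun q.2) p.2

/-- The spatial Fourier transform of an elementary function. -/
def elemFourier (φ : Elementary d) : ℝ × Space d → ℂ :=
  Finsupp.linearCombination ℝ basisFourier φ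

theorem elemFourier_eq (φ : Elementary d) (p : ℝ × Space d) :
    fourierT (fun x => (φ.toFun p.1 x : ℂ)) p.2 = elemFourier φ p := by
  rw [elemFourier, Finsupp.linearCombination_apply, Finsupp.sum, Finset.sum_apply]
  have h1 : ∀ x, (φ.toFun p.1 x : ℂ) = ∑ q ∈ φ.support,
      ((φ q : ℂ) * (Set.Icc (0 : ℝ) q.1).indicator (fun _ => (1 : ℂ)) p.1) * indFun q.2 x := by
    intro x
    rw [Elementary.toFun, Finsupp.sum]
    push_cast
    refine Finset.sum_congr rfl fun q _ => ?_
    rw [mul_assoc]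
    congr 1
    by_cases h1 : p.1 ∈ Set.Icc (0 : ℝ) q.1 <;> by_cases h2 : x ∈ q.2.1 <;>
      simp [indFun, Set.indicator, h1, h2]
  have hi : ∀ q : ℝ≥0 × BddBorel d, Integrable (indFun q.2) := fun q =>
    ((bddSupp_indFun q.2).rapid 0).integrable
  simp only [fourierT, h1, Finset.mul_sum]
  rw [integral_finsetSum _ fun q _ => integrable_fourier_integrand ((hi q).const_mul _) _]
  refine Finset.sum_congr rfl fun q _ => ?_
  rw [Pi.smul_apply, basisFourier, Complex.real_smul, ← mul_assoc, fourierT, ← integral_const_mul]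
  refine integral_congr_ae (Eventually.of_forall fun x => ?_)
  simp only
  ring

theorem integral_eq_linearCombination {Ω : Type*} (W : ℝ≥0 → BddBorel d → Ω → ℝ)
    (φ : Elementary d) :
    φ.integral W = Finsupp.linearCombination ℝ (fun q : ℝ≥0 × BddBorel d => W q.1 q.2) φ := by
  ext ω
  rw [Finsupp.linearCombination_apply, Finsupp.sum, Finset.sum_apply]
  rfl

theorem memLp_mul_prod {μ : Measure (Space d)} [SFinite μ] {a : ℝ → ℂ} {b : Space d → ℂ}
    {ν : Measure ℝ} [SFinite ν] (ha : MemLp a 2 ν) (hb : MemLp b 2 μ) :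
    MemLp (fun p : ℝ × Space d => a p.1 * b p.2) 2 (ν.prod μ) := by
  have hm : AEStronglyMeasurable (fun p : ℝ × Space d => a p.1 * b p.2) (ν.prod μ) :=
    ha.1.comp_fst.mul hb.1.comp_snd
  rw [memLp_two_iff_integrable_sq_norm hm]
  have h1 := (memLp_two_iff_integrable_sq_norm ha.1).1 ha
  have h2 := (memLp_two_iff_integrable_sq_norm hb.1).1 hb
  simpa only [norm_mul, mul_pow] using h1.mul_prod h2

variable {Γ μ : Measure (Space d)}

theorem memLp_indicator_Icc (t : ℝ) :
    MemLp ((Set.Icc (0 : ℝ) t).indicator fun _ => (1 : ℂ)) 2 (volume.restrict (Set.Ici 0)) := by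
  refine memLp_indicator_const 2 measurableSet_Icc _ (Or.inr ?_)
  exact ((Measure.restrict_apply_le _ _).trans_lt (by simp)).ne

theorem memLp_basisFourier (h : IsSpectralMeasure Γ μ) (q : ℝ≥0 × BddBorel d) :
    MemLp (basisFourier q) 2 (spaceTime μ) := by
  have := h.temperate_spectral
  have := sigmaFinite_of_hasTemperateGrowth μ
  exact memLp_mul_prod (memLp_indicator_Icc _)
    (isoPair_bddSupp h (bddSupp_indFun q.2) (bddSupp_indFun q.2)).1

theorem memLp_elemFourier (h : IsSpectralMeasure Γ μ) (φ : Elementary d) :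
    MemLp (elemFourier φ) 2 (spaceTime μ) := by
  rw [elemFourier, Finsupp.linearCombination_apply, Finsupp.sum]
  exact memLp_finsetSum' _ fun q _ => (memLp_basisFourier h q).const_smul _

/-- The isometry on generators: intersecting the time intervals gives the minimum, `isoPair_bddSupp`
gives the space factor, and the right-hand side is the covariance prescribed for the noise. -/
theorem integral_basisFourier (h : IsSpectralMeasure Γ μ) (p q : ℝ≥0 × BddBorel d) :
    ∫ x, basisFourier p x * (starRingEnd ℂ) (basisFourier q x) ∂(spaceTime μ) =
      (((min p.1 q.1 : ℝ≥0) : ℝ) * ∫ z, (∫ x, p.2.1.indicator (fun _ => (1 : ℝ)) x *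
        q.2.1.indicator (fun _ => (1 : ℝ)) (x - z)) ∂Γ : ℝ) := by
  have := h.temperate_spectral
  have := sigmaFinite_of_hasTemperateGrowth μ
  have e1 : ∀ x : ℝ × Space d, basisFourier p x * (starRingEnd ℂ) (basisFourier q x) =
      (Set.Icc (0 : ℝ) (min p.1 q.1 : ℝ≥0)).indicator (fun _ => (1 : ℂ)) x.1 *
        (fourierT (indFun p.2) x.2 * (starRingEnd ℂ) (fourierT (indFun q.2) x.2)) := by
    intro x
    have : (Set.Icc (0 : ℝ) (min p.1 q.1 : ℝ≥0)).indicator (fun _ => (1 : ℂ)) x.1 =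
        (Set.Icc (0 : ℝ) p.1).indicator (fun _ => (1 : ℂ)) x.1 *
          (Set.Icc (0 : ℝ) q.1).indicator (fun _ => (1 : ℂ)) x.1 := by
      rw [← Set.inter_indicator_mul, Set.Icc_inter_Icc]
      simp
    rw [this, basisFourier, basisFourier, map_mul]
    have h2 : (starRingEnd ℂ) ((Set.Icc (0 : ℝ) q.1).indicator (fun _ => (1 : ℂ)) x.1) =
        (Set.Icc (0 : ℝ) q.1).indicator (fun _ => (1 : ℂ)) x.1 := by
      by_cases h : x.1 ∈ Set.Icc (0 : ℝ) q.1
      · rw [Set.indicator_of_mem h, map_one]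
      · rw [Set.indicator_of_notMem h, map_zero]
    rw [h2]
    ring
  simp_rw [e1]
  rw [spaceTime, integral_prod_mul (fun s => (Set.Icc (0 : ℝ)
    (min p.1 q.1 : ℝ≥0)).indicator (fun _ => (1 : ℂ)) s)
    (fun ξ => fourierT (indFun p.2) ξ * (starRingEnd ℂ) (fourierT (indFun q.2) ξ)),
    (isoPair_bddSupp h (bddSupp_indFun p.2) (bddSupp_indFun q.2)).2.2]
  rw [Complex.ofReal_mul, corrForm, ← integral_complex_ofReal]
  congr 1
  · rw [integral_indicator measurableSet_Icc, Measure.restrict_restrict measurableSet_Icc,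
      Set.inter_eq_left.2 fun x hx => hx.1]
    simp
  · refine integral_congr_ae (Eventually.of_forall fun z => ?_)
    simp only [corr]
    rw [← integral_complex_ofReal]
    refine integral_congr_ae (Eventually.of_forall fun x => ?_)
    by_cases h1 : x ∈ p.2.1 <;> by_cases h2 : x - z ∈ q.2.1 <;> simp [indFun, h1, h2]

/-! ### The Wiener isometry -/

/-- The elementary integrands as elements of `L²(ds μ(dξ))`. -/
def elemLp (h : IsSpectralMeasure Γ μ) : Elementary d →ₗ[ℝ] Lp ℂ 2 (spaceTime μ) where
  toFun φ := (memLp_elemFourier h φ).toLp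
  map_add' φ ψ := by
    rw [← MemLp.toLp_add]
    congr 1
    exact map_add _ φ ψ
  map_smul' c φ := by
    rw [RingHom.id_apply, ← MemLp.toLp_const_smul]
    congr 1
    exact map_smul _ c φ

variable {Ω : Type*} [MeasurableSpace Ω] {P : Measure Ω}
  {W : ℝ≥0 → BddBorel d → Ω → ℝ}

theorem isGaussianProcess_integral (hW : IsNoise P Γ W) :
    IsGaussianProcess (fun φ : Elementary d => φ.integral W) P := by
  refine hW.gaussian.of_isGaussianProcess fun φ => ⟨φ.support,
    ∑ i : φ.support, (φ i) • ContinuousLinearMap.proj i, fun ω => ?_⟩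
  rw [Elementary.integral, Finsupp.sum, ← Finset.sum_coe_sort]
  simp

theorem memLp_integral [IsProbabilityMeasure P] (hW : IsNoise P Γ W) (φ : Elementary d) :
    MemLp (φ.integral W) 2 P :=
  ((isGaussianProcess_integral hW).hasGaussianLaw_eval φ).memLp_two

theorem integral_integral_eq_zero (hW : IsNoise P Γ W) (φ : Elementary d) :
    ∫ ω, φ.integral W ω ∂P = 0 := by
  simp only [Elementary.integral, Finsupp.sum]
  rw [integral_finsetSum _ fun q _ =>
    ((hW.gaussian.hasGaussianLaw_eval q).integrable.const_mul _)]
  refine Finset.sum_eq_zero fun q _ => ?_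
  rw [integral_const_mul, hW.mean_zero, mul_zero]

/-- The elementary stochastic integrals as elements of `L²(P)`. -/
def integralLp [IsProbabilityMeasure P] (hW : IsNoise P Γ W) : Elementary d →ₗ[ℝ] Lp ℝ 2 P where
  toFun φ := (memLp_integral hW φ).toLp
  map_add' φ ψ := by
    rw [← MemLp.toLp_add]
    congr 1
    simp only [integral_eq_linearCombination, map_add]
  map_smul' c φ := by
    rw [RingHom.id_apply, ← MemLp.toLp_const_smul]
    congr 1
    simp only [integral_eq_linearCombination, map_smul]

/-- The Wiener isometry on elementary integrands. -/
theorem inner_elemLp [IsProbabilityMeasure P] (h : IsSpectralMeasure Γ μ)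
    (hW : IsNoise P Γ W) (φ ψ : Elementary d) :
    inner ℂ (elemLp h ψ) (elemLp h φ) =
      ((inner ℝ (integralLp hW ψ) (integralLp hW φ) : ℝ) : ℂ) := by
  have base : ∀ p q : ℝ≥0 × BddBorel d,
      inner ℂ (elemLp h (Finsupp.single q 1)) (elemLp h (Finsupp.single p 1)) =
        ((inner ℝ (integralLp hW (Finsupp.single q 1))
          (integralLp hW (Finsupp.single p 1)) : ℝ) : ℂ) := by
    intro p q
    have e1 : ∀ p, elemFourier (d := d) (Finsupp.single p 1) = basisFourier p := fun p => by
      simp [elemFourier]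
    have e2 : ∀ p : ℝ≥0 × BddBorel d,
        Elementary.integral W (Finsupp.single p 1) = W p.1 p.2 := fun p => by
      rw [integral_eq_linearCombination]; simp
    have h1 : inner ℂ (elemLp h (Finsupp.single q 1)) (elemLp h (Finsupp.single p 1)) =
        ∫ x, basisFourier p x * (starRingEnd ℂ) (basisFourier q x) ∂(spaceTime μ) := by
      rw [L2.inner_def]
      refine integral_congr_ae ?_
      filter_upwards [(memLp_elemFourier h (Finsupp.single p 1)).coeFn_toLp,
        (memLp_elemFourier h (Finsupp.single q 1)).coeFn_toLp] with x h1 h2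
      simp only [elemLp, LinearMap.coe_mk, AddHom.coe_mk]
      rw [h1, h2, e1, e1]
      simp
    have h2 : inner ℝ (integralLp hW (Finsupp.single q 1)) (integralLp hW (Finsupp.single p 1)) =
        ∫ ω, W p.1 p.2 ω * W q.1 q.2 ω ∂P := by
      rw [L2.inner_def]
      refine integral_congr_ae ?_
      filter_upwards [(memLp_integral hW (Finsupp.single p 1)).coeFn_toLp,
        (memLp_integral hW (Finsupp.single q 1)).coeFn_toLp] with x h1 h2
      simp only [integralLp, LinearMap.coe_mk, AddHom.coe_mk]
      rw [h1, h2, e2, e2]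
      simp
    rw [h1, h2, integral_basisFourier h, hW.covariance]
  -- Both sides are real-bilinear, so the case of single generators suffices.
  induction φ using Finsupp.induction_linear with
  | zero => simp
  | add φ₁ φ₂ h₁ h₂ => simp only [map_add, inner_add_right, h₁, h₂, Complex.ofReal_add]
  | single p a =>
    induction ψ using Finsupp.induction_linear with
    | zero => simp
    | add ψ₁ ψ₂ h₁ h₂ => simp only [map_add, inner_add_left, h₁, h₂, Complex.ofReal_add]
    | single q b =>
      have e : ∀ (r : ℝ≥0 × BddBorel d) (c : ℝ),
          (Finsupp.single r c : Elementary d) = c • Finsupp.single r 1 := fun r c => by simp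
      rw [e p a, e q b]
      simp only [map_smul]
      rw [inner_smul_left_eq_smul, inner_smul_right_eq_smul, inner_smul_left_eq_smul,
        inner_smul_right_eq_smul, base]
      simp

theorem norm_elemLp [IsProbabilityMeasure P] (h : IsSpectralMeasure Γ μ)
    (hW : IsNoise P Γ W) (φ : Elementary d) :
    ‖elemLp h φ‖ = ‖integralLp hW φ‖ := by
  have h1 := inner_elemLp h hW φ φ
  rw [inner_self_eq_norm_sq_to_K, real_inner_self_eq_norm_sq] at h1
  have h2 : ‖elemLp h φ‖ ^ 2 = ‖integralLp hW φ‖ ^ 2 := by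
    have h3 := congrArg Complex.re h1
    simpa [← Complex.ofReal_pow] using h3
  exact (sq_eq_sq₀ (norm_nonneg _) (norm_nonneg _)).1 h2

/-- `h` lies in the closure of the elementary functions. -/
def IsElementaryLimit (μ : Measure (Space d)) (h : ℝ × Space d → ℂ) : Prop :=
  MemLp h 2 (spaceTime μ) ∧
    ∃ φ : ℕ → Elementary d, Tendsto (fun n => eLpNorm (elemFourier (φ n) - h) 2 (spaceTime μ))
      atTop (𝓝 0)

/-- Existence of the Wiener integral. -/
theorem exists_isWienerIntegral [IsProbabilityMeasure P] (hΓμ : IsSpectralMeasure Γ μ)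
    (hW : IsNoise P Γ W)
    {h : ℝ → Space d → ℂ} (hh : IsElementaryLimit μ fun p => h p.1 p.2) :
    ∃ X, IsWienerIntegral P μ W h X := by
  obtain ⟨hL2, φ, hφ⟩ := hh
  have h1 : Tendsto (fun n => elemLp hΓμ (φ n)) atTop (𝓝 hL2.toLp) :=
    (Lp.tendsto_Lp_iff_tendsto_eLpNorm'' _ (fun n => memLp_elemFourier hΓμ (φ n)) _ hL2).2 hφ
  -- The isometry transports the Cauchy property from the integrands to their integrals.
  have h2 : CauchySeq fun n => integralLp hW (φ n) := by
    refine Metric.cauchySeq_iff.2 fun ε hε => ?_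
    obtain ⟨N, hN⟩ := Metric.cauchySeq_iff.1 h1.cauchySeq ε hε
    refine ⟨N, fun m hm n hn => ?_⟩
    have := hN m hm n hn
    rw [dist_eq_norm, ← map_sub] at this ⊢
    rwa [← norm_elemLp hΓμ hW]
  obtain ⟨X, hX⟩ := cauchySeq_tendsto_of_complete h2
  refine ⟨X, hL2, Lp.memLp X, φ, ?_, ?_⟩
  · refine hφ.congr fun n => eLpNorm_congr_ae (Eventually.of_forall fun p => ?_)
    simp only [Pi.sub_apply]
    rw [elemFourier_eq]
  · have h3 := (Lp.tendsto_Lp_iff_tendsto_eLpNorm'' _ (fun n => memLp_integral hW (φ n)) X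
      (Lp.memLp X)).1 (by rw [Lp.toLp_coeFn]; exact hX)
    exact h3

theorem IsWienerIntegral.exists_tendsto {h : ℝ → Space d → ℂ} {X : Ω → ℝ}
    (hX : IsWienerIntegral P μ W h X) : ∃ φ : ℕ → Elementary d,
      Tendsto (fun n => eLpNorm (elemFourier (φ n) - fun p => h p.1 p.2) 2 (spaceTime μ))
        atTop (𝓝 0) ∧
      Tendsto (fun n => eLpNorm ((φ n).integral W - X) 2 P) atTop (𝓝 0) := by
  obtain ⟨_, _, φ, h1, h2⟩ := hX
  refine ⟨φ, h1.congr fun n => eLpNorm_congr_ae (Eventually.of_forall fun p => ?_), h2⟩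
  simp only [Pi.sub_apply]
  rw [elemFourier_eq]

/-- Mixed second moments of Wiener integrals. -/
theorem integral_mul_of_isWienerIntegral [IsProbabilityMeasure P] (hΓμ : IsSpectralMeasure Γ μ)
    (hW : IsNoise P Γ W)
    {h k : ℝ → Space d → ℂ} {X Y : Ω → ℝ} (hX : IsWienerIntegral P μ W h X)
    (hY : IsWienerIntegral P μ W k Y) :
    ((∫ ω, X ω * Y ω ∂P : ℝ) : ℂ) =
      ∫ p, h p.1 p.2 * (starRingEnd ℂ) (k p.1 p.2) ∂(spaceTime μ) := by
  obtain ⟨φ, hφ1, hφ2⟩ := hX.exists_tendsto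
  obtain ⟨ψ, hψ1, hψ2⟩ := hY.exists_tendsto
  have h1 := tendsto_integral_mul_conj (fun n => memLp_elemFourier hΓμ (φ n)) hX.1
    (fun n => memLp_elemFourier hΓμ (ψ n)) hY.1 hφ1 hψ1
  have h2 := tendsto_integral_mul_conj (fun n => memLp_integral hW (φ n)) hX.2.1
    (fun n => memLp_integral hW (ψ n)) hY.2.1 hφ2 hψ2
  simp only [conj_trivial] at h2
  refine tendsto_nhds_unique ((Complex.continuous_ofReal.tendsto _).comp h2) (h1.congr fun n => ?_)
  have e1 : inner ℂ (elemLp hΓμ (ψ n)) (elemLp hΓμ (φ n)) =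
      ∫ x, elemFourier (φ n) x * (starRingEnd ℂ) (elemFourier (ψ n) x) ∂(spaceTime μ) := by
    rw [L2.inner_def]
    refine integral_congr_ae ?_
    filter_upwards [(memLp_elemFourier hΓμ (φ n)).coeFn_toLp,
      (memLp_elemFourier hΓμ (ψ n)).coeFn_toLp] with x h1 h2
    simp only [elemLp, LinearMap.coe_mk, AddHom.coe_mk]
    rw [h1, h2]
    simp
  have e2 : inner ℝ (integralLp hW (ψ n)) (integralLp hW (φ n)) =
      ∫ ω, (φ n).integral W ω * (ψ n).integral W ω ∂P := by
    rw [L2.inner_def]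
    refine integral_congr_ae ?_
    filter_upwards [(memLp_integral hW (φ n)).coeFn_toLp,
      (memLp_integral hW (ψ n)).coeFn_toLp] with x h1 h2
    simp only [integralLp, LinearMap.coe_mk, AddHom.coe_mk]
    rw [h1, h2]
    simp
  rw [Function.comp, ← e1, ← e2, inner_elemLp hΓμ hW]

theorem isGaussianProcess_of_isWienerIntegral [IsProbabilityMeasure P] (hW : IsNoise P Γ W) {T : Type*}
    {h : T → ℝ → Space d → ℂ} {U : T → Ω → ℝ} (hU : ∀ t, IsWienerIntegral P μ W (h t) (U t)) :
    IsGaussianProcess U P ∧ ∀ t, ∫ ω, U t ω ∂P = 0 := by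
  have hex := fun t => IsWienerIntegral.exists_tendsto (P := P) (hU t)
  choose φ _ hφ using hex
  constructor
  · exact isGaussianProcess_of_tendsto (Y := fun n t => (φ t n).integral W)
      (fun n => (isGaussianProcess_integral hW).comp_right fun t => φ t n)
      (fun t => (hU t).2.1) hφ
  · intro t
    have h1 := tendsto_integral_of_L2 (fun n => memLp_integral hW (φ t n)) (hU t).2.1 (hφ t)
    simp only [integral_integral_eq_zero hW] at h1
    exact tendsto_nhds_unique h1 tendsto_const_nhds

end

end FracKinetic
end

noncomputable section

namespace FracKinetic

section
variable {d : ℕ} {α β γ ν : ℝ}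

/-! ### Square integrability of the canonical integrand -/

theorem continuous_symb (hα : 0 < α) : Continuous (symb (d := d) α γ) := by
  refine (continuous_norm.rpow_const fun _ => Or.inr hα.le).mul
    (Continuous.rpow_const (by fun_prop) fun ξ => Or.inl ?_)
  positivity

theorem symb_nonneg (ξ : Space d) : 0 ≤ symb α γ ξ := by
  unfold symb
  positivity

theorem symb_neg (ξ : Space d) : symb α γ (-ξ) = symb α γ ξ := by
  rw [symb, symb, norm_neg]

/-- The Fourier transform of the fundamental solution at time `τ`. -/
def kern (α β γ ν τ : ℝ) (ξ : Space d) : ℝ := mittagLeffler β (-(ν * τ ^ β * symb α γ ξ))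

theorem kern_neg (τ : ℝ) (ξ : Space d) : kern α β γ ν τ (-ξ) = kern α β γ ν τ ξ := by
  rw [kern, kern, symb_neg]

theorem continuous_kern (hα : 0 < α) (hβ0 : 0 < β) (hβ1 : β < 1) :
    Continuous fun q : ℝ × Space d => kern α β γ ν q.1 q.2 := by
  refine (continuous_mittagLeffler hβ0 hβ1).comp (((continuous_const.mul
    (continuous_fst.rpow_const fun _ => Or.inr hβ0.le)).mul
    ((continuous_symb hα).comp continuous_snd)).neg)

theorem kern_pos (hβ0 : 0 < β) (hβ1 : β < 1) (hν : 0 < ν) {τ : ℝ} (hτ : 0 ≤ τ) (ξ : Space d) :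
    0 < kern α β γ ν τ ξ :=
  mittagLeffler_neg_pos hβ0 hβ1 (mul_nonneg (by positivity) (symb_nonneg ξ))

theorem kern_antitone (hβ0 : 0 < β) (hβ1 : β < 1) (hν : 0 < ν) {τ τ' : ℝ} (hτ : 0 ≤ τ)
    (h : τ ≤ τ') (ξ : Space d) : kern α β γ ν τ' ξ ≤ kern α β γ ν τ ξ := by
  have := symb_nonneg (α := α) (γ := γ) ξ
  refine mittagLeffler_neg_antitone hβ0 hβ1 (by positivity) ?_
  gcongr

theorem kern_le_one (hβ0 : 0 < β) (hβ1 : β < 1) (hν : 0 < ν) {τ : ℝ} (hτ : 0 ≤ τ)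
    (ξ : Space d) : kern α β γ ν τ ξ ≤ 1 :=
  mittagLeffler_neg_le_one hβ0 hβ1 (mul_nonneg (by positivity) (symb_nonneg ξ))

/-- The decay `E_β(-y) ≤ max 1 Γ(β+1) / (1+y)`, squared; the exponent `2` may then be lowered to any
`p ≤ 2` because `1 + y ≥ 1`. -/
theorem mittagLeffler_neg_sq_le (hβ0 : 0 < β) (hβ1 : β < 1) :
    ∃ C : ℝ, 0 ≤ C ∧ ∀ p y : ℝ, p ≤ 2 → 0 ≤ y →
      mittagLeffler β (-y) ^ 2 ≤ C * (1 + y) ^ (-p) := by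
  set g := Real.Gamma (β + 1)
  have hg : 0 < g := Real.Gamma_pos_of_pos (by linarith)
  refine ⟨(max 1 g) ^ 2, by positivity, fun p y hp hy => ?_⟩
  have h1 := mittagLeffler_neg_mul_le hβ0 hβ1 hy
  have hm := mittagLeffler_neg_pos hβ0 hβ1 hy
  have h2 : 1 + y ≤ max 1 g * (1 + y / g) := by
    have e : y = g * (y / g) := by field_simp
    have : 0 ≤ y / g := by positivity
    nlinarith [le_max_left 1 g, le_max_right 1 g]
  have h3 : mittagLeffler β (-y) * (1 + y) ≤ max 1 g := by
    calc _ ≤ mittagLeffler β (-y) * (max 1 g * (1 + y / g)) := by gcongr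
      _ = max 1 g * (mittagLeffler β (-y) * (1 + y / g)) := by ring
      _ ≤ max 1 g * 1 := by gcongr
      _ = _ := mul_one _
  have h4 : mittagLeffler β (-y) ≤ max 1 g * (1 + y)⁻¹ := by
    rw [← div_eq_mul_inv, le_div_iff₀ (by linarith)]
    exact h3
  calc _ ≤ (max 1 g * (1 + y)⁻¹) ^ 2 := by gcongr
    _ = (max 1 g) ^ 2 * (1 + y) ^ (-(2 : ℝ)) := by
      rw [mul_pow, Real.rpow_neg (by linarith), inv_pow]
      norm_cast
    _ ≤ _ := by
      gcongr
      linarith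

/-- For `|ξ| ≥ 1` one has `|ξ|² ≥ (1+|ξ|²)/2`, so the symbol itself dominates. For `|ξ| ≤ 1` the
summand `1` dominates, as `τ ≤ t` and `1+|ξ|² ≤ 2`. The two entries of the minimum are the constants
of these cases. -/
theorem lower_bound_symb (hα : 0 < α) (hβ0 : 0 < β) (hγ : 0 ≤ γ) (hν : 0 < ν) {t : ℝ}
    (ht : 0 < t) : ∃ c : ℝ, 0 < c ∧ ∀ τ, 0 < τ → τ ≤ t → ∀ ξ : Space d,
      c * τ ^ β * (1 + ‖ξ‖ ^ 2) ^ ((α + γ) / 2) ≤ 1 + ν * τ ^ β * symb α γ ξ := by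
  refine ⟨min (ν * (1 / 2) ^ (α / 2)) (t ^ β * 2 ^ ((α + γ) / 2))⁻¹, by positivity,
    fun τ hτ0 hτ ξ => ?_⟩
  have hL : 0 < 1 + ‖ξ‖ ^ 2 := by positivity
  have hs := symb_nonneg (α := α) (γ := γ) ξ
  rcases le_total 1 ‖ξ‖ with h | h
  · have h1 : (1 / 2 : ℝ) ^ (α / 2) * (1 + ‖ξ‖ ^ 2) ^ (α / 2) ≤ ‖ξ‖ ^ α := by
      rw [← Real.mul_rpow (by norm_num) hL.le]
      have e : ‖ξ‖ ^ α = (‖ξ‖ ^ 2) ^ (α / 2) := by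
        rw [← Real.rpow_natCast, ← Real.rpow_mul (norm_nonneg _)]
        congr 1
        push_cast
        ring
      rw [e]
      refine Real.rpow_le_rpow (by positivity) ?_ (by positivity)
      nlinarith
    calc _ ≤ (ν * (1 / 2) ^ (α / 2)) * τ ^ β * (1 + ‖ξ‖ ^ 2) ^ ((α + γ) / 2) := by
          gcongr
          exact min_le_left _ _
      _ = ν * τ ^ β * ((1 / 2) ^ (α / 2) * (1 + ‖ξ‖ ^ 2) ^ (α / 2) * (1 + ‖ξ‖ ^ 2) ^ (γ / 2)) := by
          rw [add_div, Real.rpow_add hL]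
          ring
      _ ≤ ν * τ ^ β * symb α γ ξ := by
          unfold symb
          gcongr
      _ ≤ _ := by linarith
  · calc _ ≤ (t ^ β * 2 ^ ((α + γ) / 2))⁻¹ * t ^ β * 2 ^ ((α + γ) / 2) := by
          gcongr
          · exact min_le_right _ _
          · nlinarith [norm_nonneg ξ]
      _ = 1 := by field_simp
      _ ≤ _ := by
        have : 0 ≤ ν * τ ^ β * symb α γ ξ := by positivity
        linarith

/-- The exponent `p = 2η/(α+γ)` is the one that turns the growth of the symbol into `(1+|ξ|²)^{-η}`;
the price in time is `τ^{-βp}`. The bound on `η` ensures both `p ≤ 2`, the best decay available for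
the square, and `q = βp < 1`, which makes the time singularity integrable. -/
theorem kern_sq_le (hα : 0 < α) (hβ0 : 0 < β) (hβ1 : β < 1) (hγ : 0 ≤ γ) (hν : 0 < ν)
    {η : ℝ} (hη0 : 0 < η) (hη : η < exponentBound α β γ) {t : ℝ} (ht : 0 < t) :
    ∃ q K : ℝ, q < 1 ∧ ∀ τ, 0 < τ → τ ≤ t → ∀ ξ : Space d,
      kern α β γ ν τ ξ ^ 2 ≤ K * τ ^ (-q) * (1 / (1 + ‖ξ‖ ^ 2)) ^ η := by
  have hs : 0 < α + γ := by linarith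
  set p := 2 * η / (α + γ) with hp
  have hp0 : 0 < p := by positivity
  have hp2 : p ≤ 2 ∧ β * p < 1 := by
    have e : p * (α + γ) = 2 * η := by rw [hp]; field_simp
    unfold exponentBound at hη
    split_ifs at hη with h1 h2
    · have : p ≤ 2 := by
        by_contra! h
        nlinarith
      exact ⟨this, by nlinarith⟩
    · have : p < 1 := by
        by_contra! h
        nlinarith
      exact ⟨by linarith, by nlinarith⟩
    · have h3 : β * p < 1 := by
        rw [lt_div_iff₀ (by positivity)] at hη
        by_contra! h
        nlinarith
      have h4 : 1 / 2 < β := lt_of_le_of_ne (not_lt.1 h1) (Ne.symm h2)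
      refine ⟨?_, h3⟩
      by_contra! h
      nlinarith
  obtain ⟨C, hC, hm⟩ := mittagLeffler_neg_sq_le hβ0 hβ1
  obtain ⟨c, hc, hl⟩ := lower_bound_symb (d := d) hα hβ0 hγ hν ht
  refine ⟨β * p, C * c ^ (-p), hp2.2, fun τ hτ0 hτ ξ => ?_⟩
  have hL : 0 < 1 + ‖ξ‖ ^ 2 := by positivity
  calc _ ≤ C * (1 + ν * τ ^ β * symb α γ ξ) ^ (-p) :=
        hm p _ hp2.1 (mul_nonneg (by positivity) (symb_nonneg ξ))
    _ ≤ C * (c * τ ^ β * (1 + ‖ξ‖ ^ 2) ^ ((α + γ) / 2)) ^ (-p) := by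
        refine mul_le_mul_of_nonneg_left ?_ hC
        exact Real.rpow_le_rpow_of_nonpos (by positivity) (hl τ hτ0 hτ ξ) (by linarith)
    _ = _ := by
        rw [Real.mul_rpow (by positivity) (by positivity),
          Real.mul_rpow (by positivity) (by positivity), ← Real.rpow_mul hτ0.le,
          ← Real.rpow_mul hL.le, one_div, Real.inv_rpow hL.le, ← Real.rpow_neg hL.le]
        have e1 : β * -p = -(β * p) := by ring
        have e2 : (α + γ) / 2 * -p = -η := by rw [hp]; field_simp
        rw [e1, e2]
        ring

/-- The spatial Fourier transform of `y ↦ 1_{[0,t]}(s) G_{t-s}(x - y)`. -/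
def canon (α β γ ν t : ℝ) (x : Space d) (s : ℝ) (ξ : Space d) : ℂ :=
  (Set.Icc 0 t).indicator
    (fun s => Complex.exp (-(Complex.I * ((inner ℝ x ξ : ℝ) : ℂ))) * (kern α β γ ν (t - s) ξ : ℂ)) s

theorem norm_canon_of_mem (hβ0 : 0 < β) (hβ1 : β < 1) (hν : 0 < ν) {t s : ℝ}
    (hs : s ∈ Set.Icc 0 t) (x ξ : Space d) :
    ‖canon α β γ ν t x s ξ‖ = kern α β γ ν (t - s) ξ := by
  rw [canon, Set.indicator_of_mem hs, norm_mul, norm_cexp_neg_I_mul, one_mul, Complex.norm_real,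
    Real.norm_of_nonneg (kern_pos hβ0 hβ1 hν (sub_nonneg.2 hs.2) ξ).le]

theorem measurable_canon (hα : 0 < α) (hβ0 : 0 < β) (hβ1 : β < 1) (t : ℝ) (x : Space d) :
    Measurable fun q : ℝ × Space d => canon α β γ ν t x q.1 q.2 := by
  have h1 : (fun q : ℝ × Space d => canon α β γ ν t x q.1 q.2) =
      (Prod.fst ⁻¹' Set.Icc 0 t).indicator (fun q : ℝ × Space d =>
        Complex.exp (-(Complex.I * ((inner ℝ x q.2 : ℝ) : ℂ))) *
          (kern α β γ ν (t - q.1) q.2 : ℂ)) := by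
    ext q
    by_cases h : q.1 ∈ Set.Icc 0 t
    · rw [canon, Set.indicator_of_mem h, Set.indicator_of_mem (by exact h)]
    · rw [canon, Set.indicator_of_notMem h, Set.indicator_of_notMem (by exact h)]
  rw [h1]
  have h2 : Continuous fun q : ℝ × Space d => kern α β γ ν (t - q.1) q.2 :=
    (continuous_kern hα hβ0 hβ1).comp (by fun_prop : Continuous fun q : ℝ × Space d =>
      ((t - q.1, q.2) : ℝ × Space d))
  refine Measurable.indicator (Continuous.measurable ?_) (measurable_fst measurableSet_Icc)
  fun_prop

variable {Γ μ : Measure (Space d)}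

theorem memLp_kern (hα : 0 < α) (hβ0 : 0 < β) (hβ1 : β < 1) (hγ : 0 ≤ γ) (hν : 0 < ν)
    (hμ : SpectralIntegrability α β γ μ) {τ : ℝ} (hτ : 0 < τ) :
    MemLp (fun ξ => (kern α β γ ν τ ξ : ℂ)) 2 μ := by
  obtain ⟨η, hη0, hη, hint⟩ := hμ
  obtain ⟨q, K, _, hK⟩ := kern_sq_le (d := d) hα hβ0 hβ1 hγ hν hη0 hη hτ
  have hc : Continuous fun ξ : Space d => (kern α β γ ν τ ξ : ℂ) :=
    Complex.continuous_ofReal.comp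
      ((continuous_kern hα hβ0 hβ1).comp (by fun_prop : Continuous fun ξ : Space d => (τ, ξ)))
  rw [memLp_two_iff_integrable_sq_norm hc.aestronglyMeasurable]
  refine (hint.const_mul (K * τ ^ (-q))).mono'
    (hc.norm.pow 2).aestronglyMeasurable (Eventually.of_forall fun ξ => ?_)
  rw [Complex.norm_real, norm_pow, norm_norm, Real.norm_eq_abs, sq_abs]
  exact hK τ hτ le_rfl ξ

theorem memLp_canon (hα : 0 < α) (hβ0 : 0 < β) (hβ1 : β < 1) (hγ : 0 ≤ γ) (hν : 0 < ν)
    (h : IsSpectralMeasure Γ μ) (hμ : SpectralIntegrability α β γ μ) {t : ℝ} (ht : 0 < t)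
    (x : Space d) :
    MemLp (fun q : ℝ × Space d => canon α β γ ν t x q.1 q.2) 2 (spaceTime μ) := by
  have := h.temperate_spectral
  have := sigmaFinite_of_hasTemperateGrowth μ
  obtain ⟨η, hη0, hη, hint⟩ := hμ
  obtain ⟨q, K, hq, hK⟩ := kern_sq_le (d := d) hα hβ0 hβ1 hγ hν hη0 hη ht
  have hm := measurable_canon (γ := γ) (ν := ν) hα hβ0 hβ1 t x
  rw [memLp_two_iff_integrable_sq_norm hm.aestronglyMeasurable]
  have h1 : IntervalIntegrable (fun s => K * (t - s) ^ (-q)) volume 0 t :=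
    IntervalIntegrable.const_mul (by
      simpa using intervalIntegrable_sub_rpow (a := 1 - q) (t := t) (by linarith)) K
  have h2 : Integrable ((Set.Ioc 0 t).indicator fun s => K * (t - s) ^ (-q))
      (volume.restrict (Set.Ici 0)) :=
    ((intervalIntegrable_iff_integrableOn_Ioc_of_le ht.le).1 h1).integrable_indicator
      measurableSet_Ioc |>.restrict
  refine (h2.mul_prod hint).mono' (hm.norm.pow_const 2).aestronglyMeasurable ?_
  -- At `s = t` the kernel bound is unavailable, since it needs `τ > 0`; at `s = 0` the majorant,
  -- supported in `(0, t]`, vanishes.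
  have h3 : ∀ᵐ s ∂(volume.restrict (Set.Ici (0 : ℝ))), s ≠ t ∧ s ≠ 0 :=
    (ae_restrict_of_ae (Measure.ae_ne volume t)).and (ae_restrict_of_ae (Measure.ae_ne volume 0))
  filter_upwards [Measure.quasiMeasurePreserving_fst.ae h3] with p hp
  rw [norm_pow, norm_norm]
  by_cases hs : p.1 ∈ Set.Icc 0 t
  · have h4 : p.1 ∈ Set.Ioc 0 t := ⟨lt_of_le_of_ne hs.1 (Ne.symm hp.2), hs.2⟩
    rw [norm_canon_of_mem hβ0 hβ1 hν hs, Set.indicator_of_mem h4]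
    exact hK _ (sub_pos.2 (lt_of_le_of_ne hs.2 hp.1)) (by linarith [hs.1]) _
  · rw [canon, Set.indicator_of_notMem hs, Set.indicator_of_notMem
      (fun h => hs (Set.Ioc_subset_Icc_self h))]
    simp

end

end FracKinetic
end

/-! ### Density of the elementary functions -/

noncomputable section

namespace FracKinetic

section
variable {d : ℕ}

/-! ### The inverse Fourier transform on Schwartz functions -/

/-- The inverse of `schwartzFourier`. -/
def schwartzFourierInv (φ : 𝓢(Space d, ℂ)) : 𝓢(Space d, ℂ) :=
  𝓕⁻ (SchwartzMap.compCLMOfContinuousLinearEquiv ℂ (dilation d).symm φ)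

theorem schwartzFourier_schwartzFourierInv (φ : 𝓢(Space d, ℂ)) :
    schwartzFourier (schwartzFourierInv φ) = φ := by
  rw [schwartzFourier, schwartzFourierInv, FourierTransform.fourier_fourierInv_eq]
  ext x
  simp

theorem schwartzFourierInv_schwartzFourier (φ : 𝓢(Space d, ℂ)) :
    schwartzFourierInv (schwartzFourier φ) = φ := by
  have h : SchwartzMap.compCLMOfContinuousLinearEquiv ℂ (dilation d).symm (schwartzFourier φ) =
      𝓕 φ := by
    ext x
    simp [schwartzFourier]
  rw [schwartzFourierInv, h, FourierTransform.fourierInv_fourier_eq]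

/-- The complex conjugate of a Schwartz function. -/
def conjSchwartz (g : 𝓢(Space d, ℂ)) : 𝓢(Space d, ℂ) :=
  g.postcompCLM (𝕜 := ℝ) (Complex.conjCLE : ℂ →L[ℝ] ℂ)

theorem conjSchwartz_apply (g : 𝓢(Space d, ℂ)) (x : Space d) :
    conjSchwartz g x = (starRingEnd ℂ) (g x) := by
  simp [conjSchwartz]

theorem fourierT_conj (g : Space d → ℂ) (ξ : Space d) :
    fourierT (fun x => (starRingEnd ℂ) (g x)) ξ = (starRingEnd ℂ) (fourierT g (-ξ)) := by
  rw [fourierT, fourierT, ← integral_conj]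
  refine integral_congr_ae (Eventually.of_forall fun x => ?_)
  simp only [map_mul, inner_neg_left, ← Complex.exp_conj, map_neg, Complex.conj_I,
    Complex.conj_ofReal]
  push_cast
  ring_nf

/-- Hermitian symmetry on the Fourier side is reality on the space side. Elementary functions have
real coefficients, so only Hermitian transforms can be targeted. -/
theorem conj_schwartzFourierInv {η : 𝓢(Space d, ℂ)}
    (hη : ∀ ξ, η (-ξ) = (starRingEnd ℂ) (η ξ)) (x : Space d) :
    (starRingEnd ℂ) (schwartzFourierInv η x) = schwartzFourierInv η x := by
  have h : conjSchwartz (schwartzFourierInv η) = schwartzFourierInv η := by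
    rw [← schwartzFourierInv_schwartzFourier (conjSchwartz (schwartzFourierInv η))]
    congr 1
    ext ξ
    have h1 := fourierT_conj (schwartzFourierInv η) ξ
    rw [schwartzFourier_apply]
    have h2 : (conjSchwartz (schwartzFourierInv η) : Space d → ℂ) =
        fun x => (starRingEnd ℂ) (schwartzFourierInv η x) := funext (conjSchwartz_apply _)
    rw [h2, h1, ← schwartzFourier_apply, schwartzFourier_schwartzFourierInv, hη, Complex.conj_conj]
  rw [← conjSchwartz_apply, h]

/-! ### Approximation by elementary integrands -/

variable {Γ μ : Measure (Space d)}

/-- `f` belongs to the closure of the elementary functions. -/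
def Approx (h : IsSpectralMeasure Γ μ) (f : ℝ × Space d → ℂ) : Prop :=
  ∃ hf : MemLp f 2 (spaceTime μ), hf.toLp ∈ (LinearMap.range (elemLp h)).topologicalClosure

theorem Approx.isElementaryLimit {h : IsSpectralMeasure Γ μ} {f : ℝ × Space d → ℂ}
    (hf : Approx h f) : IsElementaryLimit μ f := by
  obtain ⟨hf, hcl⟩ := hf
  obtain ⟨x, hx, hxt⟩ := mem_closure_iff_seq_limit.1
    ((Submodule.topologicalClosure_coe _).subset hcl)
  choose φ hφ using hx
  refine ⟨hf, φ, (Lp.tendsto_Lp_iff_tendsto_eLpNorm'' _ (fun n => memLp_elemFourier h (φ n)) _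
    hf).1 (hxt.congr fun n => (hφ n).symm)⟩

theorem approx_elemFourier (h : IsSpectralMeasure Γ μ) (φ : Elementary d) :
    Approx h (elemFourier φ) :=
  ⟨memLp_elemFourier h φ, Submodule.le_topologicalClosure _ ⟨φ, rfl⟩⟩

theorem Approx.congr {h : IsSpectralMeasure Γ μ} {f g : ℝ × Space d → ℂ} (hf : Approx h f)
    (hfg : f =ᵐ[spaceTime μ] g) : Approx h g := by
  obtain ⟨hf, hcl⟩ := hf
  refine ⟨hf.ae_eq hfg, ?_⟩
  rwa [← MemLp.toLp_congr hf _ hfg]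

theorem Approx.sub {h : IsSpectralMeasure Γ μ} {f g : ℝ × Space d → ℂ} (hf : Approx h f)
    (hg : Approx h g) : Approx h (f - g) := by
  obtain ⟨hf, hf'⟩ := hf
  obtain ⟨hg, hg'⟩ := hg
  refine ⟨hf.sub hg, ?_⟩
  rw [MemLp.toLp_sub hf hg]
  exact sub_mem hf' hg'

theorem approx_zero (h : IsSpectralMeasure Γ μ) : Approx h 0 := by
  have h1 := approx_elemFourier h 0
  rwa [elemFourier, map_zero] at h1

theorem Approx.sum {h : IsSpectralMeasure Γ μ} {f : ℕ → ℝ × Space d → ℂ} (n : ℕ)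
    (hf : ∀ k < n, Approx h (f k)) : Approx h (fun p => ∑ k ∈ Finset.range n, f k p) := by
  induction n with
  | zero =>
    simp only [Finset.range_zero, Finset.sum_empty]
    exact approx_zero h
  | succ n ih =>
    -- The sum `a + b` is obtained as `a - (0 - b)`.
    refine ((ih fun k hk => hf k (hk.trans n.lt_succ_self)).sub
      ((approx_zero h).sub (hf n n.lt_succ_self))).congr (Eventually.of_forall fun p => ?_)
    simp [Finset.sum_range_succ]

theorem Approx.of_tendsto {h : IsSpectralMeasure Γ μ} {f : ℕ → ℝ × Space d → ℂ}
    {g : ℝ × Space d → ℂ} (hf : ∀ n, Approx h (f n)) (hg : MemLp g 2 (spaceTime μ))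
    (hfg : Tendsto (fun n => eLpNorm (f n - g) 2 (spaceTime μ)) atTop (𝓝 0)) : Approx h g := by
  refine ⟨hg, ?_⟩
  have h1 := (Lp.tendsto_Lp_iff_tendsto_eLpNorm'' _ (fun n => (hf n).1) _ hg).2 hfg
  exact (Submodule.isClosed_topologicalClosure _).mem_of_tendsto h1
    (Eventually.of_forall fun n => (hf n).2)

theorem eLpNorm_mul_prod [SFinite μ] {m : Measure ℝ} {a : ℝ → ℂ} {b : Space d → ℂ}
    (ha : AEStronglyMeasurable a m) (hb : AEStronglyMeasurable b μ) :
    eLpNorm (fun p : ℝ × Space d => a p.1 * b p.2) 2 (m.prod μ) =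
      eLpNorm a 2 m * eLpNorm b 2 μ := by
  simp only [eLpNorm_eq_lintegral_rpow_enorm_toReal (p := 2) (by norm_num) (by norm_num)]
  rw [← ENNReal.mul_rpow_of_nonneg _ _ (by norm_num),
    ← lintegral_prod_mul (ha.enorm.pow_const _) (hb.enorm.pow_const _)]
  simp only [enorm_mul, ENNReal.mul_rpow_of_nonneg _ _ ENNReal.toReal_nonneg]

theorem Approx.of_tendsto_snd {h : IsSpectralMeasure Γ μ} {a : ℝ → ℂ}
    {f : ℕ → Space d → ℂ} {g : Space d → ℂ} (ha : MemLp a 2 (volume.restrict (Set.Ici 0)))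
    (hfm : ∀ n, AEStronglyMeasurable (f n) μ)
    (hf : ∀ n, Approx h fun p => a p.1 * f n p.2) (hg : MemLp g 2 μ)
    (hfg : Tendsto (fun n => eLpNorm (f n - g) 2 μ) atTop (𝓝 0)) :
    Approx h fun p => a p.1 * g p.2 := by
  have := h.temperate_spectral
  have := sigmaFinite_of_hasTemperateGrowth μ
  refine Approx.of_tendsto hf (memLp_mul_prod ha hg) ?_
  have h1 := ENNReal.Tendsto.const_mul (a := eLpNorm a 2 (volume.restrict (Set.Ici 0))) hfg
    (Or.inr ha.2.ne)
  rw [mul_zero] at h1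
  refine h1.congr fun n => ?_
  rw [← eLpNorm_mul_prod ha.1 ((hfm n).sub hg.1)]
  refine eLpNorm_congr_ae (Eventually.of_forall fun p => ?_)
  simp only [Pi.sub_apply]
  ring

/-- A simple function restricted to a ball. -/
def truncSimple (g : SimpleFunc (Space d) ℝ) (n : ℕ) (x : Space d) : ℂ :=
  (Metric.closedBall (0 : Space d) n).indicator (fun x => (g x : ℂ)) x

/-- The level sets of a simple function in a ball. -/
def levelSet (g : SimpleFunc (Space d) ℝ) (n : ℕ) (y : ℝ) : BddBorel d :=
  ⟨g ⁻¹' {y} ∩ Metric.closedBall 0 n, (g.measurableSet_fiber y).inter measurableSet_closedBall,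
    Metric.isBounded_closedBall.subset Set.inter_subset_right⟩

theorem truncSimple_eq (g : SimpleFunc (Space d) ℝ) (n : ℕ) (x : Space d) :
    truncSimple g n x = ∑ y ∈ g.range, (y : ℂ) * indFun (levelSet g n y) x := by
  rw [Finset.sum_eq_single (g x)]
  · by_cases hx : x ∈ Metric.closedBall (0 : Space d) n
    · rw [truncSimple, indFun, Set.indicator_of_mem hx,
        Set.indicator_of_mem (s := (levelSet g n (g x)).1) ⟨rfl, hx⟩, mul_one]
    · rw [truncSimple, indFun, Set.indicator_of_notMem hx,
        Set.indicator_of_notMem (fun h => hx h.2), mul_zero]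
  · intro y _ hy
    rw [indFun, Set.indicator_of_notMem (fun h => hy h.1.symm), mul_zero]
  · intro h
    exact absurd (g.mem_range_self x) h

theorem approx_truncSimple (h : IsSpectralMeasure Γ μ) (t : ℝ≥0) (g : SimpleFunc (Space d) ℝ)
    (n : ℕ) : Approx h fun p => (Set.Icc (0 : ℝ) t).indicator (fun _ => (1 : ℂ)) p.1 *
      fourierT (truncSimple g n) p.2 := by
  refine (approx_elemFourier h
    (∑ y ∈ g.range, Finsupp.single (t, levelSet g n y) y)).congr (Eventually.of_forall fun p => ?_)
  have hi : ∀ y, Integrable (indFun (levelSet g n y)) := fun y =>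
    ((bddSupp_indFun (levelSet g n y)).rapid 0).integrable
  have h1 : fourierT (truncSimple g n) p.2 =
      ∑ y ∈ g.range, (y : ℂ) * fourierT (indFun (levelSet g n y)) p.2 := by
    rw [fourierT]
    simp only [truncSimple_eq, Finset.mul_sum]
    rw [integral_finsetSum _ fun y _ => integrable_fourier_integrand ((hi y).const_mul _) _]
    refine Finset.sum_congr rfl fun y _ => ?_
    rw [fourierT, ← integral_const_mul]
    refine integral_congr_ae (Eventually.of_forall fun x => ?_)
    simp only
    ring
  simp only
  rw [elemFourier, map_sum, Finset.sum_apply, h1, Finset.mul_sum]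
  refine Finset.sum_congr rfl fun y _ => ?_
  rw [Finsupp.linearCombination_single, Pi.smul_apply, basisFourier, Complex.real_smul]
  ring

/-- A real Schwartz function is a pointwise limit of real simple functions cut to balls and bounded
by `2|φ|`. The isometry turns this dominated convergence into `L²(μ)` convergence of the transforms.
-/
theorem approx_schwartz (h : IsSpectralMeasure Γ μ) (t : ℝ≥0) (φ : 𝓢(Space d, ℂ))
    (hφ : ∀ x, (starRingEnd ℂ) (φ x) = φ x) :
    Approx h fun p => (Set.Icc (0 : ℝ) t).indicator (fun _ => (1 : ℂ)) p.1 * fourierT φ p.2 := by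
  have hr : ∀ x, ((φ x).re : ℂ) = φ x := fun x => Complex.conj_eq_iff_re.1 (hφ x)
  have hm : Measurable fun x => (φ x).re := (Complex.continuous_re.comp φ.continuous).measurable
  set g : ℕ → SimpleFunc (Space d) ℝ := fun n =>
    SimpleFunc.approxOn (fun x => (φ x).re) hm Set.univ 0 (Set.mem_univ _) n with hg
  have hgm : ∀ n, Measurable (truncSimple (g n) n) := fun n =>
    (Complex.measurable_ofReal.comp (g n).measurable).indicator measurableSet_closedBall
  obtain ⟨_, C, hC⟩ := schwartz_rapid Γ φ
  have hb : ∀ n x, ‖truncSimple (g n) n x‖ ≤ (2 * C) * weight (rapidExp Γ) x := by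
    intro n x
    refine (norm_indicator_le_norm_self _ _).trans ?_
    have h1 := SimpleFunc.norm_approxOn_zero_le hm (Set.mem_univ _) x n
    have h2 : ‖(φ x).re‖ ≤ ‖φ x‖ := Complex.abs_re_le_norm _
    rw [Complex.norm_real]
    have := hC x
    calc _ ≤ _ := h1
      _ ≤ _ := by linarith
  have ht : ∀ x, Tendsto (fun n => truncSimple (g n) n x) atTop (𝓝 (φ x)) := by
    intro x
    rw [← hr x]
    refine ((Complex.continuous_ofReal.tendsto _).comp (SimpleFunc.tendsto_approxOn hm
      (Set.mem_univ 0) (by simp : (φ x).re ∈ closure Set.univ))).congr' ?_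
    filter_upwards [eventually_ge_atTop ⌈‖x‖⌉₊] with n hn
    rw [truncSimple, Set.indicator_of_mem (mem_closedBall_zero_iff.2 (Nat.ceil_le.1 hn))]
    rfl
  have hbs : ∀ n, BddSupp (truncSimple (g n) n) := by
    intro n
    refine ⟨hgm n, 2 * C, n, fun x => (hb n x).trans ?_, fun x hx =>
      Set.indicator_of_notMem (fun hx' => not_le.2 hx (mem_closedBall_zero_iff.1 hx')) _⟩
    have hC0 : 0 ≤ C := by
      have := (norm_nonneg _).trans (hC 0)
      have h1 := weight_pos (d := d) (rapidExp Γ) 0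
      exact nonneg_of_mul_nonneg_left this h1
    refine mul_le_of_le_one_right (by positivity) ?_
    exact Real.rpow_le_one_of_one_le_of_nonpos (by linarith [norm_nonneg x]) (by simp)
  refine Approx.of_tendsto_snd (memLp_indicator_Icc _) (fun n => ?_)
    (fun n => approx_truncSimple h t (g n) n) ?_
    (tendsto_eLpNorm_fourierT_rapid h hgm (schwartz_rapid Γ φ) hb (Eventually.of_forall ht))
  · exact (continuous_fourierT ((hbs n).rapid Γ).integrable).aestronglyMeasurable
  · exact (isoPair_schwartz h φ φ).1

theorem exists_schwartz_near (m : Measure (Space d)) [m.HasTemperateGrowth] {ψ : Space d → ℂ}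
    (hψ : MemLp ψ 2 m) {ε : ℝ≥0∞} (hε : ε ≠ 0) :
    ∃ ρ : 𝓢(Space d, ℂ), eLpNorm ((ρ : Space d → ℂ) - ψ) 2 m ≤ ε := by
  have hfc := isFiniteMeasureOnCompacts_of_hasTemperateGrowth m
  by_cases htop : ε = ⊤
  · exact ⟨0, htop ▸ le_top⟩
  have hd := SchwartzMap.denseRange_toLpCLM (E := Space d) (F := ℂ) (p := 2) (μ := m)
    (by norm_num)
  obtain ⟨_, ⟨ρ, rfl⟩, hρ⟩ := Metric.mem_closure_iff.1 (hd hψ.toLp) ε.toReal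
    (ENNReal.toReal_pos hε htop)
  refine ⟨ρ, ?_⟩
  rw [dist_comm, dist_eq_norm, Lp.norm_def] at hρ
  have h2 : eLpNorm ((ρ : Space d → ℂ) - ψ) 2 m =
      eLpNorm (SchwartzMap.toLpCLM ℝ ℂ 2 m ρ - hψ.toLp : Lp ℂ 2 m) 2 m := by
    refine eLpNorm_congr_ae ?_
    filter_upwards [ρ.coeFn_toLp 2 m, hψ.coeFn_toLp,
      Lp.coeFn_sub (SchwartzMap.toLpCLM ℝ ℂ 2 m ρ) hψ.toLp] with x h3 h4 h5
    rw [h5, Pi.sub_apply, Pi.sub_apply, h4, SchwartzMap.toLpCLM_apply, h3]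
  rw [h2]
  exact (ENNReal.toReal_le_toReal (Lp.eLpNorm_ne_top _) htop).1 hρ.le

/-- Real Schwartz functions have dense Fourier transforms among Hermitian functions. -/
theorem exists_schwartz_fourier_near (h : IsSpectralMeasure Γ μ) {ψ : Space d → ℂ}
    (hψ : MemLp ψ 2 μ) (hh : ∀ ξ, ψ (-ξ) = (starRingEnd ℂ) (ψ ξ)) {ε : ℝ≥0∞} (hε : ε ≠ 0) :
    ∃ φ : 𝓢(Space d, ℂ), (∀ x, (starRingEnd ℂ) (φ x) = φ x) ∧
      eLpNorm (fourierT φ - ψ) 2 μ ≤ ε := by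
  have h1 := h.temperate_spectral
  -- The measure is symmetrised so that closeness in `L²(m)` controls the error at both `ξ` and
  -- `-ξ`; symmetry of `μ` is not assumed.
  set m : Measure (Space d) := μ + μ.map Neg.neg with hm
  have hmap : ∀ {E : Type} [NormedAddCommGroup E] {f : Space d → E}, Continuous f →
      Integrable (fun x => f (-x)) μ → Integrable f (μ.map Neg.neg) := by
    intro E _ f hf hi
    exact (integrable_map_measure hf.aestronglyMeasurable measurable_neg.aemeasurable).2 hi
  have htg : m.HasTemperateGrowth := by
    obtain ⟨n, hn⟩ := h1.exists_integrable
    refine ⟨n, integrable_add_measure.2 ⟨hn, hmap ?_ (by simpa using hn)⟩⟩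
    exact Continuous.rpow_const (by fun_prop) fun x => Or.inl (by positivity)
  have hψm : AEStronglyMeasurable ψ (μ.map Neg.neg) := by
    have e : ψ = (starRingEnd ℂ) ∘ ψ ∘ Neg.neg := by
      ext ξ
      simp [hh]
    have h2 : AEStronglyMeasurable (ψ ∘ Neg.neg) (μ.map Neg.neg) := by
      have e2 : μ = (μ.map Neg.neg).map Neg.neg := by
        rw [Measure.map_map measurable_neg measurable_neg]
        simp
      have h3 := hψ.1
      rw [e2] at h3
      exact h3.comp_measurable measurable_neg
    rw [e]
    exact Complex.continuous_conj.comp_aestronglyMeasurable h2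
  have hψ2 : MemLp ψ 2 m := by
    rw [memLp_two_iff_integrable_sq_norm (aestronglyMeasurable_add_measure_iff.2 ⟨hψ.1, hψm⟩)]
    have h2 := (memLp_two_iff_integrable_sq_norm hψ.1).1 hψ
    refine integrable_add_measure.2 ⟨h2, ?_⟩
    refine (integrable_map_measure (hψm.norm.pow 2) measurable_neg.aemeasurable).2 ?_
    simpa [Function.comp_def, hh] using h2
  obtain ⟨ρ, hρ⟩ := exists_schwartz_near m hψ2 hε
  -- The Hermitian part of `ρ`. As `ψ` is Hermitian, its error is the average of the error of `ρ`
  -- and of the reflected conjugate of that error.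
  set η : 𝓢(Space d, ℂ) := (2⁻¹ : ℂ) • (ρ + conjNeg ρ) with hη
  have hη1 : ∀ ξ, η (-ξ) = (starRingEnd ℂ) (η ξ) := by
    intro ξ
    have h2 : (starRingEnd ℂ) 2⁻¹ = 2⁻¹ := by rw [map_inv₀, map_ofNat]
    simp only [hη, smul_apply, add_apply, conjNeg_apply, neg_neg, smul_eq_mul, map_mul, map_add,
      Complex.conj_conj, h2]
    ring
  refine ⟨schwartzFourierInv η, conj_schwartzFourierInv hη1, ?_⟩
  rw [fourierT_coe, schwartzFourier_schwartzFourierInv]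
  set u : Space d → ℂ := (ρ : Space d → ℂ) - ψ with hu
  have hum : AEStronglyMeasurable u m := ρ.continuous.aestronglyMeasurable.sub hψ2.1
  have hum1 := (aestronglyMeasurable_add_measure_iff.1 hum).1
  have hum2 := (aestronglyMeasurable_add_measure_iff.1 hum).2
  have hum3 : AEStronglyMeasurable (fun ξ => (starRingEnd ℂ) (u (-ξ))) μ :=
    Complex.continuous_conj.comp_aestronglyMeasurable (hum2.comp_measurable measurable_neg)
  have e1 : (η : Space d → ℂ) - ψ = (2⁻¹ : ℂ) • (u + fun ξ => (starRingEnd ℂ) (u (-ξ))) := by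
    ext ξ
    simp only [hη, hu, Pi.sub_apply, Pi.smul_apply, Pi.add_apply, smul_apply,
      add_apply, conjNeg_apply, map_sub, hh, Complex.conj_conj, smul_eq_mul]
    ring
  have e2 : eLpNorm (fun ξ => (starRingEnd ℂ) (u (-ξ))) 2 μ = eLpNorm u 2 (μ.map Neg.neg) := by
    rw [eLpNorm_map_measure hum2 measurable_neg.aemeasurable]
    exact eLpNorm_congr_norm_ae (Eventually.of_forall fun ξ => by simp)
  have h3 : eLpNorm u 2 μ ≤ ε := (eLpNorm_mono_measure _ (Measure.le_add_right le_rfl)).trans hρ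
  have h4 : eLpNorm u 2 (μ.map Neg.neg) ≤ ε :=
    (eLpNorm_mono_measure _ (Measure.le_add_left le_rfl)).trans hρ
  rw [e1, eLpNorm_const_smul]
  have h5 := eLpNorm_add_le hum1 hum3 (p := 2) (by norm_num)
  rw [e2] at h5
  have h6 : ‖(2⁻¹ : ℂ)‖ₑ = 2⁻¹ := by
    rw [enorm_inv (by norm_num)]
    simp [← ofReal_norm]
  calc _ ≤ 2⁻¹ * (ε + ε) := by
        rw [h6]
        gcongr
        exact h5.trans (add_le_add h3 h4)
    _ = ε := by
        rw [← two_mul, ← mul_assoc, ENNReal.inv_mul_cancel (by norm_num) (by norm_num), one_mul]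

theorem approx_hermitian (h : IsSpectralMeasure Γ μ) (t : ℝ≥0) {ψ : Space d → ℂ}
    (hψ : MemLp ψ 2 μ) (hh : ∀ ξ, ψ (-ξ) = (starRingEnd ℂ) (ψ ξ)) :
    Approx h fun p => (Set.Icc (0 : ℝ) t).indicator (fun _ => (1 : ℂ)) p.1 * ψ p.2 := by
  have hε : ∀ n : ℕ, ((n + 1 : ℕ) : ℝ≥0∞)⁻¹ ≠ 0 := fun n => by simp
  choose φ hφ1 hφ2 using fun n : ℕ => exists_schwartz_fourier_near h hψ hh (hε n)
  refine Approx.of_tendsto_snd (memLp_indicator_Icc _) (fun n => ?_)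
    (fun n => approx_schwartz h t (φ n) (hφ1 n)) hψ ?_
  · rw [fourierT_coe]
    exact (schwartzFourier (φ n)).continuous.aestronglyMeasurable
  · exact tendsto_of_tendsto_of_tendsto_of_le_of_le tendsto_const_nhds
      (ENNReal.tendsto_inv_nat_nhds_zero.comp (tendsto_add_atTop_nat 1)) (fun _ => zero_le) hφ2

theorem approx_hermitian_Ioc (h : IsSpectralMeasure Γ μ) {a b : ℝ} (ha : 0 ≤ a) (hab : a ≤ b)
    {ψ : Space d → ℂ} (hψ : MemLp ψ 2 μ) (hh : ∀ ξ, ψ (-ξ) = (starRingEnd ℂ) (ψ ξ)) :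
    Approx h fun p => (Set.Ioc a b).indicator (fun _ => ψ p.2) p.1 := by
  lift a to ℝ≥0 using ha
  lift b to ℝ≥0 using a.2.trans hab
  refine ((approx_hermitian h b hψ hh).sub (approx_hermitian h a hψ hh)).congr ?_
  have h0 : ∀ᵐ s ∂(volume.restrict (Set.Ici (0 : ℝ))), 0 ≤ s :=
    ae_restrict_mem measurableSet_Ici
  have := h.temperate_spectral
  have := sigmaFinite_of_hasTemperateGrowth μ
  filter_upwards [Measure.quasiMeasurePreserving_fst.ae h0] with p hp
  simp only [Pi.sub_apply, Set.indicator, Set.mem_Icc, Set.mem_Ioc, hp, true_and]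
  by_cases h1 : p.1 ≤ a
  · simp [h1, h1.trans hab, not_lt.2 h1]
  · simp [h1, not_le.1 h1]

end

end FracKinetic
end

noncomputable section

namespace FracKinetic

/-! ### The canonical integrand is a limit of elementary functions -/

theorem tendsto_eLpNorm_two_of_dominated {X : Type*} [MeasurableSpace X] {m : Measure X}
    {f : ℕ → X → ℂ} {g : X → ℂ} (hf : ∀ n, AEStronglyMeasurable (f n) m) (hg : MemLp g 2 m)
    (hb : ∀ n, ∀ᵐ x ∂m, ‖f n x‖ ≤ ‖g x‖)
    (ht : ∀ᵐ x ∂m, Tendsto (fun n => f n x) atTop (𝓝 (g x))) :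
    Tendsto (fun n => eLpNorm (f n - g) 2 m) atTop (𝓝 0) := by
  simp only [eLpNorm_eq_lintegral_rpow_enorm_toReal (p := 2) (by norm_num) (by norm_num)]
  have h1 : Tendsto (fun n => ∫⁻ x, ‖(f n - g) x‖ₑ ^ (2 : ℝ≥0∞).toReal ∂m) atTop
      (𝓝 (∫⁻ _, 0 ∂m)) := by
    refine tendsto_lintegral_of_dominated_convergence'
      (fun x => ‖(2 : ℂ) * g x‖ₑ ^ (2 : ℝ≥0∞).toReal)
      (fun n => ((hf n).sub hg.1).enorm.pow_const _) (fun n => ?_) ?_ ?_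
    · filter_upwards [hb n] with x hx
      refine ENNReal.rpow_le_rpow (enorm_le_iff_norm_le.2 ?_) ENNReal.toReal_nonneg
      rw [Pi.sub_apply, norm_mul, Complex.norm_ofNat]
      exact (norm_sub_le _ _).trans (by linarith)
    · have := (hg.const_mul (2 : ℂ)).2
      rw [eLpNorm_lt_top_iff_lintegral_rpow_enorm_lt_top (by norm_num) (by norm_num)] at this
      exact this.ne
    · filter_upwards [ht] with x hx
      have h2 : Tendsto (fun n => (f n - g) x) atTop (𝓝 0) := by
        simpa using hx.sub_const (g x)
      have h3 := (ENNReal.continuous_rpow_const (y := (2 : ℝ≥0∞).toReal)).tendsto (0 : ℝ≥0∞)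
      rw [ENNReal.zero_rpow_of_pos (by norm_num)] at h3
      refine h3.comp ?_
      simpa using h2.enorm
  rw [lintegral_zero] at h1
  have h3 := (ENNReal.continuous_rpow_const (y := 1 / (2 : ℝ≥0∞).toReal)).tendsto (0 : ℝ≥0∞)
  rw [ENNReal.zero_rpow_of_pos (by norm_num)] at h3
  exact h3.comp h1

/-- The left end point of the interval `(δ k, δ (k + 1)]` which contains `s`. -/
def leftEnd (δ s : ℝ) : ℝ := δ * ((⌈s / δ⌉₊ : ℝ) - 1)

theorem leftEnd_eq {δ s : ℝ} (hδ : 0 < δ) {k : ℕ} (hs : s ∈ Set.Ioc (δ * k) (δ * (k + 1 : ℕ))) :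
    leftEnd δ s = δ * k := by
  have h1 : ⌈s / δ⌉₊ = k + 1 := by
    rw [Nat.ceil_eq_iff (by simp), lt_div_iff₀ hδ, div_le_iff₀ hδ]
    constructor
    · have := hs.1
      rw [mul_comm] at this
      simpa using this
    · rw [mul_comm]
      exact hs.2
  rw [leftEnd, h1]
  push_cast
  ring

theorem sum_indicator_Ioc {δ : ℝ} (hδ : 0 < δ) (F : ℝ → ℂ) (m : ℕ) (s : ℝ) :
    ∑ k ∈ Finset.range m, (Set.Ioc (δ * k) (δ * (k + 1 : ℕ))).indicator (fun _ => F (δ * k)) s =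
      (Set.Ioc 0 (δ * m)).indicator (fun s => F (leftEnd δ s)) s := by
  induction m with
  | zero => simp
  | succ m ih =>
    rw [Finset.sum_range_succ, ih]
    have h0 : 0 ≤ δ * m := by positivity
    have h1 : δ * m ≤ δ * (m + 1 : ℕ) := by
      gcongr
      simp
    by_cases hs : s ∈ Set.Ioc (δ * m) (δ * (m + 1 : ℕ))
    · rw [Set.indicator_of_notMem (fun h => not_lt.2 h.2 hs.1), Set.indicator_of_mem hs,
        Set.indicator_of_mem (s := Set.Ioc 0 (δ * (m + 1 : ℕ))) ⟨h0.trans_lt hs.1, hs.2⟩,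
        leftEnd_eq hδ hs, zero_add]
    · rw [Set.indicator_of_notMem hs, add_zero]
      by_cases hs2 : s ∈ Set.Ioc 0 (δ * m)
      · rw [Set.indicator_of_mem hs2, Set.indicator_of_mem
          (s := Set.Ioc 0 (δ * (m + 1 : ℕ))) ⟨hs2.1, hs2.2.trans h1⟩]
      · rw [Set.indicator_of_notMem hs2, Set.indicator_of_notMem]
        rintro ⟨h2, h3⟩
        rcases le_or_gt s (δ * m) with h4 | h4
        · exact hs2 ⟨h2, h4⟩
        · exact hs ⟨h4, h3⟩

theorem leftEnd_lt {δ s : ℝ} (hδ : 0 < δ) (hs : 0 < s) : leftEnd δ s < s := by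
  have h := Nat.ceil_lt_add_one (div_pos hs hδ).le
  have : δ * ((⌈s / δ⌉₊ : ℝ) - 1) < δ * (s / δ) := by
    gcongr
    linarith
  rwa [mul_div_cancel₀ _ hδ.ne'] at this

theorem sub_le_leftEnd {δ : ℝ} (hδ : 0 < δ) (s : ℝ) : s - δ ≤ leftEnd δ s := by
  have h : δ * (s / δ) ≤ δ * (⌈s / δ⌉₊ : ℝ) := by
    gcongr
    exact Nat.le_ceil _
  rw [mul_div_cancel₀ _ hδ.ne'] at h
  rw [leftEnd, mul_sub, mul_one]
  linarith

section
variable {d : ℕ} {α β γ ν : ℝ} {Γ μ : Measure (Space d)}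

/-- Time is discretised with mesh `t/(n+1)`, each `s` being replaced by the left end of its cell.
Left ends matter twice. They stay below `t`, so the frozen kernel is taken at a positive time and
lies in `L²(μ)`. They also increase `t - s`, so by monotonicity of the kernel the step functions are
dominated by `canon` itself. -/
theorem approx_canon (hα : 0 < α) (hβ0 : 0 < β) (hβ1 : β < 1) (hγ : 0 ≤ γ) (hν : 0 < ν)
    (h : IsSpectralMeasure Γ μ) (hμ : SpectralIntegrability α β γ μ) {t : ℝ} (ht : 0 < t)
    (x : Space d) : Approx h fun p => canon α β γ ν t x p.1 p.2 := by
  have := h.temperate_spectral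
  have := sigmaFinite_of_hasTemperateGrowth μ
  set F : Space d → ℝ → ℂ := fun ξ s =>
    Complex.exp (-(Complex.I * ((inner ℝ x ξ : ℝ) : ℂ))) * (kern α β γ ν (t - s) ξ : ℂ) with hF
  have hFc : ∀ ξ, Continuous (F ξ) := fun ξ => by
    have h1 : Continuous fun s : ℝ => kern α β γ ν (t - s) ξ :=
      (continuous_kern hα hβ0 hβ1).comp (by fun_prop : Continuous fun s : ℝ => (t - s, ξ))
    fun_prop
  have hFc2 : ∀ s, Continuous fun ξ => F ξ s := fun s => by
    have h1 : Continuous fun ξ : Space d => kern α β γ ν (t - s) ξ :=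
      (continuous_kern hα hβ0 hβ1).comp (by fun_prop : Continuous fun ξ : Space d => (t - s, ξ))
    fun_prop
  have hFn : ∀ ξ s, s ≤ t → ‖F ξ s‖ = kern α β γ ν (t - s) ξ := fun ξ s hs => by
    rw [hF, norm_mul, norm_cexp_neg_I_mul, one_mul, Complex.norm_real,
      Real.norm_of_nonneg (kern_pos hβ0 hβ1 hν (sub_nonneg.2 hs) ξ).le]
  have hFL : ∀ s, s < t → MemLp (fun ξ => F ξ s) 2 μ := fun s hs =>
    (memLp_kern hα hβ0 hβ1 hγ hν hμ (sub_pos.2 hs)).congr_norm (hFc2 s).aestronglyMeasurable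
      (Eventually.of_forall fun ξ => by
        rw [hFn ξ s hs.le, Complex.norm_real,
          Real.norm_of_nonneg (kern_pos hβ0 hβ1 hν (sub_nonneg.2 hs.le) ξ).le])
  have hFh : ∀ s ξ, F (-ξ) s = (starRingEnd ℂ) (F ξ s) := fun s ξ => by
    simp only [hF, kern_neg, map_mul, Complex.conj_ofReal, ← Complex.exp_conj, map_neg,
      Complex.conj_I, inner_neg_right]
    push_cast
    ring_nf
  set δ : ℕ → ℝ := fun n => t / (n + 1 : ℕ) with hδ
  have hδ0 : ∀ n, 0 < δ n := fun n => by positivity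
  have hδt : ∀ n, δ n * (n + 1 : ℕ) = t := fun n => div_mul_cancel₀ _ (by positivity)
  have hstep : ∀ n, Approx h fun p => (Set.Ioc 0 t).indicator
      (fun s => F p.2 (leftEnd (δ n) s)) p.1 := by
    intro n
    have h1 := Approx.sum (h := h) (n + 1) (f := fun k p =>
      (Set.Ioc (δ n * k) (δ n * (k + 1 : ℕ))).indicator (fun _ => F p.2 (δ n * k)) p.1) ?_
    · simp only [sum_indicator_Ioc (hδ0 n), hδt] at h1
      exact h1
    · intro k hk
      have h2 : δ n * k < t := by
        rw [← hδt n]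
        have := hδ0 n
        gcongr
      refine approx_hermitian_Ioc h (by have := hδ0 n; positivity) ?_ (hFL _ h2) (hFh _)
      have := hδ0 n
      gcongr
      simp
  refine Approx.of_tendsto hstep (memLp_canon hα hβ0 hβ1 hγ hν h hμ ht x) ?_
  have h0 : ∀ᵐ s ∂(volume.restrict (Set.Ici (0 : ℝ))), s ≠ 0 :=
    ae_restrict_of_ae (Measure.ae_ne volume 0)
  have h0' := Measure.quasiMeasurePreserving_fst (ν := μ).ae h0
  have hcm : ∀ p : ℝ × Space d, p.1 ∈ Set.Ioc 0 t → canon α β γ ν t x p.1 p.2 = F p.2 p.1 :=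
    fun p hp => Set.indicator_of_mem (Set.Ioc_subset_Icc_self hp) _
  refine tendsto_eLpNorm_two_of_dominated (fun n => (hstep n).1.1)
    (memLp_canon hα hβ0 hβ1 hγ hν h hμ ht x) (fun n => Eventually.of_forall fun p => ?_) ?_
  · by_cases hp : p.1 ∈ Set.Ioc 0 t
    · have h1 := leftEnd_lt (hδ0 n) hp.1
      rw [Set.indicator_of_mem hp, hcm p hp, hFn _ _ hp.2, hFn _ _ (h1.le.trans hp.2)]
      exact kern_antitone hβ0 hβ1 hν (sub_nonneg.2 hp.2) (by linarith) _
    · rw [Set.indicator_of_notMem hp, norm_zero]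
      exact norm_nonneg _
  · filter_upwards [h0'] with p hp0
    by_cases hp : p.1 ∈ Set.Ioc 0 t
    · simp only [Set.indicator_of_mem hp, hcm p hp]
      refine ((hFc p.2).tendsto _).comp ?_
      have h1 : Tendsto (fun n => p.1 - δ n) atTop (𝓝 p.1) := by
        have h2 : Tendsto δ atTop (𝓝 0) :=
          (tendsto_const_div_atTop_nhds_zero_nat t).comp (tendsto_add_atTop_nat 1)
        simpa using h2.const_sub p.1
      exact tendsto_of_tendsto_of_tendsto_of_le_of_le h1 tendsto_const_nhds
        (fun n => sub_le_leftEnd (hδ0 n) _) fun n => (leftEnd_lt (hδ0 n) hp.1).le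
    · have h1 : canon α β γ ν t x p.1 p.2 = 0 := Set.indicator_of_notMem
        (fun h2 => hp ⟨lt_of_le_of_ne h2.1 (Ne.symm hp0), h2.2⟩) _
      simp only [Set.indicator_of_notMem hp, h1]
      exact tendsto_const_nhds

theorem isElementaryLimit_canon (hα : 0 < α) (hβ0 : 0 < β) (hβ1 : β < 1) (hγ : 0 ≤ γ) (hν : 0 < ν)
    (h : IsSpectralMeasure Γ μ) (hμ : SpectralIntegrability α β γ μ) {t : ℝ} (ht : 0 ≤ t)
    (x : Space d) : IsElementaryLimit μ fun p => canon α β γ ν t x p.1 p.2 := by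
  rcases ht.eq_or_lt with rfl | ht
  · refine ((approx_zero h).congr ?_).isElementaryLimit
    have := h.temperate_spectral
    have := sigmaFinite_of_hasTemperateGrowth μ
    have h0 : ∀ᵐ s ∂(volume.restrict (Set.Ici (0 : ℝ))), s ≠ 0 :=
      ae_restrict_of_ae (Measure.ae_ne volume 0)
    filter_upwards [Measure.quasiMeasurePreserving_fst (ν := μ).ae h0] with p hp
    rw [canon, Set.indicator_of_notMem (by simpa using hp), Pi.zero_apply]
  · exact (approx_canon hα hβ0 hβ1 hγ hν h hμ ht x).isElementaryLimit

end

/-! ### Fourier transforms of tempered distributions -/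

section
variable {d : ℕ}

theorem HasFourier.unique {T : 𝓢'(Space d, ℂ)} {g k : Space d → ℂ} (hg : HasFourier T g)
    (hk : HasFourier T k) : g = k := by
  have h1 : ∀ᵐ ξ, g ξ - k ξ = 0 := by
    refine ae_eq_zero_of_integral_contDiff_smul_eq_zero
      (hg.continuous.sub hk.continuous).locallyIntegrable fun f hf hfc => ?_
    have hf' : ContDiff ℝ ((⊤ : ℕ∞) : WithTop ℕ∞) fun x => (f x : ℂ) :=
      Complex.ofRealCLM.contDiff.comp hf
    have hfc' : HasCompactSupport fun x => (f x : ℂ) :=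
      hfc.comp_left (g := fun r : ℝ => (r : ℂ)) Complex.ofReal_zero
    set φ : 𝓢(Space d, ℂ) := hfc'.toSchwartzMap hf' with hφ
    have h2 : ∀ x, φ x = f x := fun x => rfl
    have h3 := (hg.apply_fourier φ).symm.trans (hk.apply_fourier φ)
    rw [← sub_eq_zero, ← integral_sub (hg.integrable φ) (hk.integrable φ)] at h3
    rw [← h3]
    refine integral_congr_ae (Eventually.of_forall fun x => ?_)
    simp only [h2, Complex.real_smul]
    ring
  have h2 : (fun ξ => g ξ - k ξ) = fun _ => 0 :=
    (Continuous.ae_eq_iff_eq volume (hg.continuous.sub hk.continuous) continuous_const).1 h1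
  ext ξ
  exact sub_eq_zero.1 (congrFun h2 ξ)

theorem schwartzFourierInv_reflShift (x y : Space d) (φ : 𝓢(Space d, ℂ)) :
    schwartzFourierInv (reflShift x (schwartzFourier φ)) y =
      Complex.exp (Complex.I * ((inner ℝ x y : ℝ) : ℂ)) * φ (-y) := by
  have e0 : φ (-y) = 𝓕⁻ (𝓕 φ : 𝓢(Space d, ℂ)) (-y) := by
    rw [FourierTransform.fourierInv_fourier_eq]
  rw [e0, schwartzFourierInv, SchwartzMap.fourierInv_coe, SchwartzMap.fourierInv_coe,
    Real.fourierInv_eq', Real.fourierInv_eq', ← integral_const_mul,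
    ← integral_sub_left_eq_self _ _ ((2 * Real.pi)⁻¹ • x)]
  refine integral_congr_ae (Eventually.of_forall fun v => ?_)
  have hpi : (Real.pi : ℂ) ≠ 0 := by exact_mod_cast Real.pi_ne_zero
  have hpi' : Real.pi ≠ 0 := Real.pi_ne_zero
  have e1 : SchwartzMap.compCLMOfContinuousLinearEquiv ℂ (dilation d).symm
      (reflShift x (schwartzFourier φ)) ((2 * Real.pi)⁻¹ • x - v) = 𝓕 φ v := by
    have e2 : reflShift x (schwartzFourier φ) ((dilation d).symm ((2 * Real.pi)⁻¹ • x - v)) =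
        𝓕 φ (dilation d (x - (dilation d).symm ((2 * Real.pi)⁻¹ • x - v))) := by
      rw [reflShift_apply]
      rfl
    refine e2.trans (congrArg _ ?_)
    rw [map_sub, ContinuousLinearEquiv.apply_symm_apply]
    have e3 : dilation d x = (2 * Real.pi)⁻¹ • x := rfl
    rw [e3, sub_sub_cancel]
  beta_reduce
  rw [e1, smul_eq_mul, smul_eq_mul, ← mul_assoc, ← Complex.exp_add]
  congr 2
  rw [inner_sub_left, inner_smul_left, inner_neg_right]
  simp only [conj_trivial]
  push_cast
  field_simp
  ring

/-- Duality: reflecting and translating the test function multiplies its inverse transform by a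
character and reflects it, by `schwartzFourierInv_reflShift`. -/
theorem HasFourier.reflDist {T : 𝓢'(Space d, ℂ)} {g : Space d → ℂ} (hg : HasFourier T g)
    (x : Space d) : HasFourier (reflDist x T)
      fun ξ => Complex.exp (-(Complex.I * ((inner ℝ x ξ : ℝ) : ℂ))) * g (-ξ) := by
  have e : ∀ (φ : 𝓢(Space d, ℂ)) (ξ : Space d),
      Complex.exp (-(Complex.I * ((inner ℝ x ξ : ℝ) : ℂ))) * g (-ξ) * φ ξ =
        g (-ξ) * schwartzFourierInv (reflShift x (schwartzFourier φ)) (-ξ) := fun φ ξ => by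
    rw [schwartzFourierInv_reflShift, neg_neg, inner_neg_right]
    push_cast
    rw [mul_neg]
    ring
  refine ⟨?_, fun φ => ?_, fun φ => ?_⟩
  · have := hg.continuous
    fun_prop
  · simp only [e]
    exact (hg.integrable (schwartzFourierInv (reflShift x (schwartzFourier φ)))).comp_neg
  · simp only [e]
    rw [integral_neg_eq_self (fun ξ => g ξ * schwartzFourierInv
      (reflShift x (schwartzFourier φ)) ξ), ← hg.apply_fourier,
      schwartzFourier_schwartzFourierInv, reflDist_apply]

/-- `schwartzFourierInv` as a continuous linear map. -/
def schwartzFourierInvCLM (d : ℕ) : 𝓢(Space d, ℂ) →L[ℂ] 𝓢(Space d, ℂ) :=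
  (FourierTransform.fourierInvCLM ℂ 𝓢(Space d, ℂ)).comp
    (SchwartzMap.compCLMOfContinuousLinearEquiv ℂ (dilation d).symm)

/-- The bounded function `g` is itself a tempered distribution; precomposing it with the inverse
transform on test functions gives the required `T`. -/
theorem exists_hasFourier {g : Space d → ℂ} (hg : Continuous g) {C : ℝ} (hC : ∀ ξ, ‖g ξ‖ ≤ C) :
    ∃ T : 𝓢'(Space d, ℂ), HasFourier T g := by
  have hL : MemLp g ⊤ (volume : Measure (Space d)) :=
    memLp_top_of_bound hg.aestronglyMeasurable C (Eventually.of_forall hC)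
  refine ⟨PointwiseConvergenceCLM.precomp ℂ (schwartzFourierInvCLM d)
    (Lp.toTemperedDistribution hL.toLp), hg, fun φ => ?_, fun φ => ?_⟩
  · exact φ.integrable.bdd_mul hg.aestronglyMeasurable (Eventually.of_forall hC)
  · have h1 : PointwiseConvergenceCLM.precomp ℂ (schwartzFourierInvCLM d)
        (Lp.toTemperedDistribution hL.toLp) (schwartzFourier φ) =
        Lp.toTemperedDistribution hL.toLp (schwartzFourierInv (schwartzFourier φ)) := rfl
    rw [h1, schwartzFourierInv_schwartzFourier, Lp.toTemperedDistribution_apply]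
    refine integral_congr_ae ?_
    filter_upwards [hL.coeFn_toLp] with ξ hξ
    rw [hξ, smul_eq_mul, mul_comm]

end

end FracKinetic
end

noncomputable section

namespace FracKinetic

/-! ### The fundamental solution and the stochastic convolution -/

section
variable {d : ℕ} {α β γ ν : ℝ}

theorem kern_eq_relax (τ : ℝ) (ξ : Space d) :
    kern α β γ ν τ ξ = relax β (ν * symb α γ ξ) τ := by
  rw [kern, relax]
  ring_nf

/-- Uniqueness of the Caputo problem, frequency by frequency, leaves `kern` as the only possible
transform. -/
theorem IsFundamentalSolution.hasFourier (hβ0 : 0 < β) (hβ1 : β < 1)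
    {G : ℝ → 𝓢'(Space d, ℂ)} (hG : IsFundamentalSolution α β γ ν G) {t : ℝ} (ht : 0 ≤ t) :
    HasFourier (G t) fun ξ => (kern α β γ ν t ξ : ℂ) := by
  obtain ⟨g, hg, hgt⟩ := hG
  have h1 : g t = fun ξ => (kern α β γ ν t ξ : ℂ) := by
    ext ξ
    obtain ⟨hc, h0, hD⟩ := hgt ξ
    rw [kern_eq_relax]
    exact caputo_unique hβ0 hβ1 (ν * symb α γ ξ) hc h0 hD t ht
  rw [← h1]
  exact hg t ht

theorem exists_isFundamentalSolution (hα : 0 < α) (hβ0 : 0 < β) (hβ1 : β < 1) (hν : 0 < ν) :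
    ∃ G : ℝ → 𝓢'(Space d, ℂ), IsFundamentalSolution α β γ ν G := by
  have h1 : ∀ t : ℝ, ∃ T : 𝓢'(Space d, ℂ),
      0 ≤ t → HasFourier T fun ξ => (kern α β γ ν t ξ : ℂ) := by
    intro t
    by_cases ht : 0 ≤ t
    · have hc : Continuous fun ξ : Space d => kern α β γ ν t ξ :=
        (continuous_kern hα hβ0 hβ1).comp (by fun_prop : Continuous fun ξ : Space d => (t, ξ))
      obtain ⟨T, hT⟩ := exists_hasFourier (Complex.continuous_ofReal.comp hc) (C := 1) fun ξ => by
        rw [Function.comp, Complex.norm_real,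
          Real.norm_of_nonneg (kern_pos hβ0 hβ1 hν ht ξ).le]
        exact kern_le_one hβ0 hβ1 hν ht ξ
      exact ⟨T, fun _ => hT⟩
    -- Negative times play no role; any distribution serves.
    · exact ⟨0, fun h => absurd h ht⟩
  choose G hG using h1
  refine ⟨G, fun t ξ => (kern α β γ ν t ξ : ℂ), hG, fun ξ => ?_⟩
  simp only [kern_eq_relax]
  refine ⟨(continuous_ofReal_relax hβ0 hβ1 _).continuousOn, ?_, fun t ht =>
    hasCaputoDerivAt_relax hβ0 hβ1 _ ht⟩
  rw [relax_zero hβ0, Complex.ofReal_one]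

theorem hasFourier_reflDist_canon (hβ0 : 0 < β) (hβ1 : β < 1)
    {G : ℝ → 𝓢'(Space d, ℂ)} (hG : IsFundamentalSolution α β γ ν G) {t s : ℝ}
    (hs : s ∈ Set.Icc 0 t) (x : Space d) :
    HasFourier (reflDist x (G (t - s))) (canon α β γ ν t x s) := by
  have h1 := (hG.hasFourier hβ0 hβ1 (sub_nonneg.2 hs.2)).reflDist x
  simp only [kern_neg] at h1
  have h2 : canon α β γ ν t x s = fun ξ => Complex.exp (-(Complex.I * ((inner ℝ x ξ : ℝ) : ℂ))) *
      (kern α β γ ν (t - s) ξ : ℂ) := funext fun ξ => Set.indicator_of_mem hs _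
  rwa [h2]

theorem canon_of_notMem {t s : ℝ} (hs : s ∉ Set.Icc 0 t) (x : Space d) :
    canon α β γ ν t x s = 0 :=
  funext fun _ => Set.indicator_of_notMem hs _

variable {Ω : Type*} [MeasurableSpace Ω] {P : Measure Ω} {Γ μ : Measure (Space d)}
  {W : ℝ≥0 → BddBorel d → Ω → ℝ}

/-- A continuous Fourier transform is determined by its distribution at every point, so the
existentially quantified integrand can only be `canon`. -/
theorem isStochasticConvolution_iff (hβ0 : 0 < β) (hβ1 : β < 1)
    {G : ℝ → 𝓢'(Space d, ℂ)} (hG : IsFundamentalSolution α β γ ν G) (t : ℝ) (x : Space d)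
    (X : Ω → ℝ) : IsStochasticConvolution P μ W G t x X ↔
      IsWienerIntegral P μ W (canon α β γ ν t x) X := by
  constructor
  · rintro ⟨h, h1, h2, h3⟩
    have e : h = canon α β γ ν t x := by
      ext s ξ
      by_cases hs : s ∈ Set.Icc 0 t
      · rw [(h1 s hs).unique (hasFourier_reflDist_canon hβ0 hβ1 hG hs x)]
      · rw [h2 s hs, canon_of_notMem hs]
    rwa [← e]
  · intro h
    exact ⟨_, fun s hs => hasFourier_reflDist_canon hβ0 hβ1 hG hs x,
      fun s hs => canon_of_notMem hs x, h⟩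

theorem canon_mul_conj (t s : ℝ) (x z ξ : Space d) :
    canon α β γ ν t z s ξ * (starRingEnd ℂ) (canon α β γ ν t x s ξ) =
      (Set.Icc 0 t).indicator (fun s => Complex.exp (Complex.I * ((inner ℝ (x - z) ξ : ℝ) : ℂ)) *
        ((kern α β γ ν (t - s) ξ ^ 2 : ℝ) : ℂ)) s := by
  by_cases hs : s ∈ Set.Icc 0 t
  · rw [canon, canon, Set.indicator_of_mem hs, Set.indicator_of_mem hs, Set.indicator_of_mem hs]
    have e : Complex.exp (Complex.I * ((inner ℝ (x - z) ξ : ℝ) : ℂ)) =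
        Complex.exp (-(Complex.I * ((inner ℝ z ξ : ℝ) : ℂ))) *
          Complex.exp (Complex.I * ((inner ℝ x ξ : ℝ) : ℂ)) := by
      rw [← Complex.exp_add, inner_sub_left]
      push_cast
      ring_nf
    rw [e]
    simp only [map_mul, Complex.conj_ofReal, ← Complex.exp_conj, map_neg, Complex.conj_I]
    push_cast
    ring_nf
  · rw [canon_of_notMem hs, Set.indicator_of_notMem hs, Pi.zero_apply, zero_mul]

theorem integral_canon_mul_conj {t : ℝ} (ht : 0 ≤ t) (x z ξ : Space d) :
    ∫ s in Set.Ici (0 : ℝ), canon α β γ ν t z s ξ * (starRingEnd ℂ) (canon α β γ ν t x s ξ) =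
      Complex.exp (Complex.I * ((inner ℝ (x - z) ξ : ℝ) : ℂ)) *
        ((∫ s in (0 : ℝ)..t, kern α β γ ν (t - s) ξ ^ 2 : ℝ) : ℂ) := by
  simp only [canon_mul_conj]
  rw [integral_indicator measurableSet_Icc, Measure.restrict_restrict measurableSet_Icc,
    Set.inter_eq_left.2 fun s hs => hs.1, integral_const_mul, integral_complex_ofReal,
    integral_Icc_eq_integral_Ioc, intervalIntegral.integral_of_le ht]

/-- The second moment is an inner product of two copies of `canon`, integrated in time first. The
pairing is taken in the order `z`, then conjugated `x`, so that the phases combine to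
`e^{i⟨x-z,ξ⟩}`. Absolute convergence in `ξ` is part of Fubini. -/
theorem covariance_canon [IsProbabilityMeasure P] (h : IsSpectralMeasure Γ μ)
    (hW : IsNoise P Γ W) {t : ℝ} (ht : 0 ≤ t) {x z : Space d} {X Z : Ω → ℝ}
    (hX : IsWienerIntegral P μ W (canon α β γ ν t x) X)
    (hZ : IsWienerIntegral P μ W (canon α β γ ν t z) Z)
    (hX0 : ∫ ω, X ω ∂P = 0) :
    Integrable (fun ξ : Space d => Complex.exp (Complex.I * ((inner ℝ (x - z) ξ : ℝ) : ℂ)) *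
        ((∫ s in (0 : ℝ)..t, kern α β γ ν (t - s) ξ ^ 2 : ℝ) : ℂ)) μ ∧
      ((cov[X, Z; P] : ℝ) : ℂ) =
        ∫ ξ : Space d, Complex.exp (Complex.I * ((inner ℝ (x - z) ξ : ℝ) : ℂ)) *
          ((∫ s in (0 : ℝ)..t, kern α β γ ν (t - s) ξ ^ 2 : ℝ) : ℂ) ∂μ := by
  have := h.temperate_spectral
  have := sigmaFinite_of_hasTemperateGrowth μ
  have hconj : MemLp (fun p : ℝ × Space d =>
      (starRingEnd ℂ) (canon α β γ ν t x p.1 p.2)) 2 (spaceTime μ) := hX.1.star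
  have hint : Integrable (fun p : ℝ × Space d => canon α β γ ν t z p.1 p.2 *
      (starRingEnd ℂ) (canon α β γ ν t x p.1 p.2)) (spaceTime μ) := hZ.1.integrable_mul hconj
  have e : (fun ξ => ∫ s in Set.Ici (0 : ℝ), canon α β γ ν t z s ξ *
      (starRingEnd ℂ) (canon α β γ ν t x s ξ)) = _ :=
    funext fun ξ => integral_canon_mul_conj ht x z ξ
  have hi := hint.integral_prod_right
  have hs := integral_prod_symm _ hint
  dsimp only at hi hs
  rw [e] at hi hs
  refine ⟨hi, ?_⟩
  rw [← hs, covariance_eq_sub hX.2.1 hZ.2.1, hX0, zero_mul, sub_zero]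
  refine Eq.trans ?_ (integral_mul_of_isWienerIntegral h hW hZ hX)
  congr 2
  ext ω
  exact mul_comm _ _

theorem isStationaryField_of_isWienerIntegral [IsProbabilityMeasure P]
    (h : IsSpectralMeasure Γ μ) (hW : IsNoise P Γ W)
    {t : ℝ} (ht : 0 ≤ t) {U : Space d → Ω → ℝ}
    (hU : ∀ x, IsWienerIntegral P μ W (canon α β γ ν t x) (U x)) : IsStationaryField P U := by
  obtain ⟨hg, h0⟩ := isGaussianProcess_of_isWienerIntegral hW hU
  intro a n x
  refine identDistrib_of_covariance_eq hg h0 (fun i => x i + a) x fun i j => ?_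
  have h1 := (covariance_canon h hW ht (hU (x i + a)) (hU (x j + a)) (h0 _)).2
  have h2 := (covariance_canon h hW ht (hU (x i)) (hU (x j)) (h0 _)).2
  rw [add_sub_add_right_eq_sub, ← h2] at h1
  exact Complex.ofReal_injective h1

end

end FracKinetic
end

/-! ### The main theorem -/

theorem mainTheorem5 {d : ℕ} {Ω : Type*} [MeasurableSpace Ω]
    (P : Measure Ω) [IsProbabilityMeasure P]
    (α β γ ν : ℝ) (hα : 0 < α) (hβ0 : 0 < β) (hβ1 : β < 1) (hγ : 0 ≤ γ) (hν : 0 < ν)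
    (Γ μ : Measure (FracKinetic.Space d)) (hΓμ : FracKinetic.IsSpectralMeasure Γ μ)
    (hμ : FracKinetic.SpectralIntegrability α β γ μ)
    (W : ℝ≥0 → FracKinetic.BddBorel d → Ω → ℝ) (hW : FracKinetic.IsNoise P Γ W) :
    -- the fundamental solution exists
    (∃ G : ℝ → 𝓢'(FracKinetic.Space d, ℂ), FracKinetic.IsFundamentalSolution α β γ ν G) ∧
    ∀ G : ℝ → 𝓢'(FracKinetic.Space d, ℂ), FracKinetic.IsFundamentalSolution α β γ ν G →
    ∀ t : ℝ, 0 ≤ t →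
      -- the stochastic integral `U(t,x)` is well defined for every `x`
      (∃ U : FracKinetic.Space d → Ω → ℝ,
        ∀ x, FracKinetic.IsStochasticConvolution P μ W G t x (U x)) ∧
      ∀ U : FracKinetic.Space d → Ω → ℝ,
        (∀ x, FracKinetic.IsStochasticConvolution P μ W G t x (U x)) →
        -- centered Gaussian field
        IsGaussianProcess U P ∧
        (∀ x, ∫ ω, U x ω ∂P = 0) ∧
        -- spatial covariance
        (∀ x z : FracKinetic.Space d,
          Integrable (fun ξ : FracKinetic.Space d =>
            Complex.exp (Complex.I * ((inner ℝ (x - z) ξ : ℝ) : ℂ)) *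
              ((∫ s in (0 : ℝ)..t, FracKinetic.mittagLeffler β
                (-(ν * (t - s) ^ β * FracKinetic.symb α γ ξ)) ^ 2 : ℝ) : ℂ)) μ ∧
          ((cov[U x, U z; P] : ℝ) : ℂ) =
            ∫ ξ : FracKinetic.Space d,
              Complex.exp (Complex.I * ((inner ℝ (x - z) ξ : ℝ) : ℂ)) *
                ((∫ s in (0 : ℝ)..t, FracKinetic.mittagLeffler β
                  (-(ν * (t - s) ^ β * FracKinetic.symb α γ ξ)) ^ 2 : ℝ) : ℂ) ∂μ) ∧
        -- stationarity in space
        FracKinetic.IsStationaryField P U := by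
  refine ⟨FracKinetic.exists_isFundamentalSolution hα hβ0 hβ1 hν, fun G hG t ht => ⟨?_, ?_⟩⟩
  · have hex := fun x => FracKinetic.exists_isWienerIntegral hΓμ hW
      (FracKinetic.isElementaryLimit_canon hα hβ0 hβ1 hγ hν hΓμ hμ ht x)
    choose U hU using hex
    exact ⟨U, fun x => (FracKinetic.isStochasticConvolution_iff hβ0 hβ1 hG t x _).2 (hU x)⟩
  · intro U hU
    have hU' := fun x => (FracKinetic.isStochasticConvolution_iff hβ0 hβ1 hG t x _).1 (hU x)
    obtain ⟨hg, h0⟩ := FracKinetic.isGaussianProcess_of_isWienerIntegral hW hU'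
    exact ⟨hg, h0, fun x z => FracKinetic.covariance_canon hΓμ hW ht
      (hU' x) (hU' z) (h0 x),
      FracKinetic.isStationaryField_of_isWienerIntegral hΓμ hW ht hU'⟩
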